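/- **Setting.** Write points of $\mathbb R^{1+3}$ as $(t,x)$ with $r=|x|$, $\omega=x/r$, $\widehat\omega=(\widehat\omega_0,\dots,\widehat\omega_3)=(-1,\omega)$, $\partial_0=\partial_t$, $\partial_i=\partial_{x_i}$ for $i=1,2,3$, $\partial=(\partial_0,\dots,\partial_3)$, $\partial_r=\sum_{i=1}^3\omega_i\partial_i$ and $\Box=-\partial_t^2+\Delta_x$. For $T,\rho\in\mathbb R$ let $$\Omega_{T,\rho}=\{(t,x)\in\mathbb R^{1+3}:\ t\ge T,\ |x|-t>\rho\},$$ and for $0<\delta<1/2$ and $t>0$ let $$f_\delta(t,x)=|x|-t-\delta^{-1}t^{-\delta}.$$ Fix the number $N$ of components. **Hypotheses.** Let $R,R''\in\mathbb R$ with $R''<R$, let $0<\gamma,\gamma'\le 1$, $T_s>|R''|+1$ and $C_1,C_2\in\mathbb R$. Let $V^{I,\alpha}_J$ and $W^I_J$ ($I,J=1,\dots,N$, $\alpha=0,1,2,3$) be continuous real functions on $\Omega_{T_s,R''}$ such that, for all $(t,x)\in\Omega_{T_s,R''}$, $$\sum_{I,J=1}^N\sum_{\alpha=0}^3|V^{I,\alpha}_J|\le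 C_1(1+t+r)^{-1},$$ $$\sum_{I,J=1}^N\Big|\sum_{\alpha=0}^3V^{I,\alpha}_J\widehat\omega_\alpha\Big|+\sum_{I,J=1}^N|W^I_J|\le C_1(1+t+r)^{-1-\gamma}.$$ Let $\phi=(\phi^I)\in C^2(\Omega_{T_s,R''};\mathbb R^N)$ (one-sided derivatives on $t=T_s$) solve, on $\Omega_{T_s,R''}$, $$\Box\phi^I+\sum_{J=1}^N\sum_{\alpha=0}^3V^{I,\alpha}_J\partial_\alpha\phi^J+\sum_{J=1}^NW^I_J\phi^J=0,\qquad I=1,\dots,N.$$ Assume that $\phi=0$ at all points of $\Omega_{T_s,R''}$ with $r-t\ge R$, and that on $\Omega_{T_s,R''}$ $$|\phi|+|\partial\phi|\le C_2(1+t+r)^{-3/2-\gamma'},\qquad |(\partial_t+\partial_r)\phi|\le C_2(1+t+r)^{-5/2-\gamma'}.$$ **Conclusion.** For every sufficiently large $T_0$ and every sufficiently small $\delta>0$, one has $\phi(t,x)=0$ for all $(t,x)\in\Omega_{T_0,R''}$ with $f_\delta(t,x)\ge R''$. Here "sufficiently large" means $T_0\ge T_{\min}$ for some $T_{\min}\ge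 T_s$ depending only on $T_s,R,R'',C_1,C_2,\gamma,\gamma'$ (and $N$), and "sufficiently small" means $0<\delta<\delta_0$ for some $\delta_0\in(0,1/2]$ depending only on $T_0,R,R''$ (and $N$). In particular, $T_{\min}$ and $\delta_0$ do not depend on $V$, $W$ or $\phi$. -/

import Mathlib

/-- Points `(t, x)` of `ℝ^{1+3}`, with `x` in Euclidean three-space. -/
abbrev Spacetime : Type := ℝ × EuclideanSpace ℝ (Fin 3)

/-- The region `Ω_{T,R} = {(t, x) : t ≥ T, |x| - t > R}`. -/
def region (T R : ℝ) : Set Spacetime :=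
  {z | T ≤ z.1 ∧ R < ‖z.2‖ - z.1}

/-- `f_δ(t, x) = |x| - t - δ⁻¹ t^{-δ}`. -/
noncomputable def fDelta (δ : ℝ) (z : Spacetime) : ℝ :=
  ‖z.2‖ - z.1 - δ⁻¹ * z.1 ^ (-δ)

/-- The coordinate directions: index `0` is time, indices `1, 2, 3` are space. -/
noncomputable def coordDir (α : Fin 4) : Spacetime :=
  Fin.cases (1, 0) (fun i => (0, EuclideanSpace.single i 1)) α

/-- The partial derivative `∂_α u` on a set `S` (one-sided where the boundary of `S` belongs
to `S`, the ordinary one at interior points). -/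
noncomputable def partialOn {F : Type*} [NormedAddCommGroup F] [NormedSpace ℝ F]
    (S : Set Spacetime) (α : Fin 4) (u : Spacetime → F) (z : Spacetime) : F :=
  fderivWithin ℝ u S z (coordDir α)

/-- The wave operator `□ = -∂_t² + ∂_1² + ∂_2² + ∂_3²`. -/
noncomputable def waveOp (S : Set Spacetime) (u : Spacetime → ℝ) (z : Spacetime) : ℝ :=
  -partialOn S 0 (partialOn S 0 u) z
    + ∑ i : Fin 3, partialOn S i.succ (partialOn S i.succ u) z

/-- The radial derivative `∂_r = ∑ i, (x_i / |x|) ∂_i`. -/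
noncomputable def radialOn {F : Type*} [NormedAddCommGroup F] [NormedSpace ℝ F]
    (S : Set Spacetime) (u : Spacetime → F) (z : Spacetime) : F :=
  ∑ i : Fin 3, (z.2 i / ‖z.2‖) • partialOn S i.succ u z

/-- The length `|∂u| = (∑ α, |∂_α u|²)^{1/2}` of the full spacetime gradient. -/
noncomputable def gradNormOn {F : Type*} [NormedAddCommGroup F] [NormedSpace ℝ F]
    (S : Set Spacetime) (u : Spacetime → F) (z : Spacetime) : ℝ :=
  Real.sqrt (∑ α : Fin 4, ‖partialOn S α u z‖ ^ 2)

/-- The covector `ω̂ = (-1, x / |x|)`. -/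
noncomputable def omegaHat (z : Spacetime) (α : Fin 4) : ℝ :=
  Fin.cases (-1) (fun i => z.2 i / ‖z.2‖) α

/-- The `I`-th component of the linear operator
`(□̃φ)^I = □φ^I + ∑_{J,α} V_J^{I,α} ∂_α φ^J + ∑_J W_J^I φ^J`;
`V I J α` stands for `V_J^{I,α}` and `W I J` for `W_J^I`. -/
noncomputable def perturbedWaveOp {N : ℕ} (S : Set Spacetime)
    (V : Fin N → Fin N → Fin 4 → Spacetime → ℝ) (W : Fin N → Fin N → Spacetime → ℝ)
    (φ : Spacetime → EuclideanSpace ℝ (Fin N)) (I : Fin N) (z : Spacetime) : ℝ :=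
  waveOp S (fun y => φ y I) z
    + ∑ J : Fin N, ∑ α : Fin 4, V I J α z * partialOn S α (fun y => φ y J) z
    + ∑ J : Fin N, W I J z * φ z J

/-!
The proof is a Carleman estimate in the null coordinates `p = t + |x|` and `q = |x| - t`, with the
weight `f = q - δ⁻¹ p^{-δ}` (`weight`). Since `t < p`, this function is larger than `f_δ`, so it is
enough to show that the solution vanishes where `f > R''`. Replacing `t` by `p` has the advantage
that `∂_p ∂_q f = 0` and that `f` is constant on spheres.

The operator `r □ r⁻¹` is `4 ∂_p ∂_q + r⁻² Δ_{S²}` (`nullWave_radius_mul`), and conjugation with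
`e^{l f}` turns it into `nullWave v + 4 l² a v - 4 l Z v`, where `a = p^{-1-δ}` and
`Z = a ∂_q + ∂_p` (`conjWave_exp_weight_mul`). Multiplication by `-p^{3/2} Z v` and integration
against `r⁻² dx dt`, a measure that `∂_p`, `∂_q` and the rotations preserve, leads to an inequality
without error terms (`carleman_inequality`): the rotational terms are positive where `q ≤ r / 4`,
and `∂_p (p^{3/2} a) > 0` controls `(∂_q v)² + l² v²`.

It is applied to `v = e^{l f} χ r φ`, where the cutoff `χ` restricts to `f ≥ c₀` and `p ≤ 2 T`.
Where `χ` is locally constant, the lower-order terms of the equation are absorbed for large `l`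
(`WaveSystem.absorption`). The extra decay of the coefficient `V · ω̂` of the transversal
derivative `∂_q φ` is needed there, because the weight that multiplies `(∂_q v)²` in the estimate
is the smallest. Elsewhere `χ r φ` is sent by the wave operator to a function of size `p^{-3/2}`,
uniformly in `T` (`WaveSystem.abs_nullWave_cutoff_le`), and `r⁻² p^{-3/2}` is integrable between
two light cones (`integrableOn_shell`). So the energy is bounded by a multiple of `e^{2 l c₁}`, plus
`e^{2 l R}` times the integral over `p ≥ T`. If `φ` did not vanish at some point with
`f > c₂ > c₁`, the energy would be at least a multiple of `e^{2 l c₂}`; letting first `T → ∞` and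
then `l → ∞` gives a contradiction (`WaveSystem.eq_zero_of_lt_weight`).

On the support of `χ φ` one needs `t ≥ T₀`, although the estimate only sees `p`. This is the reason
for the smallness of `δ`: if `q ≤ R` and `p` is bounded in terms of `T₀`, then
`f ≤ R - δ⁻¹ p^{-δ} ≤ R''` (`weight_le_of_outCoord_lt`).
-/

open MeasureTheory Filter Topology

/-! ### The null frame and its commutation relations -/

/-- The vector field `c ∂_t + ½ ∂_r`, that is, `z ↦ (c, x / (2|x|))`. For `c = ½` it is the
coordinate field `∂_p` and for `c = -½` the coordinate field `∂_q` of the null coordinates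
`p = |x| + t`, `q = |x| - t`. -/
noncomputable def nullField (c : ℝ) (z : Spacetime) : Spacetime :=
  (c, (2 * ‖z.2‖)⁻¹ • z.2)

/-- The rotation field `x_i ∂_j - x_j ∂_i`. -/
noncomputable def rotField (i j : Fin 3) (z : Spacetime) : Spacetime :=
  (0, z.2 i • EuclideanSpace.single j 1 - z.2 j • EuclideanSpace.single i 1)

/-- The derivative of `u` along the vector field `X`. -/
noncomputable def along (X : Spacetime → Spacetime) (u : Spacetime → ℝ) (z : Spacetime) : ℝ :=
  fderiv ℝ u z (X z)

/-- The outgoing null derivative `∂_p = ½ (∂_r + ∂_t)`. -/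
noncomputable def Dout (u : Spacetime → ℝ) (z : Spacetime) : ℝ := along (nullField (1 / 2)) u z

/-- The ingoing null derivative `∂_q = ½ (∂_r - ∂_t)`. -/
noncomputable def Din (u : Spacetime → ℝ) (z : Spacetime) : ℝ := along (nullField (-(1 / 2))) u z

/-- The rotational derivative `Ω_{ij} = x_i ∂_j - x_j ∂_i`. -/
noncomputable def Drot (i j : Fin 3) (u : Spacetime → ℝ) (z : Spacetime) : ℝ :=
  along (rotField i j) u z

theorem DifferentiableAt.hasDerivAt_along {u : Spacetime → ℝ} {z : Spacetime}
    (hu : DifferentiableAt ℝ u z) (X : Spacetime → Spacetime) :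
    HasDerivAt (fun s : ℝ => u (z + s • X z)) (along X u z) 0 :=
  hu.hasFDerivAt.hasLineDerivAt (X z)

/-- A derivative along `X` may be computed on the line through the point in direction `X`. -/
theorem along_eq_of_hasDerivAt {u : Spacetime → ℝ} {z : Spacetime} {X : Spacetime → Spacetime}
    {d : ℝ} (hu : DifferentiableAt ℝ u z)
    (h : HasDerivAt (fun s : ℝ => u (z + s • X z)) d 0) : along X u z = d :=
  (hu.hasDerivAt_along X).unique h

theorem hasDerivAt_norm_line {x : EuclideanSpace ℝ (Fin 3)} (hx : x ≠ 0)
    (h : EuclideanSpace ℝ (Fin 3)) :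
    HasDerivAt (fun s : ℝ => ‖x + s • h‖) (inner ℝ x h / ‖x‖) 0 := by
  have h1 : HasDerivAt (fun s : ℝ => x + s • h) h 0 := by
    simpa using ((hasDerivAt_id (0 : ℝ)).smul_const h).const_add x
  have h2 := h1.norm_sq
  have h3 := h2.sqrt (by simpa using hx)
  simp only [zero_smul, add_zero, Real.sqrt_sq (norm_nonneg _)] at h3
  convert h3 using 1
  field_simp

theorem inner_rotField (i j : Fin 3) (z : Spacetime) : inner ℝ z.2 (rotField i j z).2 = 0 := by
  simp [rotField, inner_sub_right, inner_smul_right, EuclideanSpace.inner_single_right]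
  ring

theorem hasDerivAt_radius_nullField {z : Spacetime} (hz : z.2 ≠ 0) (c : ℝ) :
    HasDerivAt (fun s : ℝ => ‖(z + s • nullField c z).2‖) (1 / 2) 0 := by
  have h := hasDerivAt_norm_line hz (nullField c z).2
  have hr : ‖z.2‖ ≠ 0 := norm_ne_zero_iff.mpr hz
  refine h.congr_deriv ?_
  simp only [nullField, inner_smul_right, real_inner_self_eq_norm_sq]
  field_simp

theorem hasDerivAt_radius_rotField {z : Spacetime} (hz : z.2 ≠ 0) (i j : Fin 3) :
    HasDerivAt (fun s : ℝ => ‖(z + s • rotField i j z).2‖) 0 0 := by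
  have h := hasDerivAt_norm_line hz (rotField i j z).2
  simpa [inner_rotField] using h

theorem hasDerivAt_time_line (z h : Spacetime) :
    HasDerivAt (fun s : ℝ => (z + s • h).1) h.1 0 := by
  simpa using ((hasDerivAt_id (0 : ℝ)).mul_const h.1).const_add z.1

theorem hasDerivAt_coord_line (z h : Spacetime) (i : Fin 3) :
    HasDerivAt (fun s : ℝ => (z + s • h).2 i) (h.2 i) 0 := by
  simpa using ((hasDerivAt_id (0 : ℝ)).mul_const (h.2 i)).const_add (z.2 i)

theorem contDiffAt_radius {n : WithTop ℕ∞} {z : Spacetime} (hz : z.2 ≠ 0) :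
    ContDiffAt ℝ n (fun y : Spacetime => ‖y.2‖) z :=
  contDiffAt_snd.norm ℝ hz

theorem contDiffAt_nullField {n : WithTop ℕ∞} {z : Spacetime} (hz : z.2 ≠ 0) (c : ℝ) :
    ContDiffAt ℝ n (nullField c) z := by
  have hr : 2 * ‖z.2‖ ≠ 0 := by simpa using hz
  exact contDiffAt_const.prodMk
    (((contDiffAt_const.mul (contDiffAt_radius hz)).inv hr).smul contDiffAt_snd)

theorem contDiff_coord {n : WithTop ℕ∞} (i : Fin 3) :
    ContDiff ℝ n (fun y : Spacetime => y.2 i) :=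
  (EuclideanSpace.proj i : EuclideanSpace ℝ (Fin 3) →L[ℝ] ℝ).contDiff.comp contDiff_snd

theorem contDiff_rotField {n : WithTop ℕ∞} (i j : Fin 3) :
    ContDiff ℝ n (rotField i j) :=
  contDiff_const.prodMk
    (((contDiff_coord i).smul contDiff_const).sub ((contDiff_coord j).smul contDiff_const))

theorem ContDiffAt.along {n m : WithTop ℕ∞} {u : Spacetime → ℝ} {X : Spacetime → Spacetime}
    {z : Spacetime} (hu : ContDiffAt ℝ n u z) (hX : ContDiffAt ℝ m X z) (hmn : m + 1 ≤ n) :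
    ContDiffAt ℝ m (along X u) z :=
  (hu.fderiv_right hmn).clm_apply hX

/-- Second derivatives along vector fields, in terms of the Hessian. -/
theorem along_along {u : Spacetime → ℝ} {X Y : Spacetime → Spacetime} {z Y' : Spacetime}
    (hu : ContDiffAt ℝ 2 u z) (hY : DifferentiableAt ℝ Y z)
    (hY' : HasDerivAt (fun s : ℝ => Y (z + s • X z)) Y' 0) :
    along X (along Y u) z = fderiv ℝ (fderiv ℝ u) z (X z) (Y z) + fderiv ℝ u z Y' := by
  have h1 : DifferentiableAt ℝ (fderiv ℝ u) z :=
    (hu.fderiv_right (m := 1) (by norm_num)).differentiableAt (by norm_num)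
  have h2 := h1.hasFDerivAt.clm_apply hY.hasFDerivAt
  have h3 : fderiv ℝ Y z (X z) = Y' := (hY.hasFDerivAt.hasLineDerivAt (X z)).unique hY'
  have h4 : fderiv ℝ (along Y u) z = _ := h2.fderiv
  unfold along at h4 ⊢
  rw [h4]
  simp [h3, add_comm]

theorem fderiv_fderiv_comm {u : Spacetime → ℝ} {z : Spacetime}
    (hu : ContDiffAt ℝ 2 u z) (a b : Spacetime) :
    fderiv ℝ (fderiv ℝ u) z a b = fderiv ℝ (fderiv ℝ u) z b a :=
  hu.isSymmSndFDerivAt (by simp) a b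

theorem hasDerivAt_nullField_nullField {z : Spacetime} (hz : z.2 ≠ 0) (c d : ℝ) :
    HasDerivAt (fun s : ℝ => nullField d (z + s • nullField c z)) 0 0 := by
  have hr : ‖z.2‖ ≠ 0 := norm_ne_zero_iff.mpr hz
  have h1 := ((hasDerivAt_radius_nullField hz c).const_mul 2).inv (by simpa using hr)
  have h2 : HasDerivAt (fun s : ℝ => (z + s • nullField c z).2) (nullField c z).2 0 := by
    simpa using ((hasDerivAt_id (0 : ℝ)).smul_const (nullField c z).2).const_add z.2
  have h3 := (hasDerivAt_const (0 : ℝ) d).prodMk (h1.smul h2)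
  refine h3.congr_deriv (Prod.ext rfl ?_)
  simp only [nullField, zero_smul, add_zero, Pi.inv_apply, smul_smul]
  rw [← add_smul]
  have : (2 * ‖z.2‖)⁻¹ * (2 * ‖z.2‖)⁻¹ + -(2 * (1 / 2)) / (2 * ‖z.2‖) ^ 2 = 0 := by
    field_simp
    ring
  rw [this, zero_smul]
  rfl

theorem hasDerivAt_nullField_rotField {z : Spacetime} (hz : z.2 ≠ 0) (c : ℝ) (i j : Fin 3) :
    HasDerivAt (fun s : ℝ => nullField c (z + s • rotField i j z))
      (0, (2 * ‖z.2‖)⁻¹ • (rotField i j z).2) 0 := by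
  have hr : ‖z.2‖ ≠ 0 := norm_ne_zero_iff.mpr hz
  have h1 := ((hasDerivAt_radius_rotField hz i j).const_mul 2).inv (by simpa using hr)
  have h2 : HasDerivAt (fun s : ℝ => (z + s • rotField i j z).2) (rotField i j z).2 0 := by
    simpa using ((hasDerivAt_id (0 : ℝ)).smul_const (rotField i j z).2).const_add z.2
  have h3 := (hasDerivAt_const (0 : ℝ) c).prodMk (h1.smul h2)
  exact h3.congr_deriv (by simp)

theorem hasDerivAt_rotField_line (z h : Spacetime) (i j : Fin 3) :
    HasDerivAt (fun s : ℝ => rotField i j (z + s • h)) (rotField i j h) 0 :=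
  (hasDerivAt_const (0 : ℝ) (0 : ℝ)).prodMk
    (((hasDerivAt_coord_line z h i).smul_const _).sub ((hasDerivAt_coord_line z h j).smul_const _))

theorem along_nullField_comm {u : Spacetime → ℝ} {z : Spacetime} (hu : ContDiffAt ℝ 2 u z)
    (hz : z.2 ≠ 0) (c d : ℝ) :
    along (nullField c) (along (nullField d) u) z =
      along (nullField d) (along (nullField c) u) z := by
  rw [along_along hu ((contDiffAt_nullField (n := 1) hz d).differentiableAt (by norm_num))
      (hasDerivAt_nullField_nullField hz c d),
    along_along hu ((contDiffAt_nullField (n := 1) hz c).differentiableAt (by norm_num))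
      (hasDerivAt_nullField_nullField hz d c), fderiv_fderiv_comm hu]

theorem along_rotField_nullField_comm {u : Spacetime → ℝ} {z : Spacetime}
    (hu : ContDiffAt ℝ 2 u z) (hz : z.2 ≠ 0) (c : ℝ) (i j : Fin 3) :
    along (rotField i j) (along (nullField c) u) z =
      along (nullField c) (along (rotField i j) u) z := by
  rw [along_along hu ((contDiffAt_nullField (n := 1) hz c).differentiableAt (by norm_num))
      (hasDerivAt_nullField_rotField hz c i j),
    along_along hu ((contDiff_rotField (n := 1) i j).contDiffAt.differentiableAt (by norm_num))
      (hasDerivAt_rotField_line z _ i j), fderiv_fderiv_comm hu]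
  congr 2
  simp [rotField, nullField, smul_sub, smul_smul]

/-! ### Integration by parts -/

/-- `F` is of class `C^n` at every point of `K` and vanishes off `K`. For closed `K` such an `F` is
`C^n` everywhere; the point of the notion is that it is stable under products with functions
that are smooth at the points of `K` only. -/
def SmoothOnSupport (n : WithTop ℕ∞) (K : Set Spacetime) (F : Spacetime → ℝ) : Prop :=
  (∀ z ∈ K, ContDiffAt ℝ n F z) ∧ ∀ z ∉ K, F z = 0

namespace SmoothOnSupport

variable {n m : WithTop ℕ∞} {K : Set Spacetime} {F G : Spacetime → ℝ}

theorem eventuallyEq_zero (hF : SmoothOnSupport n K F) (hK : IsClosed K) {z : Spacetime}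
    (hz : z ∉ K) : F =ᶠ[𝓝 z] 0 := by
  filter_upwards [hK.isOpen_compl.mem_nhds hz] with y hy using hF.2 y hy

theorem contDiff (hF : SmoothOnSupport n K F) (hK : IsClosed K) : ContDiff ℝ n F := by
  rw [contDiff_iff_contDiffAt]
  intro z
  by_cases hz : z ∈ K
  · exact hF.1 z hz
  · exact contDiffAt_const.congr_of_eventuallyEq (hF.eventuallyEq_zero hK hz)

theorem integrable (hF : SmoothOnSupport n K F) (hK : IsCompact K) : Integrable F :=
  (hF.contDiff hK.isClosed).continuous.integrable_of_hasCompactSupport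
    (HasCompactSupport.intro hK hF.2)

theorem of_le (hF : SmoothOnSupport n K F) (h : m ≤ n) : SmoothOnSupport m K F :=
  ⟨fun z hz => (hF.1 z hz).of_le h, hF.2⟩

theorem add (hF : SmoothOnSupport n K F) (hG : SmoothOnSupport n K G) :
    SmoothOnSupport n K (fun z => F z + G z) :=
  ⟨fun z hz => (hF.1 z hz).add (hG.1 z hz), fun z hz => by simp [hF.2 z hz, hG.2 z hz]⟩

theorem sub (hF : SmoothOnSupport n K F) (hG : SmoothOnSupport n K G) :
    SmoothOnSupport n K (fun z => F z - G z) :=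
  ⟨fun z hz => (hF.1 z hz).sub (hG.1 z hz), fun z hz => by simp [hF.2 z hz, hG.2 z hz]⟩

theorem mul_left (hF : SmoothOnSupport n K F) (hG : ∀ z ∈ K, ContDiffAt ℝ n G z) :
    SmoothOnSupport n K (fun z => G z * F z) :=
  ⟨fun z hz => (hG z hz).mul (hF.1 z hz), fun z hz => by simp [hF.2 z hz]⟩

theorem const_mul (hF : SmoothOnSupport n K F) (c : ℝ) :
    SmoothOnSupport n K (fun z => c * F z) :=
  hF.mul_left fun _ _ => contDiffAt_const

theorem mul (hF : SmoothOnSupport n K F) (hG : SmoothOnSupport n K G) :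
    SmoothOnSupport n K (fun z => F z * G z) :=
  hG.mul_left hF.1

theorem sq (hF : SmoothOnSupport n K F) : SmoothOnSupport n K (fun z => F z ^ 2) := by
  simpa only [pow_two] using hF.mul hF

theorem sum {ι : Type*} {s : Finset ι} {F : ι → Spacetime → ℝ}
    (hF : ∀ i ∈ s, SmoothOnSupport n K (F i)) :
    SmoothOnSupport n K (fun z => ∑ i ∈ s, F i z) :=
  ⟨fun z hz => ContDiffAt.sum fun i hi => (hF i hi).1 z hz,
    fun z hz => Finset.sum_eq_zero fun i hi => (hF i hi).2 z hz⟩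

theorem along (hF : SmoothOnSupport n K F) (hK : IsClosed K) {X : Spacetime → Spacetime}
    (hX : ∀ z ∈ K, ContDiffAt ℝ m X z) (hmn : m + 1 ≤ n) :
    SmoothOnSupport m K (along X F) := by
  refine ⟨fun z hz => (hF.1 z hz).along (hX z hz) hmn, fun z hz => ?_⟩
  have h : fderiv ℝ F z = 0 := by
    rw [(hF.eventuallyEq_zero hK hz).fderiv_eq]
    simp
  simp [_root_.along, h]

end SmoothOnSupport

instance instIsAddHaarMeasureSpacetime : (volume : Measure Spacetime).IsAddHaarMeasure :=
  inferInstanceAs (((volume : Measure ℝ).prod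
    (volume : Measure (EuclideanSpace ℝ (Fin 3)))).IsAddHaarMeasure)

theorem integral_fderiv_eq_zero {F : Spacetime → ℝ} (hF : ContDiff ℝ 1 F)
    (hc : HasCompactSupport F) (e : Spacetime) : ∫ z, fderiv ℝ F z e = 0 := by
  have h := integral_mul_fderiv_eq_neg_fderiv_mul_of_integrable (μ := (volume : Measure Spacetime))
    (f := fun _ : Spacetime => (1 : ℝ)) (g := F) (v := e) (by simp)
    (by
      simp only [one_mul]
      exact ((hF.continuous_fderiv (by norm_num)).clm_apply
        continuous_const).integrable_of_hasCompactSupport (hc.fderiv_apply ℝ e))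
    (by simpa using hF.continuous.integrable_of_hasCompactSupport hc)
    (fun _ _ => differentiableAt_const _)
    (fun x _ => hF.contDiffAt.differentiableAt (by norm_num))
  simpa using h

theorem coordDir_succ_snd (i : Fin 3) :
    (coordDir i.succ).2 = EuclideanSpace.single i 1 := rfl

theorem eq_sum_coordDir (h : Spacetime) :
    h = h.1 • coordDir 0 + ∑ i : Fin 3, h.2 i • coordDir i.succ := by
  refine Prod.ext (by simp [coordDir, Prod.fst_sum]) ?_
  ext k
  fin_cases k <;> simp [coordDir, Fin.sum_univ_three]

/-- The divergence theorem for a compactly supported multiple `F Y` of a divergence-free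
vector field `Y`. -/
theorem integral_along_eq_zero {K : Set Spacetime} (hK : IsCompact K) {F : Spacetime → ℝ}
    (hF : SmoothOnSupport 1 K F) {Y : Spacetime → Spacetime} (hY : ∀ z ∈ K, ContDiffAt ℝ 1 Y z)
    (hdiv : ∀ z ∈ K, ∃ (d₀ : ℝ) (d : Fin 3 → ℝ),
      HasDerivAt (fun s : ℝ => (Y (z + s • coordDir 0)).1) d₀ 0 ∧
      (∀ i, HasDerivAt (fun s : ℝ => (Y (z + s • coordDir i.succ)).2 i) (d i) 0) ∧
      d₀ + ∑ i, d i = 0) :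
    ∫ z, along Y F z = 0 := by
  have hc : ∀ {G : Spacetime → ℝ}, SmoothOnSupport 1 K G → ∀ e, ∫ z, fderiv ℝ G z e = 0 :=
    fun hG e => integral_fderiv_eq_zero (hG.contDiff hK.isClosed)
      (HasCompactSupport.intro hK hG.2) e
  have hi : ∀ {G : Spacetime → ℝ}, SmoothOnSupport 1 K G → ∀ e,
      Integrable fun z => fderiv ℝ G z e :=
    fun hG e => ((hG.along hK.isClosed (m := 0) (X := fun _ => e)
      (fun _ _ => contDiffAt_const) (by norm_num)).integrable hK)
  have hY0 : ∀ z ∈ K, ContDiffAt ℝ 1 (fun y => (Y y).1) z := fun z hz => (hY z hz).fst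
  have hYi : ∀ i : Fin 3, ∀ z ∈ K, ContDiffAt ℝ 1 (fun y => (Y y).2 i) z := fun i z hz =>
    (contDiff_coord i).contDiffAt.comp z (hY z hz)
  have h0 := hF.mul_left hY0
  have h1 := fun i => hF.mul_left (hYi i)
  have key : ∀ z, along Y F z = fderiv ℝ (fun y => (Y y).1 * F y) z (coordDir 0)
      + ∑ i : Fin 3, fderiv ℝ (fun y => (Y y).2 i * F y) z (coordDir i.succ) := by
    intro z
    by_cases hz : z ∈ K
    · obtain ⟨d₀, d, hd₀, hd, hsum⟩ := hdiv z hz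
      have hFz : DifferentiableAt ℝ F z := (hF.1 z hz).differentiableAt (by norm_num)
      have e0 : fderiv ℝ (fun y => (Y y).1 * F y) z (coordDir 0)
          = d₀ * F z + (Y z).1 * fderiv ℝ F z (coordDir 0) := by
        have a := ((h0.1 z hz).differentiableAt (by norm_num)).hasDerivAt_along
          (fun _ => coordDir 0)
        have b := hd₀.mul (hFz.hasDerivAt_along (fun _ => coordDir 0))
        simpa [along] using a.unique b
      have e1 : ∀ i : Fin 3, fderiv ℝ (fun y => (Y y).2 i * F y) z (coordDir i.succ)
          = d i * F z + (Y z).2 i * fderiv ℝ F z (coordDir i.succ) := by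
        intro i
        have a := (((h1 i).1 z hz).differentiableAt (by norm_num)).hasDerivAt_along
          (fun _ => coordDir i.succ)
        have b := (hd i).mul (hFz.hasDerivAt_along (fun _ => coordDir i.succ))
        simpa [along] using a.unique b
      have e2 : along Y F z = (Y z).1 * fderiv ℝ F z (coordDir 0)
          + ∑ i : Fin 3, (Y z).2 i * fderiv ℝ F z (coordDir i.succ) := by
        unfold along
        conv_lhs => rw [eq_sum_coordDir (Y z)]
        simp
      rw [e2, e0, Finset.sum_congr rfl fun i _ => e1 i, Finset.sum_add_distrib, ← Finset.sum_mul]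
      linear_combination (-F z) * hsum
    · have hz' : ∀ {G : Spacetime → ℝ}, SmoothOnSupport 1 K G → fderiv ℝ G z = 0 := by
        intro G hG
        rw [(hG.eventuallyEq_zero hK.isClosed hz).fderiv_eq]
        simp
      simp [along, hz' hF, hz' h0, fun i => hz' (h1 i)]
  simp_rw [key]
  rw [integral_add (hi h0 _) (integrable_finsetSum _ fun i _ => hi (h1 i) _),
    integral_finsetSum _ fun i _ => hi (h1 i) _, hc h0]
  simp [fun i => hc (h1 i)]

theorem along_smul (c : Spacetime → ℝ) (X : Spacetime → Spacetime) (F : Spacetime → ℝ)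
    (z : Spacetime) : along (fun y => c y • X y) F z = c z * along X F z := by
  simp [along]

theorem hasDerivAt_radius_coordDir {z : Spacetime} (hz : z.2 ≠ 0) (i : Fin 3) :
    HasDerivAt (fun s : ℝ => ‖(z + s • coordDir i.succ).2‖) (z.2 i / ‖z.2‖) 0 := by
  have h := hasDerivAt_norm_line hz (coordDir i.succ).2
  refine h.congr_deriv ?_
  simp [coordDir, EuclideanSpace.inner_single_right]

theorem norm_sq_eq_sum (x : EuclideanSpace ℝ (Fin 3)) :
    ‖x‖ ^ 2 = x 0 ^ 2 + x 1 ^ 2 + x 2 ^ 2 := by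
  rw [EuclideanSpace.norm_sq_eq, Fin.sum_univ_three]
  simp

/-- In polar coordinates `|x|^{-2} dx dt` is `dt dr dω`, which the null fields preserve. -/
theorem integral_along_nullField {K : Set Spacetime} (hK : IsCompact K)
    (hr : ∀ z ∈ K, z.2 ≠ 0) {F : Spacetime → ℝ} (hF : SmoothOnSupport 1 K F) (c : ℝ) :
    ∫ z, (‖z.2‖ ^ 2)⁻¹ * along (nullField c) F z = 0 := by
  simp_rw [← along_smul (fun y : Spacetime => (‖y.2‖ ^ 2)⁻¹) (nullField c) F]
  refine integral_along_eq_zero hK hF (fun z hz => ?_) (fun z hz => ?_)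
  · have h0 : ‖z.2‖ ^ 2 ≠ 0 := by simpa using hr z hz
    exact (((contDiffAt_radius (hr z hz)).pow 2).inv h0).smul (contDiffAt_nullField (hr z hz) c)
  · have h0 : ‖z.2‖ ≠ 0 := by simpa using hr z hz
    refine ⟨0, fun i => 1 / (2 * ‖z.2‖ ^ 3) - 3 * z.2 i ^ 2 / (2 * ‖z.2‖ ^ 5), ?_, fun i => ?_, ?_⟩
    · simpa [nullField, coordDir] using hasDerivAt_const (0 : ℝ) ((‖z.2‖ ^ 2)⁻¹ * c)
    · have hrad := hasDerivAt_radius_coordDir (hr z hz) i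
      have h1 := (hrad.pow 2).inv (by simpa using hr z hz)
      have h2 := (hrad.const_mul 2).inv (by simpa using hr z hz)
      have h3 := h1.mul (h2.mul (hasDerivAt_coord_line z (coordDir i.succ) i))
      refine h3.congr_deriv ?_
      simp [coordDir]
      field_simp
      ring
    · have := norm_sq_eq_sum z.2
      rw [Fin.sum_univ_three]
      field_simp
      linear_combination 3 * this

theorem integral_along_rotField {K : Set Spacetime} (hK : IsCompact K)
    (hr : ∀ z ∈ K, z.2 ≠ 0) {F : Spacetime → ℝ} (hF : SmoothOnSupport 1 K F) (i j : Fin 3) :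
    ∫ z, (‖z.2‖ ^ 2)⁻¹ * along (rotField i j) F z = 0 := by
  simp_rw [← along_smul (fun y : Spacetime => (‖y.2‖ ^ 2)⁻¹) (rotField i j) F]
  refine integral_along_eq_zero hK hF (fun z hz => ?_) (fun z hz => ?_)
  · have h0 : ‖z.2‖ ^ 2 ≠ 0 := by simpa using hr z hz
    exact (((contDiffAt_radius (hr z hz)).pow 2).inv h0).smul (contDiff_rotField i j).contDiffAt
  · have h0 : ‖z.2‖ ≠ 0 := by simpa using hr z hz
    refine ⟨0, fun k => -2 * z.2 k / ‖z.2‖ ^ 4 * (rotField i j z).2 k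
      + (‖z.2‖ ^ 2)⁻¹ * (rotField i j (coordDir k.succ)).2 k, ?_, fun k => ?_, ?_⟩
    · simpa [rotField] using hasDerivAt_const (0 : ℝ) (0 : ℝ)
    · have hrad := hasDerivAt_radius_coordDir (hr z hz) k
      have h1 := (hrad.pow 2).inv (by simpa using hr z hz)
      have h2 : HasDerivAt (fun s : ℝ => (rotField i j (z + s • coordDir k.succ)).2 k)
          ((rotField i j (coordDir k.succ)).2 k) 0 :=
        (((EuclideanSpace.proj k : EuclideanSpace ℝ (Fin 3) →L[ℝ] ℝ).comp
          (ContinuousLinearMap.snd ℝ ℝ (EuclideanSpace ℝ (Fin 3)))).hasFDerivAt.comp_hasDerivAt 0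
            (hasDerivAt_rotField_line z (coordDir k.succ) i j))
      refine (h1.mul h2).congr_deriv ?_
      simp only [Pi.inv_apply, Pi.pow_apply, zero_smul, add_zero, Nat.cast_ofNat,
        Nat.add_one_sub_one, pow_one]
      field_simp
    · simp only [Fin.sum_univ_three, rotField, coordDir_succ_snd]
      fin_cases i <;> fin_cases j <;> simp <;> ring

/-! ### The Carleman inequality -/

/-- The null coordinate `p = t + |x|`. -/
noncomputable def outCoord (z : Spacetime) : ℝ := z.1 + ‖z.2‖

/-- The null coordinate `q = |x| - t`. -/
noncomputable def inCoord (z : Spacetime) : ℝ := ‖z.2‖ - z.1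

theorem contDiffAt_outCoord {n : WithTop ℕ∞} {z : Spacetime} (hz : z.2 ≠ 0) :
    ContDiffAt ℝ n outCoord z :=
  contDiffAt_fst.add (contDiffAt_radius hz)

theorem contDiffAt_inCoord {n : WithTop ℕ∞} {z : Spacetime} (hz : z.2 ≠ 0) :
    ContDiffAt ℝ n inCoord z :=
  (contDiffAt_radius hz).sub contDiffAt_fst

theorem hasDerivAt_outCoord_nullField {z : Spacetime} (hz : z.2 ≠ 0) (c : ℝ) :
    HasDerivAt (fun s : ℝ => outCoord (z + s • nullField c z)) (c + 1 / 2) 0 :=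
  (hasDerivAt_time_line z (nullField c z)).add (hasDerivAt_radius_nullField hz c)

theorem hasDerivAt_inCoord_nullField {z : Spacetime} (hz : z.2 ≠ 0) (c : ℝ) :
    HasDerivAt (fun s : ℝ => inCoord (z + s • nullField c z)) (1 / 2 - c) 0 :=
  (hasDerivAt_radius_nullField hz c).sub (hasDerivAt_time_line z (nullField c z))

theorem hasDerivAt_outCoord_rotField {z : Spacetime} (hz : z.2 ≠ 0) (i j : Fin 3) :
    HasDerivAt (fun s : ℝ => outCoord (z + s • rotField i j z)) 0 0 := by
  exact ((hasDerivAt_time_line z (rotField i j z)).add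
    (hasDerivAt_radius_rotField hz i j)).congr_deriv (by simp [rotField])

theorem hasDerivAt_inCoord_rotField {z : Spacetime} (hz : z.2 ≠ 0) (i j : Fin 3) :
    HasDerivAt (fun s : ℝ => inCoord (z + s • rotField i j z)) 0 0 := by
  exact ((hasDerivAt_radius_rotField hz i j).sub
    (hasDerivAt_time_line z (rotField i j z))).congr_deriv (by simp [rotField])

theorem HasDerivAt.comp_outCoord {g : ℝ → ℝ} {g' d : ℝ} {z h : Spacetime}
    (hg : HasDerivAt g g' (outCoord z))
    (hd : HasDerivAt (fun s : ℝ => outCoord (z + s • h)) d 0) :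
    HasDerivAt (fun s : ℝ => g (outCoord (z + s • h))) (g' * d) 0 :=
  HasDerivAt.comp (0 : ℝ) (by simpa using hg) hd

theorem ContDiffAt.dout {u : Spacetime → ℝ} {z : Spacetime} {n m : WithTop ℕ∞}
    (hu : ContDiffAt ℝ n u z) (hz : z.2 ≠ 0) (h : m + 1 ≤ n) : ContDiffAt ℝ m (Dout u) z :=
  hu.along (contDiffAt_nullField hz _) h

theorem ContDiffAt.din {u : Spacetime → ℝ} {z : Spacetime} {n m : WithTop ℕ∞}
    (hu : ContDiffAt ℝ n u z) (hz : z.2 ≠ 0) (h : m + 1 ≤ n) : ContDiffAt ℝ m (Din u) z :=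
  hu.along (contDiffAt_nullField hz _) h

theorem ContDiffAt.drot {u : Spacetime → ℝ} {z : Spacetime} {n m : WithTop ℕ∞}
    (hu : ContDiffAt ℝ n u z) (i j : Fin 3) (h : m + 1 ≤ n) : ContDiffAt ℝ m (Drot i j u) z :=
  hu.along (contDiff_rotField i j).contDiffAt h

theorem DifferentiableAt.hasDerivAt_dout {u : Spacetime → ℝ} {z : Spacetime}
    (hu : DifferentiableAt ℝ u z) :
    HasDerivAt (fun s : ℝ => u (z + s • nullField (1 / 2) z)) (Dout u z) 0 :=
  hu.hasDerivAt_along _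

theorem DifferentiableAt.hasDerivAt_din {u : Spacetime → ℝ} {z : Spacetime}
    (hu : DifferentiableAt ℝ u z) :
    HasDerivAt (fun s : ℝ => u (z + s • nullField (-(1 / 2)) z)) (Din u z) 0 :=
  hu.hasDerivAt_along _

theorem DifferentiableAt.hasDerivAt_drot {u : Spacetime → ℝ} {z : Spacetime}
    (hu : DifferentiableAt ℝ u z) (i j : Fin 3) :
    HasDerivAt (fun s : ℝ => u (z + s • rotField i j z)) (Drot i j u z) 0 :=
  hu.hasDerivAt_along _

theorem dout_eq {u : Spacetime → ℝ} {z : Spacetime} {d : ℝ} (hu : DifferentiableAt ℝ u z)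
    (h : HasDerivAt (fun s : ℝ => u (z + s • nullField (1 / 2) z)) d 0) : Dout u z = d :=
  along_eq_of_hasDerivAt hu h

theorem din_eq {u : Spacetime → ℝ} {z : Spacetime} {d : ℝ} (hu : DifferentiableAt ℝ u z)
    (h : HasDerivAt (fun s : ℝ => u (z + s • nullField (-(1 / 2)) z)) d 0) : Din u z = d :=
  along_eq_of_hasDerivAt hu h

theorem drot_eq {u : Spacetime → ℝ} {z : Spacetime} {d : ℝ} {i j : Fin 3}
    (hu : DifferentiableAt ℝ u z)
    (h : HasDerivAt (fun s : ℝ => u (z + s • rotField i j z)) d 0) : Drot i j u z = d :=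
  along_eq_of_hasDerivAt hu h

theorem dout_din_comm {u : Spacetime → ℝ} {z : Spacetime} (hu : ContDiffAt ℝ 2 u z)
    (hz : z.2 ≠ 0) : Dout (Din u) z = Din (Dout u) z :=
  along_nullField_comm hu hz _ _

theorem drot_dout_comm {u : Spacetime → ℝ} {z : Spacetime} (hu : ContDiffAt ℝ 2 u z)
    (hz : z.2 ≠ 0) (i j : Fin 3) : Drot i j (Dout u) z = Dout (Drot i j u) z :=
  along_rotField_nullField_comm hu hz _ i j

theorem drot_din_comm {u : Spacetime → ℝ} {z : Spacetime} (hu : ContDiffAt ℝ 2 u z)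
    (hz : z.2 ≠ 0) (i j : Fin 3) : Drot i j (Din u) z = Din (Drot i j u) z :=
  along_rotField_nullField_comm hu hz _ i j

/-- The multiplier identity for the part `4 ∂_p ∂_q + 4 l² a` of the conjugated operator and the
multiplier `w (a ∂_q + ∂_p)`, where `a` and `w` depend on `p` only. -/
theorem multiplier_identity_null {a w b : ℝ → ℝ} {w' b' l : ℝ} {v : Spacetime → ℝ}
    {z : Spacetime} (hz : z.2 ≠ 0) (hv : ContDiffAt ℝ 2 v z)
    (ha : DifferentiableAt ℝ a (outCoord z))
    (hw : HasDerivAt w w' (outCoord z)) (hb : HasDerivAt b b' (outCoord z))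
    (hab : w (outCoord z) * a (outCoord z) = b (outCoord z)) :
    -(4 * Dout (Din v) z + 4 * l ^ 2 * a (outCoord z) * v z) *
        (w (outCoord z) * (a (outCoord z) * Din v z + Dout v z)) =
      2 * b' * ((Din v z) ^ 2 + l ^ 2 * (v z) ^ 2)
      + Dout (fun y => -2 * b (outCoord y) * ((Din v y) ^ 2 + l ^ 2 * (v y) ^ 2)) z
      + Din (fun y => -2 * w (outCoord y) * (Dout v y) ^ 2
          - 2 * l ^ 2 * (b (outCoord y) * a (outCoord y)) * (v y) ^ 2) z := by
  have hvd := hv.differentiableAt (by norm_num)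
  have hq := (hv.din (m := 1) hz (by norm_num)).differentiableAt (by norm_num)
  have hp := (hv.dout (m := 1) hz (by norm_num)).differentiableAt (by norm_num)
  have hP : DifferentiableAt ℝ outCoord z :=
    (contDiffAt_outCoord (n := 1) hz).differentiableAt (by norm_num)
  have hbP : DifferentiableAt ℝ (fun y => b (outCoord y)) z := hb.differentiableAt.comp z hP
  have hwP : DifferentiableAt ℝ (fun y => w (outCoord y)) z := hw.differentiableAt.comp z hP
  have haP : DifferentiableAt ℝ (fun y => a (outCoord y)) z := ha.comp z hP
  have e1 := dout_eq
    (u := fun y => -2 * b (outCoord y) * ((Din v y) ^ 2 + l ^ 2 * (v y) ^ 2))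
    ((hbP.const_mul (-2)).mul ((hq.pow 2).add ((hvd.pow 2).const_mul _)))
    (((hb.comp_outCoord (hasDerivAt_outCoord_nullField hz (1 / 2))).const_mul (-2)).mul
      (((hq.hasDerivAt_dout).pow 2).add
        (((hvd.hasDerivAt_dout).pow 2).const_mul (l ^ 2))))
  have e2 := din_eq
    (u := fun y => -2 * w (outCoord y) * (Dout v y) ^ 2
          - 2 * l ^ 2 * (b (outCoord y) * a (outCoord y)) * (v y) ^ 2)
    (((hwP.const_mul (-2)).mul (hp.pow 2)).sub (((hbP.mul haP).const_mul _).mul (hvd.pow 2)))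
    ((((hw.comp_outCoord (hasDerivAt_outCoord_nullField hz (-(1 / 2)))).const_mul (-2)).mul
      ((hp.hasDerivAt_din).pow 2)).sub
      ((((hb.comp_outCoord (hasDerivAt_outCoord_nullField hz (-(1 / 2)))).mul
        (ha.hasDerivAt.comp_outCoord (hasDerivAt_outCoord_nullField hz (-(1 / 2))))).const_mul
          (2 * l ^ 2)).mul
        ((hvd.hasDerivAt_din).pow 2)))
  have hcomm := dout_din_comm hv hz
  rw [e1, e2]
  simp only [Pi.mul_apply, Pi.pow_apply, Pi.add_apply, zero_smul, add_zero, ← hcomm, ← hab]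
  norm_num
  ring

/-- The multiplier identity for the rotational part of the operator. -/
theorem multiplier_identity_rot {a w b : ℝ → ℝ} {w' b' : ℝ} {v : Spacetime → ℝ}
    {z : Spacetime} (hz : z.2 ≠ 0) (hv : ContDiffAt ℝ 2 v z)
    (ha : DifferentiableAt ℝ a (outCoord z))
    (hw : HasDerivAt w w' (outCoord z)) (hb : HasDerivAt b b' (outCoord z))
    (hab : w (outCoord z) * a (outCoord z) = b (outCoord z)) (i j : Fin 3) :
    -((‖z.2‖ ^ 2)⁻¹ * Drot i j (Drot i j v) z) *
        (w (outCoord z) * (a (outCoord z) * Din v z + Dout v z)) =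
      1 / 2 * (‖z.2‖ ^ 2)⁻¹ * (w (outCoord z) * (1 + a (outCoord z)) / ‖z.2‖ - w')
        * (Drot i j v z) ^ 2
      + Dout (fun y => 1 / 2 * w (outCoord y) * (‖y.2‖ ^ 2)⁻¹ * (Drot i j v y) ^ 2) z
      + Din (fun y => 1 / 2 * b (outCoord y) * (‖y.2‖ ^ 2)⁻¹ * (Drot i j v y) ^ 2) z
      + Drot i j (fun y => -(w (outCoord y) * (‖y.2‖ ^ 2)⁻¹ * Drot i j v y
          * (a (outCoord y) * Din v y + Dout v y))) z := by
  have hr : ‖z.2‖ ≠ 0 := by simpa using hz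
  have hvd := hv.differentiableAt (by norm_num)
  have hq := (hv.din (m := 1) hz (by norm_num)).differentiableAt (by norm_num)
  have hp := (hv.dout (m := 1) hz (by norm_num)).differentiableAt (by norm_num)
  have hu := (hv.drot (m := 1) i j (by norm_num)).differentiableAt (by norm_num)
  have hP : DifferentiableAt ℝ outCoord z :=
    (contDiffAt_outCoord (n := 1) hz).differentiableAt (by norm_num)
  have hbP : DifferentiableAt ℝ (fun y => b (outCoord y)) z := hb.differentiableAt.comp z hP
  have hwP : DifferentiableAt ℝ (fun y => w (outCoord y)) z := hw.differentiableAt.comp z hP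
  have haP : DifferentiableAt ℝ (fun y => a (outCoord y)) z := ha.comp z hP
  have hR : DifferentiableAt ℝ (fun y : Spacetime => (‖y.2‖ ^ 2)⁻¹) z :=
    ((((contDiffAt_radius (n := 1) hz).pow 2).inv (by simpa using hz)).differentiableAt
      (by norm_num))
  have dR : ∀ c, HasDerivAt (fun s : ℝ => (‖(z + s • nullField c z).2‖ ^ 2)⁻¹)
      (-(‖z.2‖ ^ 3)⁻¹) 0 := by
    intro c
    refine (((hasDerivAt_radius_nullField hz c).pow 2).inv (by simpa using hz)).congr_deriv ?_
    simp
    field_simp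
  have dR' : HasDerivAt (fun s : ℝ => (‖(z + s • rotField i j z).2‖ ^ 2)⁻¹) 0 0 := by
    refine (((hasDerivAt_radius_rotField hz i j).pow 2).inv (by simpa using hz)).congr_deriv ?_
    simp
  have e1 := dout_eq
    (u := fun y => 1 / 2 * w (outCoord y) * (‖y.2‖ ^ 2)⁻¹ * (Drot i j v y) ^ 2)
    (((hwP.const_mul _).mul hR).mul (hu.pow 2))
    ((((hw.comp_outCoord (hasDerivAt_outCoord_nullField hz (1 / 2))).const_mul (1 / 2)).mul
      (dR _)).mul ((hu.hasDerivAt_dout).pow 2))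
  have e2 := din_eq
    (u := fun y => 1 / 2 * b (outCoord y) * (‖y.2‖ ^ 2)⁻¹ * (Drot i j v y) ^ 2)
    (((hbP.const_mul _).mul hR).mul (hu.pow 2))
    ((((hb.comp_outCoord (hasDerivAt_outCoord_nullField hz (-(1 / 2)))).const_mul (1 / 2)).mul
      (dR _)).mul ((hu.hasDerivAt_din).pow 2))
  have e3 := drot_eq
    (u := fun y => -(w (outCoord y) * (‖y.2‖ ^ 2)⁻¹ * Drot i j v y
          * (a (outCoord y) * Din v y + Dout v y)))
    (((hwP.mul hR).mul hu).mul ((haP.mul hq).add hp)).neg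
    ((((hw.comp_outCoord (hasDerivAt_outCoord_rotField hz i j)).mul dR').mul
      (hu.hasDerivAt_drot i j)).mul
      (((ha.hasDerivAt.comp_outCoord (hasDerivAt_outCoord_rotField hz i j)).mul
        (hq.hasDerivAt_drot i j)).add (hp.hasDerivAt_drot i j))).neg
  have c1 := drot_dout_comm hv hz i j
  have c2 := drot_din_comm hv hz i j
  rw [e1, e2, e3]
  simp only [Pi.mul_apply, Pi.pow_apply, Pi.add_apply, zero_smul, add_zero, c1, c2, ← hab]
  norm_num
  field_simp
  ring

/-- The derivative `f_p = p^{-1-δ}` of the weight function `f = q - δ⁻¹ p^{-δ}`. -/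
noncomputable def weightSlope (δ : ℝ) (z : Spacetime) : ℝ := outCoord z ^ (-1 - δ)

/-- The derivative `f_p v_q + f_q v_p` of `v` along the gradient of the weight function. -/
noncomputable def weightDeriv (δ : ℝ) (v : Spacetime → ℝ) (z : Spacetime) : ℝ :=
  weightSlope δ z * Din v z + Dout v z

/-- The operator `4 ∂_p ∂_q + r⁻² Δ_{S²}`, equal to `r □ r⁻¹`; the spherical Laplacian is half the
sum of the squares of all the `Ω_{ij}`, each rotation being counted twice. -/
noncomputable def nullWave (v : Spacetime → ℝ) (z : Spacetime) : ℝ :=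
  4 * Dout (Din v) z + ∑ i, ∑ j, 1 / 2 * ((‖z.2‖ ^ 2)⁻¹ * Drot i j (Drot i j v) z)

/-- The conjugate `e^{l f} ∘ nullWave ∘ e^{-l f}` of the wave operator by the weight. -/
noncomputable def conjWave (δ l : ℝ) (v : Spacetime → ℝ) (z : Spacetime) : ℝ :=
  nullWave v z + 4 * l ^ 2 * weightSlope δ z * v z - 4 * l * weightDeriv δ v z

/-- The positive quadratic form in `v` and its first derivatives that the Carleman inequality
controls. -/
noncomputable def carlemanDensity (δ l : ℝ) (v : Spacetime → ℝ) (z : Spacetime) : ℝ :=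
  (1 - 2 * δ) * outCoord z ^ (-1 / 2 - δ) * ((Din v z) ^ 2 + l ^ 2 * (v z) ^ 2)
    + 3 * l * outCoord z ^ (3 / 2 : ℝ) * (weightDeriv δ v z) ^ 2
    + ∑ i, ∑ j, 1 / 16 * outCoord z ^ (1 / 2 : ℝ) * (‖z.2‖ ^ 2)⁻¹ * (Drot i j v z) ^ 2

section

variable {K : Set Spacetime} {v : Spacetime → ℝ} {n m : WithTop ℕ∞}

theorem SmoothOnSupport.dout (hv : SmoothOnSupport n K v) (hK : IsCompact K)
    (hr : ∀ z ∈ K, z.2 ≠ 0) (h : m + 1 ≤ n) : SmoothOnSupport m K (Dout v) :=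
  hv.along hK.isClosed (fun z hz => contDiffAt_nullField (hr z hz) _) h

theorem SmoothOnSupport.din (hv : SmoothOnSupport n K v) (hK : IsCompact K)
    (hr : ∀ z ∈ K, z.2 ≠ 0) (h : m + 1 ≤ n) : SmoothOnSupport m K (Din v) :=
  hv.along hK.isClosed (fun z hz => contDiffAt_nullField (hr z hz) _) h

theorem SmoothOnSupport.drot (hv : SmoothOnSupport n K v) (hK : IsCompact K)
    (i j : Fin 3) (h : m + 1 ≤ n) : SmoothOnSupport m K (Drot i j v) :=
  hv.along hK.isClosed (fun _ _ => (contDiff_rotField i j).contDiffAt) h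

theorem contDiffAt_outCoord_rpow {z : Spacetime} (hz : z.2 ≠ 0) (hp : 0 < outCoord z) (s : ℝ) :
    ContDiffAt ℝ n (fun y => outCoord y ^ s) z :=
  (contDiffAt_outCoord hz).rpow_const_of_ne hp.ne'

theorem contDiffAt_inv_radius_sq {z : Spacetime} (hz : z.2 ≠ 0) :
    ContDiffAt ℝ n (fun y : Spacetime => (‖y.2‖ ^ 2)⁻¹) z :=
  ((contDiffAt_radius hz).pow 2).inv (by simpa using hz)

theorem SmoothOnSupport.weightDeriv (hv : SmoothOnSupport n K v) (hK : IsCompact K)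
    (hr : ∀ z ∈ K, z.2 ≠ 0) (hp : ∀ z ∈ K, 0 < outCoord z) (δ : ℝ) (h : m + 1 ≤ n) :
    SmoothOnSupport m K (weightDeriv δ v) :=
  ((hv.din hK hr h).mul_left fun z hz =>
    contDiffAt_outCoord_rpow (hr z hz) (hp z hz) _).add (hv.dout hK hr h)

theorem SmoothOnSupport.conjWave (hv : SmoothOnSupport 2 K v) (hK : IsCompact K)
    (hr : ∀ z ∈ K, z.2 ≠ 0) (hp : ∀ z ∈ K, 0 < outCoord z) (δ l : ℝ) :
    SmoothOnSupport 0 K (conjWave δ l v) := by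
  refine SmoothOnSupport.sub (.add (.add ?_ (.sum fun i _ => .sum fun j _ => ?_)) ?_) ?_
  · exact (((hv.din hK hr (m := 1) (by norm_num)).dout hK hr (by norm_num)).const_mul 4)
  · exact ((((hv.drot hK i j (m := 1) (by norm_num)).drot hK i j (by norm_num)).mul_left
      fun z hz => contDiffAt_inv_radius_sq (hr z hz)).const_mul _)
  · exact (hv.of_le (by norm_num)).mul_left fun z hz =>
      contDiffAt_const.mul (contDiffAt_outCoord_rpow (hr z hz) (hp z hz) _)
  · exact (hv.weightDeriv hK hr hp δ (by norm_num)).const_mul _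

theorem SmoothOnSupport.carlemanDensity (hv : SmoothOnSupport 2 K v) (hK : IsCompact K)
    (hr : ∀ z ∈ K, z.2 ≠ 0) (hp : ∀ z ∈ K, 0 < outCoord z) (δ l : ℝ) :
    SmoothOnSupport 0 K (carlemanDensity δ l v) := by
  have hpow : ∀ s : ℝ, ∀ z ∈ K, ContDiffAt ℝ 0 (fun y => outCoord y ^ s) z := fun s z hz =>
    contDiffAt_outCoord_rpow (hr z hz) (hp z hz) s
  refine SmoothOnSupport.add (.add ?_ ?_) (.sum fun i _ => .sum fun j _ => ?_)
  · exact ((hv.din hK hr (m := 0) (by norm_num)).sq.add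
      ((hv.of_le (m := 0) (by norm_num)).sq.const_mul _)).mul_left
        fun z hz => contDiffAt_const.mul (hpow _ z hz)
  · exact (hv.weightDeriv hK hr hp δ (by norm_num)).sq.mul_left
      fun z hz => contDiffAt_const.mul (hpow _ z hz)
  · exact (hv.drot hK i j (by norm_num)).sq.mul_left
      fun z hz => (contDiffAt_const.mul (hpow _ z hz)).mul (contDiffAt_inv_radius_sq (hr z hz))

/-- The Carleman inequality. It has no error terms: the multiplier `w (a ∂_q + ∂_p)` with
`a = p^{-1-δ}` and `w = p^{3/2}` produces positive bulk terms only, since `w a` is increasing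
and `w / p²` decreasing. -/
theorem carleman_inequality (hK : IsCompact K)
    (hr : ∀ z ∈ K, z.2 ≠ 0) (hp : ∀ z ∈ K, 0 < outCoord z)
    (hq : ∀ z ∈ K, 4 * inCoord z ≤ ‖z.2‖) {δ l : ℝ} (hl : 0 < l)
    (hv : SmoothOnSupport 2 K v) :
    ∫ z, (‖z.2‖ ^ 2)⁻¹ * carlemanDensity δ l v z ≤
      ∫ z, (‖z.2‖ ^ 2)⁻¹ *
        ((4 * l)⁻¹ * outCoord z ^ (3 / 2 : ℝ) * (conjWave δ l v z) ^ 2) := by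
  have hpow : ∀ s : ℝ, ∀ z ∈ K, ContDiffAt ℝ 1 (fun y => outCoord y ^ s) z := fun s z hz =>
    contDiffAt_outCoord_rpow (hr z hz) (hp z hz) s
  have hR : ∀ z ∈ K, ContDiffAt ℝ 1 (fun y : Spacetime => (‖y.2‖ ^ 2)⁻¹) z := fun z hz =>
    contDiffAt_inv_radius_sq (hr z hz)
  have hint : ∀ {F : Spacetime → ℝ}, SmoothOnSupport 0 K F →
      Integrable fun z => (‖z.2‖ ^ 2)⁻¹ * F z := fun hF =>
    (hF.mul_left fun z hz => contDiffAt_inv_radius_sq (hr z hz)).integrable hK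
  have hv1 : SmoothOnSupport 1 K v := hv.of_le (by norm_num)
  have hvq : SmoothOnSupport 1 K (Din v) := hv.din hK hr (by norm_num)
  have hvp : SmoothOnSupport 1 K (Dout v) := hv.dout hK hr (by norm_num)
  have hvr : ∀ i j, SmoothOnSupport 1 K (Drot i j v) := fun i j => hv.drot hK i j (by norm_num)
  have hZ : SmoothOnSupport 1 K (weightDeriv δ v) := hv.weightDeriv hK hr hp δ (by norm_num)
  set F₁ : Spacetime → ℝ := fun y => -2 * outCoord y ^ (1 / 2 - δ) *
    ((Din v y) ^ 2 + l ^ 2 * (v y) ^ 2) with hF₁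
  set F₂ : Spacetime → ℝ := fun y => -2 * outCoord y ^ (3 / 2 : ℝ) * (Dout v y) ^ 2
    - 2 * l ^ 2 * (outCoord y ^ (1 / 2 - δ) * outCoord y ^ (-1 - δ)) * (v y) ^ 2 with hF₂
  set G₁ : Fin 3 → Fin 3 → Spacetime → ℝ := fun i j y =>
    1 / 2 * outCoord y ^ (3 / 2 : ℝ) * (‖y.2‖ ^ 2)⁻¹ * (Drot i j v y) ^ 2 with hG₁
  set G₂ : Fin 3 → Fin 3 → Spacetime → ℝ := fun i j y =>
    1 / 2 * outCoord y ^ (1 / 2 - δ) * (‖y.2‖ ^ 2)⁻¹ * (Drot i j v y) ^ 2 with hG₂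
  set G₃ : Fin 3 → Fin 3 → Spacetime → ℝ := fun i j y =>
    -(outCoord y ^ (3 / 2 : ℝ) * (‖y.2‖ ^ 2)⁻¹ * Drot i j v y *
      (outCoord y ^ (-1 - δ) * Din v y + Dout v y)) with hG₃
  have sF₁ : SmoothOnSupport 1 K F₁ := (hvq.sq.add (hv1.sq.const_mul _)).mul_left
    fun z hz => contDiffAt_const.mul (hpow _ z hz)
  have sF₂ : SmoothOnSupport 1 K F₂ := (hvp.sq.mul_left
    fun z hz => contDiffAt_const.mul (hpow _ z hz)).sub (hv1.sq.mul_left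
      fun z hz => contDiffAt_const.mul ((hpow _ z hz).mul (hpow _ z hz)))
  have sG₁ : ∀ i j, SmoothOnSupport 1 K (G₁ i j) := fun i j => (hvr i j).sq.mul_left
    fun z hz => (contDiffAt_const.mul (hpow _ z hz)).mul (hR z hz)
  have sG₂ : ∀ i j, SmoothOnSupport 1 K (G₂ i j) := fun i j => (hvr i j).sq.mul_left
    fun z hz => (contDiffAt_const.mul (hpow _ z hz)).mul (hR z hz)
  have sG₃ : ∀ i j, SmoothOnSupport 1 K (G₃ i j) := fun i j => by
    simpa [hG₃, weightDeriv, weightSlope] using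
      (((hvr i j).mul_left fun z hz => (hpow (3 / 2) z hz).mul (hR z hz)).mul hZ).const_mul (-1)
  have tF₁ := sF₁.dout hK hr (m := 0) (by norm_num)
  have tF₂ := sF₂.din hK hr (m := 0) (by norm_num)
  have tG₁ := fun i j => (sG₁ i j).dout hK hr (m := 0) (by norm_num)
  have tG₂ := fun i j => (sG₂ i j).din hK hr (m := 0) (by norm_num)
  have tG₃ := fun i j => (sG₃ i j).drot hK i j (m := 0) (by norm_num)
  have iF₁ : ∫ z, (‖z.2‖ ^ 2)⁻¹ * Dout F₁ z = 0 := integral_along_nullField hK hr sF₁ _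
  have iF₂ : ∫ z, (‖z.2‖ ^ 2)⁻¹ * Din F₂ z = 0 := integral_along_nullField hK hr sF₂ _
  have iG₁ : ∀ i j, ∫ z, (‖z.2‖ ^ 2)⁻¹ * Dout (G₁ i j) z = 0 := fun i j =>
    integral_along_nullField hK hr (sG₁ i j) _
  have iG₂ : ∀ i j, ∫ z, (‖z.2‖ ^ 2)⁻¹ * Din (G₂ i j) z = 0 := fun i j =>
    integral_along_nullField hK hr (sG₂ i j) _
  have iG₃ : ∀ i j, ∫ z, (‖z.2‖ ^ 2)⁻¹ * Drot i j (G₃ i j) z = 0 := fun i j =>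
    integral_along_rotField hK hr (sG₃ i j) i j
  -- the divergence terms, which integrate to zero
  have zadd : ∀ {F G : Spacetime → ℝ}, (Integrable F ∧ ∫ z, F z = 0) →
      (Integrable G ∧ ∫ z, G z = 0) →
      Integrable (fun z => F z + G z) ∧ ∫ z, (F z + G z) = 0 := fun hF hG =>
    ⟨hF.1.add hG.1, by rw [integral_add hF.1 hG.1, hF.2, hG.2, add_zero]⟩
  have zmul : ∀ {F : Spacetime → ℝ}, (Integrable F ∧ ∫ z, F z = 0) →
      Integrable (fun z => 1 / 2 * F z) ∧ ∫ z, 1 / 2 * F z = 0 := fun hF =>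
    ⟨hF.1.const_mul _, by rw [integral_const_mul, hF.2, mul_zero]⟩
  have zsum : ∀ {F : Fin 3 → Spacetime → ℝ}, (∀ i, Integrable (F i) ∧ ∫ z, F i z = 0) →
      Integrable (fun z => ∑ i, F i z) ∧ ∫ z, ∑ i, F i z = 0 := fun hF =>
    ⟨integrable_finsetSum _ fun i _ => (hF i).1, by
      rw [integral_finsetSum _ fun i _ => (hF i).1]
      exact Finset.sum_eq_zero fun i _ => (hF i).2⟩
  set D : Spacetime → ℝ := fun z => (‖z.2‖ ^ 2)⁻¹ * Dout F₁ z + (‖z.2‖ ^ 2)⁻¹ * Din F₂ z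
    + ∑ i, ∑ j, 1 / 2 * ((‖z.2‖ ^ 2)⁻¹ * Dout (G₁ i j) z
      + (‖z.2‖ ^ 2)⁻¹ * Din (G₂ i j) z + (‖z.2‖ ^ 2)⁻¹ * Drot i j (G₃ i j) z) with hD
  obtain ⟨hDint, hD0⟩ : Integrable D ∧ ∫ z, D z = 0 :=
    zadd (zadd ⟨hint tF₁, iF₁⟩ ⟨hint tF₂, iF₂⟩) (zsum fun i => zsum fun j => zmul
      (zadd (zadd ⟨hint (tG₁ i j), iG₁ i j⟩ ⟨hint (tG₂ i j), iG₂ i j⟩) ⟨hint (tG₃ i j), iG₃ i j⟩))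
  have hC := hint (hv.carlemanDensity hK hr hp δ l)
  have hP : Integrable fun z : Spacetime => (‖z.2‖ ^ 2)⁻¹ *
      ((4 * l)⁻¹ * outCoord z ^ (3 / 2 : ℝ) * (conjWave δ l v z) ^ 2) :=
    hint ((hv.conjWave hK hr hp δ l).sq.mul_left fun z hz =>
      contDiffAt_const.mul (contDiffAt_outCoord_rpow (hr z hz) (hp z hz) _))
  rw [← sub_zero (∫ z : Spacetime, (‖z.2‖ ^ 2)⁻¹ * ((4 * l)⁻¹ * _ * _)), ← hD0,
    ← integral_sub hP hDint]
  refine integral_mono hC (hP.sub hDint) fun z => ?_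
  by_cases hz : z ∈ K
  swap
  · simp [hD, (hv.carlemanDensity hK hr hp δ l).2 z hz, (hv.conjWave hK hr hp δ l).2 z hz,
      tF₁.2 z hz, tF₂.2 z hz, fun i j => (tG₁ i j).2 z hz, fun i j => (tG₂ i j).2 z hz,
      fun i j => (tG₃ i j).2 z hz]
  have hz2 := hr z hz
  have hr0 : 0 < ‖z.2‖ := norm_pos_iff.mpr hz2
  have hp0 := hp z hz
  have hw : HasDerivAt (fun p : ℝ => p ^ (3 / 2 : ℝ)) (3 / 2 * outCoord z ^ (1 / 2 : ℝ))
      (outCoord z) :=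
    (Real.hasDerivAt_rpow_const (Or.inl hp0.ne')).congr_deriv (by norm_num)
  have hb : HasDerivAt (fun p : ℝ => p ^ (1 / 2 - δ)) ((1 / 2 - δ) * outCoord z ^ (-1 / 2 - δ))
      (outCoord z) :=
    (Real.hasDerivAt_rpow_const (Or.inl hp0.ne')).congr_deriv (by
      rw [show 1 / 2 - δ - 1 = -1 / 2 - δ by ring])
  have ha : DifferentiableAt ℝ (fun p : ℝ => p ^ (-1 - δ)) (outCoord z) :=
    (Real.hasDerivAt_rpow_const (Or.inl hp0.ne')).differentiableAt
  have hab : outCoord z ^ (3 / 2 : ℝ) * outCoord z ^ (-1 - δ) = outCoord z ^ (1 / 2 - δ) := by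
    rw [← Real.rpow_add hp0]
    congr 1
    ring
  have id1 := multiplier_identity_null (l := l) hz2 (hv.1 z hz) ha hw hb hab
  have id2 := fun i j => multiplier_identity_rot hz2 (hv.1 z hz) ha hw hb hab i j
  change _ = _ + Dout F₁ z + Din F₂ z at id1
  change ∀ i j, _ = _ + Dout (G₁ i j) z + Din (G₂ i j) z + Drot i j (G₃ i j) z at id2
  -- the coefficient of the rotational derivatives; this is where `q ≤ r / 4` enters
  have hcoef : 1 / 4 * outCoord z ^ (1 / 2 : ℝ) ≤
      outCoord z ^ (3 / 2 : ℝ) * (1 + outCoord z ^ (-1 - δ)) / ‖z.2‖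
        - 3 / 2 * outCoord z ^ (1 / 2 : ℝ) := by
    have h1 : outCoord z ^ (3 / 2 : ℝ) = outCoord z ^ (1 / 2 : ℝ) * outCoord z := by
      rw [← Real.rpow_add_one hp0.ne']
      norm_num
    have h2 : 0 ≤ outCoord z ^ (-1 - δ) := by positivity
    have h3 : 7 / 4 ≤ outCoord z / ‖z.2‖ := by
      rw [le_div_iff₀ hr0]
      have := hq z hz
      unfold inCoord at this
      unfold outCoord
      linarith
    have h4 : 7 / 4 ≤ outCoord z / ‖z.2‖ * (1 + outCoord z ^ (-1 - δ)) := by nlinarith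
    have h5 : 0 ≤ outCoord z ^ (1 / 2 : ℝ) := by positivity
    have h6 := mul_le_mul_of_nonneg_left h4 h5
    rw [h1]
    calc _ = outCoord z ^ (1 / 2 : ℝ) * (7 / 4) - 3 / 2 * outCoord z ^ (1 / 2 : ℝ) := by ring
      _ ≤ _ := by
        have : outCoord z ^ (1 / 2 : ℝ) * outCoord z * (1 + outCoord z ^ (-1 - δ)) / ‖z.2‖
          = outCoord z ^ (1 / 2 : ℝ) * (outCoord z / ‖z.2‖ * (1 + outCoord z ^ (-1 - δ))) := by
          ring
        rw [this]
        linarith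
  have hrot : ∀ i j, 1 / 16 * outCoord z ^ (1 / 2 : ℝ) * (‖z.2‖ ^ 2)⁻¹ * (Drot i j v z) ^ 2
      + 1 / 2 * (Dout (G₁ i j) z + Din (G₂ i j) z + Drot i j (G₃ i j) z)
      ≤ -(1 / 2 * ((‖z.2‖ ^ 2)⁻¹ * Drot i j (Drot i j v) z)) *
        (outCoord z ^ (3 / 2 : ℝ) * weightDeriv δ v z) := by
    intro i j
    have h := mul_le_mul_of_nonneg_left hcoef
      (show 0 ≤ 1 / 4 * (‖z.2‖ ^ 2)⁻¹ * (Drot i j v z) ^ 2 by positivity)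
    have h' := id2 i j
    simp only [weightDeriv, weightSlope]
    linarith
  have hrot' := Finset.sum_le_sum fun i (_ : i ∈ Finset.univ) =>
    Finset.sum_le_sum fun j (_ : j ∈ Finset.univ) => hrot i j
  simp only [Finset.sum_add_distrib] at hrot'
  have hDz : D z = (‖z.2‖ ^ 2)⁻¹ * (Dout F₁ z + Din F₂ z + ∑ i, ∑ j, 1 / 2 *
      (Dout (G₁ i j) z + Din (G₂ i j) z + Drot i j (G₃ i j) z)) := by
    simp only [hD, mul_add, Finset.mul_sum, Finset.sum_add_distrib]
    congr 1
    congr 1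
    congr 1
    all_goals
      refine Finset.sum_congr rfl fun i _ => Finset.sum_congr rfl fun j _ => ?_
      ring
  simp only [hDz]
  rw [← mul_sub]
  refine mul_le_mul_of_nonneg_left ?_ (by positivity)
  -- Young's inequality for the product of the operator and the multiplier
  have hyoung : -(conjWave δ l v z) * (outCoord z ^ (3 / 2 : ℝ) * weightDeriv δ v z)
      ≤ l * outCoord z ^ (3 / 2 : ℝ) * weightDeriv δ v z ^ 2
        + (4 * l)⁻¹ * outCoord z ^ (3 / 2 : ℝ) * (conjWave δ l v z) ^ 2 := by
    have h : 0 ≤ (4 * l)⁻¹ * outCoord z ^ (3 / 2 : ℝ) *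
        (conjWave δ l v z + 2 * l * weightDeriv δ v z) ^ 2 := by positivity
    have h' : (4 * l)⁻¹ * outCoord z ^ (3 / 2 : ℝ) *
        (conjWave δ l v z + 2 * l * weightDeriv δ v z) ^ 2 =
        (4 * l)⁻¹ * outCoord z ^ (3 / 2 : ℝ) * (conjWave δ l v z) ^ 2
        + conjWave δ l v z * (outCoord z ^ (3 / 2 : ℝ) * weightDeriv δ v z)
        + l * outCoord z ^ (3 / 2 : ℝ) * weightDeriv δ v z ^ 2 := by
      field_simp
      ring
    linarith
  have hsplit : -(conjWave δ l v z) * (outCoord z ^ (3 / 2 : ℝ) * weightDeriv δ v z) =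
      -(4 * Dout (Din v) z + 4 * l ^ 2 * weightSlope δ z * v z)
        * (outCoord z ^ (3 / 2 : ℝ) * weightDeriv δ v z)
      + ∑ i, ∑ j, -(1 / 2 * ((‖z.2‖ ^ 2)⁻¹ * Drot i j (Drot i j v) z)) *
        (outCoord z ^ (3 / 2 : ℝ) * weightDeriv δ v z)
      + 4 * l * outCoord z ^ (3 / 2 : ℝ) * weightDeriv δ v z ^ 2 := by
    simp only [conjWave, nullWave, neg_mul, Finset.sum_neg_distrib, ← Finset.sum_mul]
    ring
  change -(4 * Dout (Din v) z + 4 * l ^ 2 * weightSlope δ z * v z)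
    * (outCoord z ^ (3 / 2 : ℝ) * weightDeriv δ v z) = _ at id1
  unfold carlemanDensity
  linarith

end

/-! ### The wave operator in the null frame -/

theorem along_mul {X : Spacetime → Spacetime} {g u : Spacetime → ℝ} {z : Spacetime}
    (hg : DifferentiableAt ℝ g z) (hu : DifferentiableAt ℝ u z) :
    along X (fun y => g y * u y) z = along X g z * u z + g z * along X u z := by
  unfold along
  rw [fderiv_fun_mul hg hu]
  simp
  ring

theorem along_congr {X : Spacetime → Spacetime} {u v : Spacetime → ℝ} {z : Spacetime}
    (h : u =ᶠ[𝓝 z] v) : along X u z = along X v z := by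
  unfold along
  rw [h.fderiv_eq]

theorem along_add {X : Spacetime → Spacetime} {g u : Spacetime → ℝ} {z : Spacetime}
    (hg : DifferentiableAt ℝ g z) (hu : DifferentiableAt ℝ u z) :
    along X (fun y => g y + u y) z = along X g z + along X u z := by
  unfold along
  rw [fderiv_fun_add hg hu]
  simp

theorem ContDiffAt.eventually_differentiableAt {u : Spacetime → ℝ} {z : Spacetime}
    (hu : ContDiffAt ℝ 2 u z) : ∀ᶠ y in 𝓝 z, DifferentiableAt ℝ u y := by
  filter_upwards [hu.eventually (by simp)] with y hy using hy.differentiableAt (by norm_num)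

/-- Second derivatives of a product along two vector fields. -/
theorem along_along_mul {X Y : Spacetime → Spacetime} {g u : Spacetime → ℝ} {z : Spacetime}
    (hg : ContDiffAt ℝ 2 g z) (hu : ContDiffAt ℝ 2 u z) (hY : ContDiffAt ℝ 1 Y z) :
    along X (along Y (fun y => g y * u y)) z = along X (along Y g) z * u z
      + along Y g z * along X u z + along X g z * along Y u z + g z * along X (along Y u) z := by
  have h1 : along Y (fun y => g y * u y) =ᶠ[𝓝 z] fun y => along Y g y * u y + g y * along Y u y := by
    filter_upwards [hg.eventually_differentiableAt, hu.eventually_differentiableAt] with y a b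
      using along_mul a b
  have dg := hg.differentiableAt (by norm_num)
  have du := hu.differentiableAt (by norm_num)
  have dYg : DifferentiableAt ℝ (along Y g) z :=
    (hg.along hY (by norm_num)).differentiableAt (by norm_num)
  have dYu : DifferentiableAt ℝ (along Y u) z :=
    (hu.along hY (by norm_num)).differentiableAt (by norm_num)
  rw [along_congr h1, along_add (g := fun y => along Y g y * u y)
    (u := fun y => g y * along Y u y) (dYg.mul du) (dg.mul dYu), along_mul dYg du,
    along_mul dg dYu]
  ring

/-- The product rule for `nullWave` when one factor is spherically symmetric. -/
theorem nullWave_mul {g u : Spacetime → ℝ} {z : Spacetime} (hz : z.2 ≠ 0)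
    (hg : ContDiffAt ℝ 2 g z) (hu : ContDiffAt ℝ 2 u z)
    (hrot : ∀ i j, ∀ᶠ y in 𝓝 z, Drot i j g y = 0) :
    nullWave (fun y => g y * u y) z = g z * nullWave u z
      + 4 * (Dout g z * Din u z + Din g z * Dout u z + Dout (Din g) z * u z) := by
  have h1 : Dout (Din (fun y => g y * u y)) z = Dout (Din g) z * u z
      + Din g z * Dout u z + Dout g z * Din u z + g z * Dout (Din u) z :=
    along_along_mul hg hu (contDiffAt_nullField hz _)
  have h2 : ∀ i j, Drot i j (Drot i j (fun y => g y * u y)) z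
      = g z * Drot i j (Drot i j u) z := by
    intro i j
    have h : Drot i j (Drot i j (fun y => g y * u y)) z = Drot i j (Drot i j g) z * u z
        + Drot i j g z * Drot i j u z + Drot i j g z * Drot i j u z
        + g z * Drot i j (Drot i j u) z :=
      along_along_mul hg hu (contDiff_rotField i j).contDiffAt
    have h0 : Drot i j (Drot i j g) z = 0 := by
      have : along (rotField i j) (Drot i j g) z = along (rotField i j) (fun _ => 0) z :=
        along_congr (hrot i j)
      rw [Drot, this]
      simp [along]
    rw [h, h0, (hrot i j).self_of_nhds]
    ring
  unfold nullWave
  rw [h1]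
  simp only [h2]
  simp only [mul_add, Finset.mul_sum]
  have : ∀ i j, 1 / 2 * ((‖z.2‖ ^ 2)⁻¹ * (g z * Drot i j (Drot i j u) z)) =
    g z * (1 / 2 * ((‖z.2‖ ^ 2)⁻¹ * Drot i j (Drot i j u) z)) := fun i j => by ring
  simp only [this]
  ring

theorem nullField_eq_sum (c : ℝ) (z : Spacetime) :
    nullField c z = c • coordDir 0 + ∑ i : Fin 3, ((2 * ‖z.2‖)⁻¹ * z.2 i) • coordDir i.succ := by
  rw [eq_sum_coordDir (nullField c z)]
  simp [nullField]

theorem rotField_eq (i j : Fin 3) (z : Spacetime) :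
    rotField i j z = z.2 i • coordDir j.succ - z.2 j • coordDir i.succ :=
  Prod.ext (by simp [rotField, coordDir]) (by simp [rotField, coordDir_succ_snd])

/-- The flat wave operator, as a trace of the Hessian, in the null frame. -/
theorem nullWave_eq {u : Spacetime → ℝ} {z : Spacetime} (hz : z.2 ≠ 0)
    (hu : ContDiffAt ℝ 2 u z) :
    nullWave u z = -fderiv ℝ (fderiv ℝ u) z (coordDir 0) (coordDir 0)
      + ∑ i : Fin 3, fderiv ℝ (fderiv ℝ u) z (coordDir i.succ) (coordDir i.succ)
      - 2 / ‖z.2‖ * (Dout u z + Din u z) := by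
  have hr : ‖z.2‖ ≠ 0 := norm_ne_zero_iff.mpr hz
  have hsq := norm_sq_eq_sum z.2
  have hnull : Dout (Din u) z =
      fderiv ℝ (fderiv ℝ u) z (nullField (1 / 2) z) (nullField (-(1 / 2)) z) := by
    have h : Dout (Din u) z = _ := along_along (X := nullField (1 / 2)) hu
      ((contDiffAt_nullField (n := 1) hz (-(1 / 2))).differentiableAt (by norm_num))
      (hasDerivAt_nullField_nullField hz (1 / 2) (-(1 / 2)))
    simpa using h
  have hrot : ∀ i j, Drot i j (Drot i j u) z =
      fderiv ℝ (fderiv ℝ u) z (rotField i j z) (rotField i j z)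
        + fderiv ℝ u z (rotField i j (rotField i j z)) := fun i j =>
    along_along (X := rotField i j) hu
      ((contDiff_rotField (n := 1) i j).contDiffAt.differentiableAt (by norm_num))
      (hasDerivAt_rotField_line z _ i j)
  have hsymm := fderiv_fderiv_comm hu
  have hp : Dout u z = fderiv ℝ u z (nullField (1 / 2) z) := rfl
  have hq : Din u z = fderiv ℝ u z (nullField (-(1 / 2)) z) := rfl
  unfold nullWave
  rw [hnull, hp, hq]
  simp only [hrot]
  generalize fderiv ℝ (fderiv ℝ u) z = H at *
  generalize fderiv ℝ u z = L at *
  have hR : ∀ i j, rotField i j (rotField i j z) =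
      (z.2 i * (if i = j then 1 else 0) - z.2 j) • coordDir j.succ
        - (z.2 i - z.2 j * (if i = j then 1 else 0)) • coordDir i.succ := by
    intro i j
    rw [rotField_eq i j (rotField i j z)]
    congr 2 <;> simp [rotField, eq_comm]
  simp only [hR]
  simp only [nullField_eq_sum, rotField_eq, Fin.sum_univ_three, map_add, map_sub, map_smul,
    add_apply, sub_apply, smul_apply, smul_eq_mul]
  simp only [Fin.isValue, Fin.reduceEq, if_true, if_false, Fin.reduceSucc]
  rw [hsymm (coordDir 2) (coordDir 1), hsymm (coordDir 3) (coordDir 1),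
    hsymm (coordDir 3) (coordDir 2), hsymm (coordDir 1) (coordDir 0),
    hsymm (coordDir 2) (coordDir 0), hsymm (coordDir 3) (coordDir 0)]
  generalize z.2 0 = x at *
  generalize z.2 1 = y at *
  generalize z.2 2 = w at *
  generalize ‖z.2‖ = r at *
  field_simp
  linear_combination (-4 * (H (coordDir 1) (coordDir 1) + H (coordDir 2) (coordDir 2)
    + H (coordDir 3) (coordDir 3))) * hsq

/-- `nullWave` is `r □ r⁻¹`. -/
theorem nullWave_radius_mul {u : Spacetime → ℝ} {z : Spacetime} (hz : z.2 ≠ 0)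
    (hu : ContDiffAt ℝ 2 u z) :
    nullWave (fun y => ‖y.2‖ * u y) z =
      ‖z.2‖ * (-fderiv ℝ (fderiv ℝ u) z (coordDir 0) (coordDir 0)
        + ∑ i : Fin 3, fderiv ℝ (fderiv ℝ u) z (coordDir i.succ) (coordDir i.succ)) := by
  have hr : ‖z.2‖ ≠ 0 := norm_ne_zero_iff.mpr hz
  have hne : ∀ᶠ y : Spacetime in 𝓝 z, y.2 ≠ 0 := continuous_snd.continuousAt.eventually_ne hz
  have hd : ∀ y : Spacetime, y.2 ≠ 0 → DifferentiableAt ℝ (fun y : Spacetime => ‖y.2‖) y :=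
    fun y hy => (contDiffAt_radius (n := 1) hy).differentiableAt (by norm_num)
  have h1 : ∀ y : Spacetime, y.2 ≠ 0 → Dout (fun y => ‖y.2‖) y = 1 / 2 := fun y hy =>
    dout_eq (hd y hy) (hasDerivAt_radius_nullField hy _)
  have h2 : ∀ y : Spacetime, y.2 ≠ 0 → Din (fun y => ‖y.2‖) y = 1 / 2 := fun y hy =>
    din_eq (hd y hy) (hasDerivAt_radius_nullField hy _)
  have h3 : Dout (Din (fun y : Spacetime => ‖y.2‖)) z = 0 := by
    have : along (nullField (1 / 2)) (Din (fun y : Spacetime => ‖y.2‖)) z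
        = along (nullField (1 / 2)) (fun _ => 1 / 2) z :=
      along_congr (hne.mono h2)
    rw [Dout, this]
    simp [along]
  rw [nullWave_mul hz (contDiffAt_radius hz) hu, nullWave_eq hz hu, h1 z hz, h2 z hz, h3]
  · field_simp
    ring
  · intro i j
    exact hne.mono fun y hy => drot_eq (hd y hy) (hasDerivAt_radius_rotField hy i j)

/-! ### The weight function -/

/-- The weight function `f = q - δ⁻¹ p^{-δ}`. It exceeds `f_δ`, in which `t` takes the
place of `p`, and it satisfies `∂_p ∂_q f = 0`. -/
noncomputable def weight (δ : ℝ) (z : Spacetime) : ℝ := inCoord z - δ⁻¹ * outCoord z ^ (-δ)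

theorem contDiffAt_weight {n : WithTop ℕ∞} {δ : ℝ} {z : Spacetime} (hz : z.2 ≠ 0)
    (hp : 0 < outCoord z) : ContDiffAt ℝ n (weight δ) z :=
  (contDiffAt_inCoord hz).sub (contDiffAt_const.mul (contDiffAt_outCoord_rpow hz hp _))

theorem hasDerivAt_weight_line {δ : ℝ} (hδ : δ ≠ 0) {z h : Spacetime} (hp : 0 < outCoord z)
    {p' q' : ℝ} (hdp : HasDerivAt (fun s : ℝ => outCoord (z + s • h)) p' 0)
    (hdq : HasDerivAt (fun s : ℝ => inCoord (z + s • h)) q' 0) :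
    HasDerivAt (fun s : ℝ => weight δ (z + s • h)) (q' + weightSlope δ z * p') 0 := by
  have h1 : HasDerivAt (fun p : ℝ => p ^ (-δ)) (-δ * outCoord z ^ (-δ - 1)) (outCoord z) :=
    Real.hasDerivAt_rpow_const (Or.inl hp.ne')
  refine (hdq.sub ((h1.comp_outCoord hdp).const_mul δ⁻¹)).congr_deriv ?_
  rw [weightSlope, show -1 - δ = -δ - 1 by ring]
  field_simp
  ring

section

variable {δ : ℝ} {z : Spacetime} {g : ℝ → ℝ} {g' : ℝ}

theorem HasDerivAt.comp_weight {h : Spacetime} {d : ℝ} (hg : HasDerivAt g g' (weight δ z))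
    (hd : HasDerivAt (fun s : ℝ => weight δ (z + s • h)) d 0) :
    HasDerivAt (fun s : ℝ => g (weight δ (z + s • h))) (g' * d) 0 :=
  HasDerivAt.comp (0 : ℝ) (by simpa using hg) hd

theorem dout_comp_weight (hδ : δ ≠ 0) (hz : z.2 ≠ 0) (hp : 0 < outCoord z)
    (hg : HasDerivAt g g' (weight δ z)) :
    Dout (fun y => g (weight δ y)) z = g' * weightSlope δ z :=
  dout_eq (hg.differentiableAt.comp z
      ((contDiffAt_weight (n := 1) hz hp).differentiableAt (by norm_num)))
    ((hg.comp_weight (hasDerivAt_weight_line hδ hp (hasDerivAt_outCoord_nullField hz _)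
      (hasDerivAt_inCoord_nullField hz _))).congr_deriv (by norm_num))

theorem din_comp_weight (hδ : δ ≠ 0) (hz : z.2 ≠ 0) (hp : 0 < outCoord z)
    (hg : HasDerivAt g g' (weight δ z)) :
    Din (fun y => g (weight δ y)) z = g' :=
  din_eq (hg.differentiableAt.comp z
      ((contDiffAt_weight (n := 1) hz hp).differentiableAt (by norm_num)))
    ((hg.comp_weight (hasDerivAt_weight_line hδ hp (hasDerivAt_outCoord_nullField hz _)
      (hasDerivAt_inCoord_nullField hz _))).congr_deriv (by norm_num))

theorem drot_comp_weight (hδ : δ ≠ 0) (hz : z.2 ≠ 0) (hp : 0 < outCoord z)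
    (hg : HasDerivAt g g' (weight δ z)) (i j : Fin 3) :
    Drot i j (fun y => g (weight δ y)) z = 0 :=
  drot_eq (hg.differentiableAt.comp z
      ((contDiffAt_weight (n := 1) hz hp).differentiableAt (by norm_num)))
    ((hg.comp_weight (hasDerivAt_weight_line hδ hp (hasDerivAt_outCoord_rotField hz i j)
      (hasDerivAt_inCoord_rotField hz i j))).congr_deriv (by norm_num))

theorem eventually_ne_zero_and_outCoord_pos (hz : z.2 ≠ 0) (hp : 0 < outCoord z) :
    ∀ᶠ y : Spacetime in 𝓝 z, y.2 ≠ 0 ∧ 0 < outCoord y :=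
  (continuous_snd.continuousAt.eventually_ne hz).and
    ((contDiffAt_outCoord (n := 0) hz).continuousAt.eventually_const_lt hp)

/-- The conjugation of the wave operator by the weight. -/
theorem conjWave_exp_weight_mul (hδ : δ ≠ 0) (hz : z.2 ≠ 0) (hp : 0 < outCoord z) (l : ℝ)
    {u : Spacetime → ℝ} (hu : ContDiffAt ℝ 2 u z) :
    conjWave δ l (fun y => Real.exp (l * weight δ y) * u y) z =
      Real.exp (l * weight δ z) * nullWave u z := by
  have hexp : ∀ s : ℝ, HasDerivAt (fun s => Real.exp (l * s)) (l * Real.exp (l * s)) s := fun s =>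
    (((hasDerivAt_id s).const_mul l).exp).congr_deriv (by simp; ring)
  have hE : ContDiffAt ℝ 2 (fun y => Real.exp (l * weight δ y)) z :=
    (contDiffAt_const.mul (contDiffAt_weight hz hp)).exp
  have hnear := eventually_ne_zero_and_outCoord_pos hz hp
  have e1 := dout_comp_weight hδ hz hp (hexp _)
  have e2 := din_comp_weight hδ hz hp (hexp _)
  have e3 : Dout (Din (fun y => Real.exp (l * weight δ y))) z
      = l * (l * Real.exp (l * weight δ z)) * weightSlope δ z := by
    have h : Din (fun y => Real.exp (l * weight δ y))
        =ᶠ[𝓝 z] fun y => l * Real.exp (l * weight δ y) := by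
      filter_upwards [hnear] with y hy using din_comp_weight hδ hy.1 hy.2 (hexp _)
    have h' : Dout (Din (fun y => Real.exp (l * weight δ y))) z =
      Dout (fun y => l * Real.exp (l * weight δ y)) z := along_congr h
    rw [h', dout_comp_weight (g := fun s => l * Real.exp (l * s)) hδ hz hp
      ((hexp _).const_mul l)]
  have hdE := hE.differentiableAt (by norm_num)
  have hdu := hu.differentiableAt (by norm_num)
  have e4 : Din (fun y => Real.exp (l * weight δ y) * u y) z = _ := along_mul hdE hdu
  have e5 : Dout (fun y => Real.exp (l * weight δ y) * u y) z = _ := along_mul hdE hdu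
  change _ = Din (fun y => Real.exp (l * weight δ y)) z * _ + _ * Din u z at e4
  change _ = Dout (fun y => Real.exp (l * weight δ y)) z * _ + _ * Dout u z at e5
  unfold conjWave weightDeriv
  rw [nullWave_mul hz hE hu, e4, e5, e1, e2, e3]
  · ring
  · intro i j
    filter_upwards [hnear] with y hy using drot_comp_weight hδ hy.1 hy.2 (hexp _) i j

end

/-! ### Absorption of the lower-order terms -/

/-- The pointwise information on the solution: `u` solves the wave system with coefficients `V`,
`W` on `U`, with the stated bounds in terms of `p = t + |x|`. The coefficient of the
ingoing derivative, which is the contraction of `V` with `ω̂`, decays better than the others. -/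
structure WaveSystem {N : ℕ} (U : Set Spacetime) (M γ C : ℝ)
    (V : Fin N → Fin N → Fin 4 → Spacetime → ℝ) (W : Fin N → Fin N → Spacetime → ℝ)
    (u : Fin N → Spacetime → ℝ) : Prop where
  contDiffAt : ∀ z ∈ U, ∀ I, ContDiffAt ℝ 2 (u I) z
  equation : ∀ z ∈ U, ∀ I, nullWave (fun y => ‖y.2‖ * u I y) z =
    -(‖z.2‖ * ∑ J, (∑ α, V I J α z * fderiv ℝ (u J) z (coordDir α) + W I J z * u J z))
  abs_le : ∀ z ∈ U, ∀ I, |u I z| ≤ C * outCoord z ^ (-3 / 2 : ℝ)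
  abs_fderiv_le : ∀ z ∈ U, ∀ I α,
    |fderiv ℝ (u I) z (coordDir α)| ≤ C * outCoord z ^ (-3 / 2 : ℝ)
  abs_dout_le : ∀ z ∈ U, ∀ I, |Dout (u I) z| ≤ C * outCoord z ^ (-5 / 2 : ℝ)
  abs_V_le : ∀ z ∈ U, ∀ I J α, |V I J α z| ≤ M * outCoord z ^ (-1 : ℝ)
  abs_V_omegaHat_le : ∀ z ∈ U, ∀ I J,
    |∑ α, V I J α z * omegaHat z α| ≤ M * outCoord z ^ (-1 - γ)
  abs_W_le : ∀ z ∈ U, ∀ I J, |W I J z| ≤ M * outCoord z ^ (-1 - γ)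

theorem abs_coord_div_norm_le_one (x : EuclideanSpace ℝ (Fin 3)) (i : Fin 3) :
    |x i / ‖x‖| ≤ 1 := by
  rw [abs_div, abs_norm]
  exact div_le_one_of_le₀ (PiLp.norm_apply_le x i) (norm_nonneg _)

theorem fderiv_time_eq (u : Spacetime → ℝ) (z : Spacetime) :
    fderiv ℝ u z (coordDir 0) = Dout u z - Din u z := by
  unfold Dout Din along
  rw [← map_sub]
  congr 1
  rw [nullField_eq_sum, nullField_eq_sum, add_sub_add_right_eq_sub, ← sub_smul]
  norm_num

theorem fderiv_space_eq {u : Spacetime → ℝ} {z : Spacetime} (hz : z.2 ≠ 0) (i : Fin 3) :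
    fderiv ℝ u z (coordDir i.succ) = z.2 i / ‖z.2‖ * (Dout u z + Din u z)
      + ∑ j, (‖z.2‖ ^ 2)⁻¹ * z.2 j * Drot j i u z := by
  have hr : ‖z.2‖ ≠ 0 := norm_ne_zero_iff.mpr hz
  have hsq := norm_sq_eq_sum z.2
  unfold Dout Din Drot along
  simp only [nullField_eq_sum, rotField_eq, map_add, map_sub, map_smul, smul_eq_mul,
    Fin.sum_univ_three]
  field_simp
  fin_cases i
  · simp
    linear_combination (2 * fderiv ℝ u z (coordDir 1)) * hsq
  · simp
    linear_combination (2 * fderiv ℝ u z (coordDir 2)) * hsq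
  · simp
    linear_combination (2 * fderiv ℝ u z (coordDir 3)) * hsq

/-- The first-order terms in the null frame. The coefficient of the transversal derivative `∂_q u`
is the contraction of `V` with `ω̂`. -/
theorem sum_coeff_mul_fderiv (V : Fin 4 → ℝ) {u : Spacetime → ℝ} {z : Spacetime}
    (hz : z.2 ≠ 0) :
    ∑ α, V α * fderiv ℝ u z (coordDir α) = (∑ α, V α * omegaHat z α) * Din u z
      + (V 0 + ∑ i : Fin 3, V i.succ * (z.2 i / ‖z.2‖)) * Dout u z
      + ∑ i : Fin 3, ∑ j, V i.succ * (‖z.2‖ ^ 2)⁻¹ * z.2 j * Drot j i u z := by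
  simp only [Fin.sum_univ_succ (n := 3), fderiv_time_eq, fderiv_space_eq hz, omegaHat,
    Fin.cases_zero, Fin.cases_succ, Fin.sum_univ_three]
  ring

/-- The weighted sum of the first derivatives of the conjugated unknown `v` and of `l |v|` that
bounds the lower-order terms of the equation. The transversal derivative `∂_q v` and `l v` carry
the extra decay `p^{-δ/2}`. -/
noncomputable def lowerOrderSize (δ l : ℝ) (v : Spacetime → ℝ) (z : Spacetime) : ℝ :=
  outCoord z ^ (-1 : ℝ) * |weightDeriv δ v z|
    + outCoord z ^ (-1 - δ / 2) * (|Din v z| + l * |v z|)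
    + ∑ i, ∑ j, outCoord z ^ (-1 : ℝ) * ‖z.2‖⁻¹ * |Drot i j v z|

/-- First derivatives of the conjugated unknown `e^{l f} r u` in the null frame. -/
theorem derivs_exp_weight_mul {δ : ℝ} (hδ : δ ≠ 0) {z : Spacetime} (hz : z.2 ≠ 0)
    (hp0 : 0 < outCoord z) (l : ℝ) {u : Spacetime → ℝ} (hu : ContDiffAt ℝ 2 u z) :
    Din (fun y => Real.exp (l * weight δ y) * (‖y.2‖ * u y)) z =
        l * (Real.exp (l * weight δ z) * (‖z.2‖ * u z))
          + Real.exp (l * weight δ z) * (1 / 2 * u z)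
          + Real.exp (l * weight δ z) * (‖z.2‖ * Din u z) ∧
      Dout (fun y => Real.exp (l * weight δ y) * (‖y.2‖ * u y)) z =
        l * weightSlope δ z * (Real.exp (l * weight δ z) * (‖z.2‖ * u z))
          + Real.exp (l * weight δ z) * (1 / 2 * u z)
          + Real.exp (l * weight δ z) * (‖z.2‖ * Dout u z) ∧
      ∀ i j, Drot i j (fun y => Real.exp (l * weight δ y) * (‖y.2‖ * u y)) z =
        Real.exp (l * weight δ z) * (‖z.2‖ * Drot i j u z) := by
  set E : Spacetime → ℝ := fun y => Real.exp (l * weight δ y) with hE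
  set v : Spacetime → ℝ := fun y => E y * (‖y.2‖ * u y) with hv
  have hEd : DifferentiableAt ℝ E z :=
    ((contDiffAt_const.mul (contDiffAt_weight (n := 1) hz hp0)).exp).differentiableAt (by norm_num)
  have hrd : DifferentiableAt ℝ (fun y : Spacetime => ‖y.2‖) z :=
    (contDiffAt_radius (n := 1) hz).differentiableAt (by norm_num)
  have hud := hu.differentiableAt (by norm_num)
  have hexp : HasDerivAt (fun s => Real.exp (l * s)) (l * Real.exp (l * weight δ z))
      (weight δ z) :=
    (((hasDerivAt_id _).const_mul l).exp).congr_deriv (by simp; ring)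
  have e1 : Din v z = l * v z + E z * (1 / 2 * u z) + E z * (‖z.2‖ * Din u z) := by
    have h : Din v z = Din E z * _ + E z * Din (fun y => ‖y.2‖ * u y) z :=
      along_mul hEd (hrd.mul hud)
    have h' : Din (fun y => ‖y.2‖ * u y) z = Din (fun y => ‖y.2‖) z * u z + ‖z.2‖ * Din u z :=
      along_mul hrd hud
    rw [h, h', din_comp_weight hδ hz hp0 hexp,
      din_eq hrd (hasDerivAt_radius_nullField hz _)]
    simp only [hv, hE]
    ring
  have e2 : Dout v z = l * weightSlope δ z * v z + E z * (1 / 2 * u z)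
      + E z * (‖z.2‖ * Dout u z) := by
    have h : Dout v z = Dout E z * _ + E z * Dout (fun y => ‖y.2‖ * u y) z :=
      along_mul hEd (hrd.mul hud)
    have h' : Dout (fun y => ‖y.2‖ * u y) z = Dout (fun y => ‖y.2‖) z * u z + ‖z.2‖ * Dout u z :=
      along_mul hrd hud
    rw [h, h', dout_comp_weight hδ hz hp0 hexp,
      dout_eq hrd (hasDerivAt_radius_nullField hz _)]
    simp only [hv, hE]
    ring
  have e3 : ∀ i j, Drot i j v z = E z * (‖z.2‖ * Drot i j u z) := by
    intro i j
    have h : Drot i j v z = Drot i j E z * _ + E z * Drot i j (fun y => ‖y.2‖ * u y) z :=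
      along_mul hEd (hrd.mul hud)
    have h' : Drot i j (fun y => ‖y.2‖ * u y) z
        = Drot i j (fun y => ‖y.2‖) z * u z + ‖z.2‖ * Drot i j u z :=
      along_mul hrd hud
    rw [h, h', drot_comp_weight hδ hz hp0 hexp,
      drot_eq hrd (hasDerivAt_radius_rotField hz i j)]
    ring
  exact ⟨e1, e2, e3⟩

/-- The bound for the lower-order terms of one component by the conjugated quantities. -/
theorem abs_lowerOrder_le {δ l M γ : ℝ} (hδ : 0 < δ) (hδ1 : δ ≤ 1) (hδγ : δ ≤ 2 * γ)
    (hl : 1 ≤ l) (hM : 0 ≤ M) {z : Spacetime} (hz : z.2 ≠ 0) (hp : 1 ≤ outCoord z)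
    (hpr : outCoord z ≤ 4 * ‖z.2‖) {V : Fin 4 → ℝ} {W : ℝ}
    (hV : ∀ α, |V α| ≤ M * outCoord z ^ (-1 : ℝ))
    (hVω : |∑ α, V α * omegaHat z α| ≤ M * outCoord z ^ (-1 - γ))
    (hW : |W| ≤ M * outCoord z ^ (-1 - γ))
    {u : Spacetime → ℝ} (hu : ContDiffAt ℝ 2 u z) :
    Real.exp (l * weight δ z) * (‖z.2‖ * |∑ α, V α * fderiv ℝ u z (coordDir α) + W * u z|) ≤
      16 * M * lowerOrderSize δ l (fun y => Real.exp (l * weight δ y) * (‖y.2‖ * u y)) z := by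
  have hp0 : 0 < outCoord z := by linarith
  have hr0 : 0 < ‖z.2‖ := norm_pos_iff.mpr hz
  set E : Spacetime → ℝ := fun y => Real.exp (l * weight δ y) with hE
  set v : Spacetime → ℝ := fun y => E y * (‖y.2‖ * u y) with hv
  have hE0 : 0 < E z := Real.exp_pos _
  obtain ⟨e1, e2, e3⟩ := derivs_exp_weight_mul hδ.ne' hz hp0 l hu
  change Din v z = l * v z + E z * (1 / 2 * u z) + E z * (‖z.2‖ * Din u z) at e1
  change Dout v z = l * weightSlope δ z * v z + E z * (1 / 2 * u z)
    + E z * (‖z.2‖ * Dout u z) at e2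
  change ∀ i j, Drot i j v z = E z * (‖z.2‖ * Drot i j u z) at e3
  -- comparison of the powers of `p`
  set P : ℝ := outCoord z ^ (-1 : ℝ) with hP
  set Q : ℝ := outCoord z ^ (-1 - δ / 2) with hQ
  have hP0 : 0 < P := Real.rpow_pos_of_pos hp0 _
  have hQ0 : 0 < Q := Real.rpow_pos_of_pos hp0 _
  have hγQ : outCoord z ^ (-1 - γ) ≤ Q := Real.rpow_le_rpow_of_exponent_le hp (by linarith)
  have hPaQ : P * weightSlope δ z ≤ Q := by
    rw [hP, weightSlope, ← Real.rpow_add hp0]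
    exact Real.rpow_le_rpow_of_exponent_le hp (by linarith)
  have hPPQ : P * P ≤ Q := by
    rw [hP, ← Real.rpow_add hp0]
    exact Real.rpow_le_rpow_of_exponent_le hp (by linarith)
  have hP1 : P ≤ 1 := Real.rpow_le_one_of_one_le_of_nonpos hp (by norm_num)
  have ha0 : 0 ≤ weightSlope δ z := (Real.rpow_pos_of_pos hp0 _).le
  have hrP : ‖z.2‖⁻¹ ≤ 4 * P := by
    rw [hP, Real.rpow_neg_one, inv_le_iff_one_le_mul₀ hr0]
    have : outCoord z * (outCoord z)⁻¹ = 1 := mul_inv_cancel₀ hp0.ne'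
    nlinarith [inv_pos.mpr hp0]
  -- the undifferentiated term produced by the factor `r`
  have hEu : |E z * (1 / 2 * u z)| ≤ 2 * P * |v z| := by
    have : E z * (1 / 2 * u z) = 1 / 2 * ‖z.2‖⁻¹ * v z := by
      simp only [hv]
      field_simp
    rw [this, abs_mul, abs_of_nonneg (by positivity)]
    exact mul_le_mul_of_nonneg_right (by linarith) (abs_nonneg _)
  have hlv : |v z| ≤ l * |v z| := le_mul_of_one_le_left (abs_nonneg _) hl
  have b1 : |E z * (‖z.2‖ * Din u z)| ≤ |Din v z| + 3 * (l * |v z|) := by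
    have : E z * (‖z.2‖ * Din u z) = Din v z - l * v z - E z * (1 / 2 * u z) := by
      rw [e1]; ring
    rw [this]
    refine (abs_sub _ _).trans ((add_le_add (abs_sub _ _) hEu).trans ?_)
    rw [abs_mul, abs_of_nonneg (by linarith : (0 : ℝ) ≤ l)]
    have := mul_le_of_le_one_left (abs_nonneg (v z)) hP1
    linarith
  have b2 : P * |E z * (‖z.2‖ * Dout u z)| ≤
      P * |weightDeriv δ v z| + Q * (|Din v z| + 3 * (l * |v z|)) := by
    have : E z * (‖z.2‖ * Dout u z) = weightDeriv δ v z - weightSlope δ z * Din v z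
        - l * weightSlope δ z * v z - E z * (1 / 2 * u z) := by
      rw [weightDeriv, e2]; ring
    rw [this]
    have h : |weightDeriv δ v z - weightSlope δ z * Din v z
        - l * weightSlope δ z * v z - E z * (1 / 2 * u z)| ≤ |weightDeriv δ v z|
        + weightSlope δ z * |Din v z| + weightSlope δ z * (l * |v z|) + 2 * P * |v z| := by
      refine (abs_sub _ _).trans (add_le_add ((abs_sub _ _).trans (add_le_add
        ((abs_sub _ _).trans (add_le_add le_rfl ?_)) ?_)) hEu)
      · rw [abs_mul, abs_of_nonneg ha0]
      · rw [abs_mul, abs_mul, abs_of_nonneg ha0, abs_of_nonneg (by linarith : (0 : ℝ) ≤ l)]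
        exact le_of_eq (by ring)
    refine (mul_le_mul_of_nonneg_left h hP0.le).trans ?_
    have i1 := mul_le_mul_of_nonneg_right hPaQ (abs_nonneg (Din v z))
    have i2 := mul_le_mul_of_nonneg_right hPaQ
      (mul_nonneg (by linarith : (0 : ℝ) ≤ l) (abs_nonneg (v z)))
    have i3 := mul_le_mul hPPQ hlv (abs_nonneg _) hQ0.le
    linarith
  have b3 : E z * (‖z.2‖ * |W * u z|) ≤ M * (Q * (l * |v z|)) := by
    have : E z * (‖z.2‖ * |W * u z|) = |W| * |v z| := by
      simp only [hv]
      rw [abs_mul, abs_mul, abs_mul, abs_of_pos hE0, abs_norm]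
      ring
    rw [this, ← mul_assoc]
    exact mul_le_mul (hW.trans (mul_le_mul_of_nonneg_left hγQ hM)) hlv (abs_nonneg _)
      (by positivity)
  have hVout : |V 0 + ∑ i : Fin 3, V i.succ * (z.2 i / ‖z.2‖)| ≤ 4 * M * P := by
    have h : ∀ i : Fin 3, |V i.succ * (z.2 i / ‖z.2‖)| ≤ M * P := by
      intro i
      rw [abs_mul]
      calc _ ≤ (M * P) * 1 := mul_le_mul (hV _) (abs_coord_div_norm_le_one z.2 i)
            (abs_nonneg _) (by positivity)
        _ = M * P := mul_one _
    refine (abs_add_le _ _).trans ((add_le_add (hV 0) ((Finset.abs_sum_le_sum_abs _ _).trans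
      (Finset.sum_le_sum fun i _ => h i))).trans (le_of_eq ?_))
    simp
    ring
  have hVrot : |∑ i : Fin 3, ∑ j, V i.succ * (‖z.2‖ ^ 2)⁻¹ * z.2 j
      * (E z * (‖z.2‖ * Drot j i u z))| ≤ M * ∑ i, ∑ j, P * ‖z.2‖⁻¹ * |Drot i j v z| := by
    rw [Finset.sum_comm, Finset.mul_sum]
    refine (Finset.abs_sum_le_sum_abs _ _).trans (Finset.sum_le_sum fun j _ => ?_)
    rw [Finset.mul_sum]
    refine (Finset.abs_sum_le_sum_abs _ _).trans (Finset.sum_le_sum fun i _ => ?_)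
    rw [← e3, abs_mul]
    have : V i.succ * (‖z.2‖ ^ 2)⁻¹ * z.2 j = V i.succ * (z.2 j / ‖z.2‖) * ‖z.2‖⁻¹ := by
      field_simp
    rw [this, abs_mul, abs_mul, abs_of_pos (inv_pos.mpr hr0)]
    have h1 : |V i.succ| * |z.2 j / ‖z.2‖| ≤ M * P * 1 :=
      mul_le_mul (hV _) (abs_coord_div_norm_le_one z.2 j) (abs_nonneg _) (by positivity)
    calc _ ≤ (M * P * 1) * ‖z.2‖⁻¹ * |Drot j i v z| :=
          mul_le_mul_of_nonneg_right (mul_le_mul_of_nonneg_right h1 (by positivity))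
            (abs_nonneg _)
      _ = _ := by ring
  have hmain : E z * (‖z.2‖ * |∑ α, V α * fderiv ℝ u z (coordDir α) + W * u z|) ≤
      |∑ α, V α * omegaHat z α| * |E z * (‖z.2‖ * Din u z)|
      + |V 0 + ∑ i : Fin 3, V i.succ * (z.2 i / ‖z.2‖)| * |E z * (‖z.2‖ * Dout u z)|
      + |∑ i : Fin 3, ∑ j, V i.succ * (‖z.2‖ ^ 2)⁻¹ * z.2 j * (E z * (‖z.2‖ * Drot j i u z))|
      + E z * (‖z.2‖ * |W * u z|) := by
    rw [sum_coeff_mul_fderiv V hz]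
    have h : ∀ s : ℝ, E z * (‖z.2‖ * |s|) = |E z * (‖z.2‖ * s)| := fun s => by
      rw [abs_mul, abs_mul, abs_of_pos hE0, abs_norm]
    rw [h, h, ← abs_mul, ← abs_mul]
    have : ∑ i : Fin 3, ∑ j, V i.succ * (‖z.2‖ ^ 2)⁻¹ * z.2 j * (E z * (‖z.2‖ * Drot j i u z))
        = E z * (‖z.2‖ * ∑ i : Fin 3, ∑ j, V i.succ * (‖z.2‖ ^ 2)⁻¹ * z.2 j * Drot j i u z) := by
      simp only [Finset.mul_sum]
      refine Finset.sum_congr rfl fun i _ => Finset.sum_congr rfl fun j _ => ?_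
      ring
    rw [this]
    refine le_trans (le_of_eq ?_) ((abs_add_le _ _).trans (add_le_add ((abs_add_le _ _).trans
      (add_le_add (abs_add_le _ _) le_rfl)) le_rfl))
    congr 1
    ring
  refine hmain.trans ?_
  have c1 : |∑ α, V α * omegaHat z α| * |E z * (‖z.2‖ * Din u z)| ≤
      M * Q * (|Din v z| + 3 * (l * |v z|)) :=
    mul_le_mul (hVω.trans (mul_le_mul_of_nonneg_left hγQ hM)) b1 (abs_nonneg _) (by positivity)
  have c2 : |V 0 + ∑ i : Fin 3, V i.succ * (z.2 i / ‖z.2‖)| * |E z * (‖z.2‖ * Dout u z)| ≤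
      4 * M * (P * |weightDeriv δ v z| + Q * (|Din v z| + 3 * (l * |v z|))) := by
    refine (mul_le_mul_of_nonneg_right hVout (abs_nonneg _)).trans ?_
    rw [mul_assoc (4 * M)]
    exact mul_le_mul_of_nonneg_left b2 (by positivity)
  have hrotn : 0 ≤ ∑ i, ∑ j, P * ‖z.2‖⁻¹ * |Drot i j v z| := by positivity
  have hZn : 0 ≤ M * (P * |weightDeriv δ v z|) := by positivity
  have hDn : 0 ≤ M * (Q * |Din v z|) := by positivity
  have hvn : 0 ≤ M * (Q * (l * |v z|)) := by positivity
  have hrotn' := mul_nonneg hM hrotn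
  unfold lowerOrderSize
  change _ ≤ 16 * M * (P * |weightDeriv δ v z| + Q * (|Din v z| + l * |v z|)
    + ∑ i, ∑ j, P * ‖z.2‖⁻¹ * |Drot i j v z|)
  generalize (∑ i, ∑ j, P * ‖z.2‖⁻¹ * |Drot i j v z|) = S at *
  linarith

theorem sq_lowerOrderSize_le {δ l : ℝ} (hδ : 0 < δ) (hδ2 : δ < 1 / 2) (hl : 1 ≤ l)
    {z : Spacetime} (hp : 1 ≤ outCoord z) (v : Spacetime → ℝ) :
    outCoord z ^ (3 / 2 : ℝ) * (lowerOrderSize δ l v z) ^ 2 ≤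
      192 / (1 - 2 * δ) * carlemanDensity δ l v z := by
  have hp0 : 0 < outCoord z := by linarith
  have hd : 0 < 1 - 2 * δ := by linarith
  set p := outCoord z with hpdef
  set X : Fin 3 → Fin 3 → ℝ := fun i j => ‖z.2‖⁻¹ * |Drot i j v z| with hX
  -- Cauchy–Schwarz for the twelve terms of `lowerOrderSize`
  have hcs : (lowerOrderSize δ l v z) ^ 2 ≤ 12 * ((p ^ (-1 : ℝ) * |weightDeriv δ v z|) ^ 2
      + (p ^ (-1 - δ / 2) * |Din v z|) ^ 2 + (p ^ (-1 - δ / 2) * (l * |v z|)) ^ 2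
      + ∑ i, ∑ j, (p ^ (-1 : ℝ) * X i j) ^ 2) := by
    have h : lowerOrderSize δ l v z = p ^ (-1 : ℝ) * |weightDeriv δ v z|
        + p ^ (-1 - δ / 2) * |Din v z| + p ^ (-1 - δ / 2) * (l * |v z|)
        + ∑ i, ∑ j, p ^ (-1 : ℝ) * X i j := by
      simp only [lowerOrderSize, hX, mul_add, mul_assoc, ← hpdef]
      ring
    have h9 : (∑ i, ∑ j, p ^ (-1 : ℝ) * X i j) ^ 2 ≤ 9 * ∑ i, ∑ j, (p ^ (-1 : ℝ) * X i j) ^ 2 := by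
      have := sq_sum_le_card_mul_sum_sq (s := (Finset.univ : Finset (Fin 3 × Fin 3)))
        (f := fun k => p ^ (-1 : ℝ) * X k.1 k.2)
      simpa [Fintype.sum_prod_type] using this
    rw [h]
    generalize (∑ i, ∑ j, p ^ (-1 : ℝ) * X i j) = S at *
    generalize (∑ i, ∑ j, (p ^ (-1 : ℝ) * X i j) ^ 2) = S2 at *
    generalize p ^ (-1 : ℝ) * |weightDeriv δ v z| = a at *
    generalize p ^ (-1 - δ / 2) * |Din v z| = b at *
    generalize p ^ (-1 - δ / 2) * (l * |v z|) = c at *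
    nlinarith [sq_nonneg (a - b), sq_nonneg (a - c), sq_nonneg (b - c), sq_nonneg (3 * a - S / 3),
      sq_nonneg (3 * b - S / 3), sq_nonneg (3 * c - S / 3)]
  have q1 : p ^ (3 / 2 : ℝ) * (p ^ (-1 : ℝ)) ^ 2 = p ^ (-1 / 2 : ℝ) := by
    rw [← Real.rpow_mul_natCast hp0.le, ← Real.rpow_add hp0]
    norm_num
  have q2 : p ^ (3 / 2 : ℝ) * (p ^ (-1 - δ / 2)) ^ 2 = p ^ (-1 / 2 - δ) := by
    rw [← Real.rpow_mul_natCast hp0.le, ← Real.rpow_add hp0]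
    congr 1
    push_cast
    ring
  have q3 : p ^ (-1 / 2 : ℝ) ≤ p ^ (3 / 2 : ℝ) :=
    Real.rpow_le_rpow_of_exponent_le hp (by norm_num)
  have q4 : p ^ (-1 / 2 : ℝ) ≤ p ^ (1 / 2 : ℝ) :=
    Real.rpow_le_rpow_of_exponent_le hp (by norm_num)
  have hw0 : 0 < p ^ (3 / 2 : ℝ) := Real.rpow_pos_of_pos hp0 _
  have hinv : 1 ≤ 1 / (1 - 2 * δ) := by
    rw [le_div_iff₀ hd]
    linarith
  have t1 : p ^ (3 / 2 : ℝ) * (p ^ (-1 : ℝ) * |weightDeriv δ v z|) ^ 2 ≤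
      1 / (1 - 2 * δ) * (3 * l * p ^ (3 / 2 : ℝ) * (weightDeriv δ v z) ^ 2) := by
    rw [mul_pow, ← mul_assoc, q1, sq_abs]
    have h1 : p ^ (-1 / 2 : ℝ) * (weightDeriv δ v z) ^ 2 ≤
        3 * l * p ^ (3 / 2 : ℝ) * (weightDeriv δ v z) ^ 2 :=
      mul_le_mul_of_nonneg_right (by nlinarith) (sq_nonneg _)
    exact h1.trans (le_mul_of_one_le_left (by positivity) hinv)
  have t2 : p ^ (3 / 2 : ℝ) * ((p ^ (-1 - δ / 2) * |Din v z|) ^ 2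
      + (p ^ (-1 - δ / 2) * (l * |v z|)) ^ 2) =
      1 / (1 - 2 * δ) * ((1 - 2 * δ) * p ^ (-1 / 2 - δ) * ((Din v z) ^ 2 + l ^ 2 * (v z) ^ 2)) := by
    rw [← q2]
    simp only [mul_pow, sq_abs]
    field_simp
  have t3 : p ^ (3 / 2 : ℝ) * ∑ i, ∑ j, (p ^ (-1 : ℝ) * X i j) ^ 2 ≤ 1 / (1 - 2 * δ) * (16 *
      ∑ i, ∑ j, 1 / 16 * p ^ (1 / 2 : ℝ) * (‖z.2‖ ^ 2)⁻¹ * (Drot i j v z) ^ 2) := by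
    refine le_trans ?_ (le_mul_of_one_le_left (by positivity) hinv)
    simp only [Finset.mul_sum]
    refine Finset.sum_le_sum fun i _ => Finset.sum_le_sum fun j _ => ?_
    rw [mul_pow, ← mul_assoc, q1, hX]
    simp only [mul_pow, sq_abs, inv_pow]
    have := mul_le_mul_of_nonneg_right q4
      (show 0 ≤ (‖z.2‖ ^ 2)⁻¹ * (Drot i j v z) ^ 2 by positivity)
    linarith
  have h := mul_le_mul_of_nonneg_left hcs hw0.le
  refine h.trans ?_
  have hA : 0 ≤ 1 / (1 - 2 * δ) * (3 * l * p ^ (3 / 2 : ℝ) * (weightDeriv δ v z) ^ 2) := by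
    positivity
  have hB : 0 ≤ 1 / (1 - 2 * δ) *
      ((1 - 2 * δ) * p ^ (-1 / 2 - δ) * ((Din v z) ^ 2 + l ^ 2 * (v z) ^ 2)) := by positivity
  have e : 192 / (1 - 2 * δ) * carlemanDensity δ l v z =
      192 * (1 / (1 - 2 * δ) *
        ((1 - 2 * δ) * p ^ (-1 / 2 - δ) * ((Din v z) ^ 2 + l ^ 2 * (v z) ^ 2)))
      + 192 * (1 / (1 - 2 * δ) * (3 * l * p ^ (3 / 2 : ℝ) * (weightDeriv δ v z) ^ 2))
      + 12 * (1 / (1 - 2 * δ) * (16 *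
        ∑ i, ∑ j, 1 / 16 * p ^ (1 / 2 : ℝ) * (‖z.2‖ ^ 2)⁻¹ * (Drot i j v z) ^ 2)) := by
    unfold carlemanDensity
    ring
  rw [e]
  linarith

theorem carlemanDensity_nonneg {δ l : ℝ} (hδ2 : δ < 1 / 2) (hl : 0 ≤ l)
    {z : Spacetime} (hp : 0 < outCoord z) (v : Spacetime → ℝ) : 0 ≤ carlemanDensity δ l v z := by
  have : 0 < 1 - 2 * δ := by linarith
  unfold carlemanDensity
  positivity

/-- For a large parameter `l` the Carleman density absorbs the lower-order terms of the equation. -/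
theorem WaveSystem.absorption {N : ℕ} {U : Set Spacetime} {M γ C : ℝ}
    {V : Fin N → Fin N → Fin 4 → Spacetime → ℝ} {W : Fin N → Fin N → Spacetime → ℝ}
    {u : Fin N → Spacetime → ℝ} (hu : WaveSystem U M γ C V W u) (hM : 0 ≤ M) {δ l : ℝ}
    (hδ : 0 < δ) (hδ2 : δ < 1 / 2) (hδγ : δ ≤ 2 * γ) (hl : 1 ≤ l)
    (hl' : N * (N * (16 * M) ^ 2 * (192 / (1 - 2 * δ))) ≤ 2 * l)
    {z : Spacetime} (hzU : z ∈ U) (hz : z.2 ≠ 0) (hp : 1 ≤ outCoord z)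
    (hpr : outCoord z ≤ 4 * ‖z.2‖) :
    ∑ I, (4 * l)⁻¹ * outCoord z ^ (3 / 2 : ℝ) *
        (Real.exp (l * weight δ z) * nullWave (fun y => ‖y.2‖ * u I y) z) ^ 2 ≤
      1 / 2 * ∑ J, carlemanDensity δ l
        (fun y => Real.exp (l * weight δ y) * (‖y.2‖ * u J y)) z := by
  have hp0 : 0 < outCoord z := by linarith
  have hl0 : 0 < l := by linarith
  have hd : 0 < 1 - 2 * δ := by linarith
  set v : Fin N → Spacetime → ℝ := fun J y => Real.exp (l * weight δ y) * (‖y.2‖ * u J y) with hv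
  have h1 : ∀ I, |Real.exp (l * weight δ z) * nullWave (fun y => ‖y.2‖ * u I y) z| ≤
      ∑ J, 16 * M * lowerOrderSize δ l (v J) z := by
    intro I
    rw [hu.equation z hzU I, abs_mul, abs_neg, abs_mul, abs_norm, Real.abs_exp]
    calc _ ≤ Real.exp (l * weight δ z) * (‖z.2‖ * ∑ J,
          |∑ α, V I J α z * fderiv ℝ (u J) z (coordDir α) + W I J z * u J z|) := by
          gcongr
          exact Finset.abs_sum_le_sum_abs _ _
      _ = ∑ J, Real.exp (l * weight δ z) * (‖z.2‖ *
          |∑ α, V I J α z * fderiv ℝ (u J) z (coordDir α) + W I J z * u J z|) := by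
          rw [Finset.mul_sum, Finset.mul_sum]
      _ ≤ _ := Finset.sum_le_sum fun J _ => abs_lowerOrder_le hδ (by linarith) hδγ hl hM hz hp hpr
          (V := fun α => V I J α z) (hu.abs_V_le z hzU I J) (hu.abs_V_omegaHat_le z hzU I J)
          (hu.abs_W_le z hzU I J) (hu.contDiffAt z hzU J)
  have h2 : ∀ I, outCoord z ^ (3 / 2 : ℝ) *
      (Real.exp (l * weight δ z) * nullWave (fun y => ‖y.2‖ * u I y) z) ^ 2 ≤
      N * (16 * M) ^ 2 * (192 / (1 - 2 * δ)) * ∑ J, carlemanDensity δ l (v J) z := by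
    intro I
    have h3 := sq_le_sq' (neg_le_of_abs_le (h1 I)) (le_of_abs_le (h1 I))
    have h4 := sq_sum_le_card_mul_sum_sq (s := (Finset.univ : Finset (Fin N)))
      (f := fun J => 16 * M * lowerOrderSize δ l (v J) z)
    rw [Finset.card_univ, Fintype.card_fin] at h4
    calc _ ≤ outCoord z ^ (3 / 2 : ℝ) * (N * ∑ J, (16 * M * lowerOrderSize δ l (v J) z) ^ 2) :=
          mul_le_mul_of_nonneg_left (h3.trans h4) (by positivity)
      _ = N * (16 * M) ^ 2 *
          ∑ J, outCoord z ^ (3 / 2 : ℝ) * (lowerOrderSize δ l (v J) z) ^ 2 := by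
          simp only [Finset.mul_sum]
          refine Finset.sum_congr rfl fun J _ => ?_
          ring
      _ ≤ N * (16 * M) ^ 2 * ∑ J, 192 / (1 - 2 * δ) * carlemanDensity δ l (v J) z := by
          exact mul_le_mul_of_nonneg_left (Finset.sum_le_sum fun J _ =>
            sq_lowerOrderSize_le hδ hδ2 hl hp _) (by positivity)
      _ = _ := by
          rw [← Finset.mul_sum]
          ring
  have hS : 0 ≤ ∑ J, carlemanDensity δ l (v J) z :=
    Finset.sum_nonneg fun J _ => carlemanDensity_nonneg hδ2 hl0.le hp0 _
  calc _ ≤ ∑ _I : Fin N, (4 * l)⁻¹ * (N * (16 * M) ^ 2 * (192 / (1 - 2 * δ)) *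
        ∑ J, carlemanDensity δ l (v J) z) := by
        refine Finset.sum_le_sum fun I _ => ?_
        rw [mul_assoc]
        exact mul_le_mul_of_nonneg_left (h2 I) (by positivity)
    _ = (4 * l)⁻¹ * (N * (N * (16 * M) ^ 2 * (192 / (1 - 2 * δ)))) *
        ∑ J, carlemanDensity δ l (v J) z := by
        rw [Finset.sum_const, Finset.card_univ, Fintype.card_fin, nsmul_eq_mul]
        ring
    _ ≤ (4 * l)⁻¹ * (2 * l) * ∑ J, carlemanDensity δ l (v J) z := by gcongr
    _ = _ := by
        rw [show (4 * l)⁻¹ * (2 * l) = 1 / 2 by field_simp; norm_num]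

/-- Where the solution is cut off by a radial function `g` with `|g| ≤ 1`, `|∂_q g| ≲ 1` and
`|∂_p g|, |∂_p ∂_q g| ≲ 1 / p`, the wave operator decays like `p^{-3/2}`. -/
theorem WaveSystem.abs_nullWave_cutoff_le {N : ℕ} {U : Set Spacetime} {M γ C B : ℝ}
    {V : Fin N → Fin N → Fin 4 → Spacetime → ℝ} {W : Fin N → Fin N → Spacetime → ℝ}
    {u : Fin N → Spacetime → ℝ} (hu : WaveSystem U M γ C V W u) (hM : 0 ≤ M) (hC : 0 ≤ C)
    (hγ : 0 ≤ γ) {g : Spacetime → ℝ}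
    {z : Spacetime} (hzU : z ∈ U) (hz : z.2 ≠ 0) (hp : 1 ≤ outCoord z)
    (hrp : ‖z.2‖ ≤ outCoord z) (hg : ContDiffAt ℝ 2 g z)
    (hrot : ∀ i j, ∀ᶠ y in 𝓝 z, Drot i j g y = 0) (h1 : |g z| ≤ 1) (h2 : |Din g z| ≤ B)
    (h3 : |Dout g z| ≤ B * outCoord z ^ (-1 : ℝ))
    (h4 : |Dout (Din g) z| ≤ B * outCoord z ^ (-1 : ℝ)) (I : Fin N) :
    |nullWave (fun y => g y * (‖y.2‖ * u I y)) z| ≤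
      (5 * N * M * C + 24 * B * C) * outCoord z ^ (-3 / 2 : ℝ) := by
  have hp0 : 0 < outCoord z := by linarith
  have hB : 0 ≤ B := (abs_nonneg _).trans h2
  set p := outCoord z with hpdef
  set P := p ^ (-3 / 2 : ℝ) with hP
  have hP0 : 0 < P := Real.rpow_pos_of_pos hp0 _
  have hinv : p ^ (-1 : ℝ) = p⁻¹ := Real.rpow_neg_one p
  have hpinv : 0 < p⁻¹ := inv_pos.mpr hp0
  have hcan : p * p⁻¹ = 1 := mul_inv_cancel₀ hp0.ne'
  have hpinv1 : p⁻¹ ≤ 1 := inv_le_one_of_one_le₀ hp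
  have h52 : p ^ (-5 / 2 : ℝ) = P * p⁻¹ := by
    rw [hP, ← hinv, ← Real.rpow_add hp0]
    norm_num
  have hrd : DifferentiableAt ℝ (fun y : Spacetime => ‖y.2‖) z :=
    (contDiffAt_radius (n := 1) hz).differentiableAt (by norm_num)
  have huc := hu.contDiffAt z hzU I
  have hud := huc.differentiableAt (by norm_num)
  have e1 : Din (fun y => ‖y.2‖ * u I y) z = 1 / 2 * u I z + ‖z.2‖ * Din (u I) z := by
    have h : Din (fun y => ‖y.2‖ * u I y) z = Din (fun y => ‖y.2‖) z * _ + _ * Din (u I) z :=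
      along_mul hrd hud
    rw [h, din_eq hrd (hasDerivAt_radius_nullField hz _)]
  have e2 : Dout (fun y => ‖y.2‖ * u I y) z = 1 / 2 * u I z + ‖z.2‖ * Dout (u I) z := by
    have h : Dout (fun y => ‖y.2‖ * u I y) z = Dout (fun y => ‖y.2‖) z * _ + _ * Dout (u I) z :=
      along_mul hrd hud
    rw [h, dout_eq hrd (hasDerivAt_radius_nullField hz _)]
  have b0 : |u I z| ≤ C * P := hu.abs_le z hzU I
  have bD : ∀ J α, |fderiv ℝ (u J) z (coordDir α)| ≤ C * P := fun J => hu.abs_fderiv_le z hzU J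
  have bout : |Dout (u I) z| ≤ C * P * p⁻¹ := by
    have := hu.abs_dout_le z hzU I
    rwa [← hpdef, h52, ← mul_assoc] at this
  have bin : |Din (u I) z| ≤ 2 * (C * P) := by
    have h : Din (u I) z = Dout (u I) z - fderiv ℝ (u I) z (coordDir 0) := by
      rw [fderiv_time_eq]; ring
    rw [h]
    refine (abs_sub _ _).trans ?_
    have h1 := bD I 0
    have h2 : C * P * p⁻¹ ≤ C * P := mul_le_of_le_one_right (by positivity) hpinv1
    linarith
  have c0 : |‖z.2‖ * u I z| ≤ p * (C * P) := by
    rw [abs_mul, abs_norm]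
    exact mul_le_mul hrp b0 (abs_nonneg _) hp0.le
  have c1 : |Din (fun y => ‖y.2‖ * u I y) z| ≤ 3 * (p * (C * P)) := by
    rw [e1]
    refine (abs_add_le _ _).trans ?_
    rw [abs_mul, abs_mul, abs_norm]
    have h1 := mul_le_mul hrp bin (abs_nonneg _) hp0.le
    have h2 : C * P ≤ p * (C * P) := le_mul_of_one_le_left (by positivity) hp
    have h3 : |(1 / 2 : ℝ)| = 1 / 2 := by norm_num
    have h4 : 0 ≤ C * P := by positivity
    rw [h3]
    linarith
  have c2 : |Dout (fun y => ‖y.2‖ * u I y) z| ≤ 2 * (C * P) := by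
    rw [e2]
    refine (abs_add_le _ _).trans ?_
    rw [abs_mul, abs_mul, abs_norm]
    have h1 := mul_le_mul hrp bout (abs_nonneg _) hp0.le
    have h2 : p * (C * P * p⁻¹) = C * P := by
      rw [mul_comm (C * P), ← mul_assoc, hcan, one_mul]
    have h3 : |(1 / 2 : ℝ)| = 1 / 2 := by norm_num
    rw [h3]
    have h4 : 0 ≤ C * P := by positivity
    linarith
  have c3 : |nullWave (fun y => ‖y.2‖ * u I y) z| ≤ 5 * N * M * C * P := by
    rw [hu.equation z hzU I, abs_neg, abs_mul, abs_norm]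
    have hγp : p ^ (-1 - γ) ≤ p⁻¹ := by
      rw [← hinv]
      exact Real.rpow_le_rpow_of_exponent_le hp (by linarith)
    have hJ : ∀ J, |∑ α, V I J α z * fderiv ℝ (u J) z (coordDir α) + W I J z * u J z| ≤
        5 * (M * p⁻¹ * (C * P)) := by
      intro J
      have hα : ∀ α, |V I J α z * fderiv ℝ (u J) z (coordDir α)| ≤ M * p⁻¹ * (C * P) := by
        intro α
        rw [abs_mul]
        have := hu.abs_V_le z hzU I J α
        rw [← hpdef, hinv] at this
        exact mul_le_mul this (bD J α) (abs_nonneg _) (by positivity)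
      have hW : |W I J z * u J z| ≤ M * p⁻¹ * (C * P) := by
        rw [abs_mul]
        exact mul_le_mul ((hu.abs_W_le z hzU I J).trans (mul_le_mul_of_nonneg_left hγp hM))
          (hu.abs_le z hzU J) (abs_nonneg _) (by positivity)
      refine (abs_add_le _ _).trans ((add_le_add ((Finset.abs_sum_le_sum_abs _ _).trans
        (Finset.sum_le_sum fun α _ => hα α)) hW).trans (le_of_eq ?_))
      simp
      ring
    calc _ ≤ p * ∑ _J : Fin N, 5 * (M * p⁻¹ * (C * P)) :=
          mul_le_mul hrp ((Finset.abs_sum_le_sum_abs _ _).trans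
            (Finset.sum_le_sum fun J _ => hJ J)) (abs_nonneg _) hp0.le
      _ = p * p⁻¹ * (5 * N * M * C * P) := by
          rw [Finset.sum_const, Finset.card_univ, Fintype.card_fin, nsmul_eq_mul]
          ring
      _ = _ := by rw [hcan, one_mul]
  rw [nullWave_mul hz hg ((contDiffAt_radius hz).mul huc) hrot]
  rw [hinv] at h3 h4
  have d1 : |g z * nullWave (fun y => ‖y.2‖ * u I y) z| ≤ 5 * N * M * C * P := by
    rw [abs_mul]
    calc _ ≤ 1 * (5 * N * M * C * P) := mul_le_mul h1 c3 (abs_nonneg _) zero_le_one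
      _ = _ := one_mul _
  have d2 : |Dout g z * Din (fun y => ‖y.2‖ * u I y) z| ≤ 3 * (B * C * P) := by
    rw [abs_mul]
    calc _ ≤ B * p⁻¹ * (3 * (p * (C * P))) := mul_le_mul h3 c1 (abs_nonneg _) (by positivity)
      _ = p * p⁻¹ * (3 * (B * C * P)) := by ring
      _ = _ := by rw [hcan, one_mul]
  have d3 : |Din g z * Dout (fun y => ‖y.2‖ * u I y) z| ≤ 2 * (B * C * P) := by
    rw [abs_mul]
    calc _ ≤ B * (2 * (C * P)) := mul_le_mul h2 c2 (abs_nonneg _) (by positivity)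
      _ = _ := by ring
  have d4 : |Dout (Din g) z * (‖z.2‖ * u I z)| ≤ B * C * P := by
    rw [abs_mul]
    calc _ ≤ B * p⁻¹ * (p * (C * P)) := mul_le_mul h4 c0 (abs_nonneg _) (by positivity)
      _ = p * p⁻¹ * (B * C * P) := by ring
      _ = _ := by rw [hcan, one_mul]
  refine (abs_add_le _ _).trans ?_
  rw [abs_mul 4, abs_of_pos (by norm_num : (0 : ℝ) < 4)]
  have d5 := (abs_add_le (Dout g z * Din (fun y => ‖y.2‖ * u I y) z
    + Din g z * Dout (fun y => ‖y.2‖ * u I y) z) (Dout (Din g) z * (‖z.2‖ * u I z))).trans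
    (add_le_add ((abs_add_le _ _).trans (add_le_add d2 d3)) d4)
  linarith

/-! ### Cutoff functions and supports -/

theorem exists_bound_deriv_smoothTransition :
    ∃ B : ℝ, 1 ≤ B ∧ ∀ s : ℝ, |deriv Real.smoothTransition s| ≤ B ∧
      |deriv (deriv Real.smoothTransition) s| ≤ B := by
  have h2 : ContDiff ℝ 2 Real.smoothTransition := Real.smoothTransition.contDiff
  have h1 : ContDiff ℝ 1 (deriv Real.smoothTransition) := by
    have : ContDiff ℝ (1 + 1) Real.smoothTransition := by
      simpa [one_add_one_eq_two] using h2
    exact (contDiff_succ_iff_deriv.mp this).2.2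
  have h0 : Continuous (deriv (deriv Real.smoothTransition)) := h1.continuous_deriv (by norm_num)
  obtain ⟨B₁, hB₁⟩ := (isCompact_Icc (a := (0 : ℝ)) (b := 1)).exists_bound_of_continuousOn
    h1.continuous.continuousOn
  obtain ⟨B₂, hB₂⟩ := (isCompact_Icc (a := (0 : ℝ)) (b := 1)).exists_bound_of_continuousOn
    h0.continuousOn
  refine ⟨max 1 (max B₁ B₂), le_max_left _ _, fun s => ?_⟩
  by_cases hs : s ∈ Set.Icc (0 : ℝ) 1
  · exact ⟨(hB₁ s hs).trans ((le_max_left _ _).trans (le_max_right _ _)),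
      (hB₂ s hs).trans ((le_max_right _ _).trans (le_max_right _ _))⟩
  have hloc : ∃ c : ℝ, Real.smoothTransition =ᶠ[𝓝 s] fun _ => c := by
    rw [Set.mem_Icc, not_and_or, not_le, not_le] at hs
    rcases hs with hs | hs
    · exact ⟨0, (eventually_lt_nhds hs).mono fun y hy =>
        Real.smoothTransition.zero_of_nonpos hy.le⟩
    · exact ⟨1, (eventually_gt_nhds hs).mono fun y hy =>
        Real.smoothTransition.one_of_one_le hy.le⟩
  obtain ⟨c, hc⟩ := hloc
  have e1 : deriv Real.smoothTransition =ᶠ[𝓝 s] fun _ => 0 := by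
    have := hc.deriv
    simpa using this
  rw [e1.deriv_eq, e1.self_of_nhds]
  simp

/-- The cutoff function: `0` where `f ≤ c₀` or `p ≥ 2T`, and `1` where `f ≥ c₁` and `p ≤ T`. -/
noncomputable def cutoff (δ c₀ c₁ T : ℝ) (z : Spacetime) : ℝ :=
  Real.smoothTransition ((weight δ z - c₀) / (c₁ - c₀)) *
    Real.smoothTransition (2 - outCoord z / T)

theorem cutoff_eq_zero_of_weight_le {δ c₀ c₁ T : ℝ} (hc : c₀ < c₁) {z : Spacetime}
    (h : weight δ z ≤ c₀) : cutoff δ c₀ c₁ T z = 0 := by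
  rw [cutoff, Real.smoothTransition.zero_of_nonpos, zero_mul]
  exact div_nonpos_of_nonpos_of_nonneg (by linarith) (by linarith)

theorem cutoff_eq_zero_of_le_outCoord {δ c₀ c₁ T : ℝ} (hT : 0 < T) {z : Spacetime}
    (h : 2 * T ≤ outCoord z) : cutoff δ c₀ c₁ T z = 0 := by
  rw [cutoff, Real.smoothTransition.zero_of_nonpos (x := 2 - outCoord z / T), mul_zero]
  rw [sub_nonpos, le_div_iff₀ hT]
  exact h

theorem cutoff_eq_one {δ c₀ c₁ T : ℝ} (hc : c₀ < c₁) (hT : 0 < T) {z : Spacetime}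
    (h : c₁ ≤ weight δ z) (h' : outCoord z ≤ T) : cutoff δ c₀ c₁ T z = 1 := by
  rw [cutoff, Real.smoothTransition.one_of_one_le, Real.smoothTransition.one_of_one_le, one_mul]
  · have : outCoord z / T ≤ 1 := (div_le_one hT).mpr h'
    linarith
  · rw [le_div_iff₀ (by linarith)]
    linarith

section

variable {δ : ℝ} {z : Spacetime} {A B : ℝ → ℝ} {A' B' : ℝ}

/-- First derivatives of a product of a function of `f` and a function of `p`. -/
theorem derivs_comp_weight_mul_comp_outCoord (hδ : δ ≠ 0) (hz : z.2 ≠ 0) (hp : 0 < outCoord z)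
    (hA : HasDerivAt A A' (weight δ z)) (hB : HasDerivAt B B' (outCoord z)) :
    Dout (fun y => A (weight δ y) * B (outCoord y)) z =
        A' * weightSlope δ z * B (outCoord z) + A (weight δ z) * B' ∧
      Din (fun y => A (weight δ y) * B (outCoord y)) z = A' * B (outCoord z) ∧
      ∀ i j, Drot i j (fun y => A (weight δ y) * B (outCoord y)) z = 0 := by
  have hP : DifferentiableAt ℝ outCoord z :=
    (contDiffAt_outCoord (n := 1) hz).differentiableAt (by norm_num)
  have hBd : DifferentiableAt ℝ (fun y => B (outCoord y)) z := hB.differentiableAt.comp z hP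
  have hAd : DifferentiableAt ℝ (fun y => A (weight δ y)) z := hA.differentiableAt.comp z
    ((contDiffAt_weight (n := 1) hz hp).differentiableAt (by norm_num))
  have h1 : Dout (fun y => A (weight δ y) * B (outCoord y)) z =
    Dout (fun y => A (weight δ y)) z * _ + _ * Dout (fun y => B (outCoord y)) z :=
    along_mul hAd hBd
  have h2 : Din (fun y => A (weight δ y) * B (outCoord y)) z =
    Din (fun y => A (weight δ y)) z * _ + _ * Din (fun y => B (outCoord y)) z :=
    along_mul hAd hBd
  have h3 : ∀ i j, Drot i j (fun y => A (weight δ y) * B (outCoord y)) z =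
    Drot i j (fun y => A (weight δ y)) z * _ + _ * Drot i j (fun y => B (outCoord y)) z :=
    fun i j => along_mul hAd hBd
  refine ⟨?_, ?_, fun i j => ?_⟩
  · rw [h1, dout_comp_weight hδ hz hp hA,
      dout_eq hBd (hB.comp_outCoord (hasDerivAt_outCoord_nullField hz _))]
    norm_num
  · rw [h2, din_comp_weight hδ hz hp hA,
      din_eq hBd (hB.comp_outCoord (hasDerivAt_outCoord_nullField hz _))]
    norm_num
  · rw [h3, drot_comp_weight hδ hz hp hA,
      drot_eq hBd (hB.comp_outCoord (hasDerivAt_outCoord_rotField hz i j))]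
    norm_num

end

/-- The cutoff functions satisfy the derivative bounds required in
`WaveSystem.abs_nullWave_cutoff_le`, uniformly in `T`. -/
theorem exists_cutoff_bound {δ c₀ c₁ : ℝ} (hδ : 0 < δ) (hc : c₀ < c₁) :
    ∃ B : ℝ, 0 ≤ B ∧ ∀ T : ℝ, 1 ≤ T → ∀ z : Spacetime, z.2 ≠ 0 → 1 ≤ outCoord z →
      outCoord z ≤ 2 * T →
      ContDiffAt ℝ 2 (cutoff δ c₀ c₁ T) z ∧
      (∀ i j, ∀ᶠ y in 𝓝 z, Drot i j (cutoff δ c₀ c₁ T) y = 0) ∧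
      |cutoff δ c₀ c₁ T z| ≤ 1 ∧ |Din (cutoff δ c₀ c₁ T) z| ≤ B ∧
      |Dout (cutoff δ c₀ c₁ T) z| ≤ B * outCoord z ^ (-1 : ℝ) ∧
      |Dout (Din (cutoff δ c₀ c₁ T)) z| ≤ B * outCoord z ^ (-1 : ℝ) := by
  obtain ⟨b, hb1, hb⟩ := exists_bound_deriv_smoothTransition
  set d := (c₁ - c₀)⁻¹ with hd
  have hd0 : 0 < d := inv_pos.mpr (by linarith)
  refine ⟨b * d + b * d ^ 2 + 2 * b + 2 * b ^ 2 * d, by positivity, ?_⟩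
  intro T hT z hz hp hpT
  have hT0 : 0 < T := by linarith
  have hp0 : 0 < outCoord z := by linarith
  set A : ℝ → ℝ := fun s => Real.smoothTransition ((s - c₀) / (c₁ - c₀)) with hA
  set A₁ : ℝ → ℝ := fun s => deriv Real.smoothTransition ((s - c₀) / (c₁ - c₀)) * d with hA₁
  set A₂ : ℝ → ℝ := fun s =>
    deriv (deriv Real.smoothTransition) ((s - c₀) / (c₁ - c₀)) * d * d with hA₂
  set E : ℝ → ℝ := fun p => Real.smoothTransition (2 - p / T) with hE
  set E₁ : ℝ → ℝ := fun p => deriv Real.smoothTransition (2 - p / T) * -T⁻¹ with hE₁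
  have hS : ContDiff ℝ 2 Real.smoothTransition := Real.smoothTransition.contDiff
  have hS1 : ContDiff ℝ 1 (deriv Real.smoothTransition) := by
    have : ContDiff ℝ (1 + 1) Real.smoothTransition := by
      simpa [one_add_one_eq_two] using hS
    exact (contDiff_succ_iff_deriv.mp this).2.2
  have hlin : ∀ s, HasDerivAt (fun s => (s - c₀) / (c₁ - c₀)) d s := fun s =>
    (((hasDerivAt_id s).sub_const c₀).div_const (c₁ - c₀)).congr_deriv (by simp [hd])
  have hlinE : ∀ p, HasDerivAt (fun p => 2 - p / T) (-T⁻¹) p := fun p =>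
    (((hasDerivAt_id p).div_const T).const_sub 2).congr_deriv (by simp)
  have dA : ∀ s, HasDerivAt A (A₁ s) s := fun s =>
    HasDerivAt.comp s ((hS.differentiable (by norm_num)) _).hasDerivAt (hlin s)
  have dA₁ : ∀ s, HasDerivAt A₁ (A₂ s) s := fun s =>
    (HasDerivAt.comp s ((hS1.differentiable (by norm_num)) _).hasDerivAt (hlin s)).mul_const d
  have dE : ∀ p, HasDerivAt E (E₁ p) p := fun p =>
    HasDerivAt.comp p ((hS.differentiable (by norm_num)) _).hasDerivAt (hlinE p)
  have hg : cutoff δ c₀ c₁ T = fun y => A (weight δ y) * E (outCoord y) := rfl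
  have hnear := eventually_ne_zero_and_outCoord_pos hz hp0
  obtain ⟨e1, e2, -⟩ := derivs_comp_weight_mul_comp_outCoord hδ.ne' hz hp0 (dA _) (dE _)
  have e3 : Dout (Din (cutoff δ c₀ c₁ T)) z =
      A₂ (weight δ z) * weightSlope δ z * E (outCoord z) + A₁ (weight δ z) * E₁ (outCoord z) := by
    have h : Din (cutoff δ c₀ c₁ T) =ᶠ[𝓝 z] fun y => A₁ (weight δ y) * E (outCoord y) := by
      filter_upwards [hnear] with y hy
      exact (derivs_comp_weight_mul_comp_outCoord hδ.ne' hy.1 hy.2 (dA _) (dE _)).2.1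
    have h' : Dout (Din (cutoff δ c₀ c₁ T)) z =
      Dout (fun y => A₁ (weight δ y) * E (outCoord y)) z := along_congr h
    rw [h']
    exact (derivs_comp_weight_mul_comp_outCoord hδ.ne' hz hp0 (dA₁ _) (dE _)).1
  rw [← hg] at e1 e2
  have bA : ∀ s, |A s| ≤ 1 := fun s => by
    rw [abs_of_nonneg (Real.smoothTransition.nonneg _)]
    exact Real.smoothTransition.le_one _
  have bE : ∀ s, |E s| ≤ 1 := fun s => by
    rw [abs_of_nonneg (Real.smoothTransition.nonneg _)]
    exact Real.smoothTransition.le_one _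
  have bA₁ : ∀ s, |A₁ s| ≤ b * d := fun s => by
    rw [hA₁, abs_mul, abs_of_pos hd0]
    exact mul_le_mul_of_nonneg_right (hb _).1 hd0.le
  have bA₂ : ∀ s, |A₂ s| ≤ b * d ^ 2 := fun s => by
    rw [hA₂, abs_mul, abs_mul, abs_of_pos hd0, mul_assoc, ← pow_two]
    exact mul_le_mul_of_nonneg_right (hb _).2 (by positivity)
  have hinv : outCoord z ^ (-1 : ℝ) = (outCoord z)⁻¹ := Real.rpow_neg_one _
  set q := (outCoord z)⁻¹ with hq
  have hq0 : 0 < q := inv_pos.mpr hp0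
  have hTq : T⁻¹ ≤ 2 * q := by
    rw [hq, inv_le_iff_one_le_mul₀ hT0, mul_assoc, inv_mul_eq_div]
    have : 1 / 2 ≤ T / outCoord z := by
      rw [le_div_iff₀ hp0]
      linarith
    linarith
  have bE₁ : |E₁ (outCoord z)| ≤ 2 * b * q := by
    rw [hE₁, abs_mul, abs_neg, abs_of_pos (inv_pos.mpr hT0)]
    calc _ ≤ b * (2 * q) := mul_le_mul (hb _).1 hTq (by positivity) (by linarith)
      _ = _ := by ring
  have ba : |weightSlope δ z| ≤ q := by
    rw [weightSlope, abs_of_pos (Real.rpow_pos_of_pos hp0 _), ← hinv]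
    exact Real.rpow_le_rpow_of_exponent_le hp (by linarith)
  have hbd : 0 ≤ b * d := by positivity
  have hbd2 : 0 ≤ b * d ^ 2 := by positivity
  have hb2d : 0 ≤ b ^ 2 * d := by positivity
  refine ⟨?_, fun i j => ?_, ?_, ?_, ?_, ?_⟩
  · have hw := contDiffAt_weight (n := 2) (δ := δ) hz hp0
    have hP := contDiffAt_outCoord (n := 2) hz
    exact (hS.contDiffAt.comp z ((hw.sub contDiffAt_const).div_const _)).mul
      (hS.contDiffAt.comp z (contDiffAt_const.sub (hP.div_const _)))
  · filter_upwards [hnear] with y hy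
    exact (derivs_comp_weight_mul_comp_outCoord hδ.ne' hy.1 hy.2 (dA _) (dE _)).2.2 i j
  · rw [hg, abs_mul]
    calc _ ≤ (1 : ℝ) * 1 := mul_le_mul (bA _) (bE _) (abs_nonneg _) zero_le_one
      _ = 1 := mul_one _
  · rw [e2, abs_mul]
    calc _ ≤ b * d * 1 := mul_le_mul (bA₁ _) (bE _) (abs_nonneg _) (by positivity)
      _ ≤ _ := by linarith
  · rw [e1, hinv]
    refine (abs_add_le _ _).trans ?_
    rw [abs_mul, abs_mul, abs_mul (A _)]
    calc _ ≤ b * d * q * 1 + 1 * (2 * b * q) :=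
          add_le_add
            (mul_le_mul (mul_le_mul (bA₁ _) ba (abs_nonneg _) hbd) (bE _) (abs_nonneg _)
              (by positivity))
            (mul_le_mul (bA _) bE₁ (abs_nonneg _) zero_le_one)
      _ = (b * d + 2 * b) * q := by ring
      _ ≤ _ := mul_le_mul_of_nonneg_right (by linarith) hq0.le
  · rw [e3, hinv]
    refine (abs_add_le _ _).trans ?_
    rw [abs_mul, abs_mul, abs_mul (A₁ _)]
    calc _ ≤ b * d ^ 2 * q * 1 + b * d * (2 * b * q) :=
          add_le_add
            (mul_le_mul (mul_le_mul (bA₂ _) ba (abs_nonneg _) hbd2) (bE _) (abs_nonneg _)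
              (by positivity))
            (mul_le_mul (bA₁ _) bE₁ (abs_nonneg _) hbd)
      _ = (b * d ^ 2 + 2 * b ^ 2 * d) * q := by ring
      _ ≤ _ := mul_le_mul_of_nonneg_right (by linarith) hq0.le

/-- The set on which the cut-off solution may be nonzero. -/
def cutoffSupport (δ p₀ c₀ R T : ℝ) : Set Spacetime :=
  {z | p₀ ≤ outCoord z ∧ outCoord z ≤ 2 * T ∧ c₀ ≤ weight δ z ∧ inCoord z ≤ R}

theorem continuous_outCoord : Continuous outCoord :=
  continuous_fst.add continuous_snd.norm

theorem continuous_inCoord : Continuous inCoord :=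
  continuous_snd.norm.sub continuous_fst

theorem isCompact_cutoffSupport {δ p₀ c₀ R T : ℝ} (hδ : 0 < δ) (hp₀ : 0 < p₀) :
    IsCompact (cutoffSupport δ p₀ c₀ R T) := by
  have hset : cutoffSupport δ p₀ c₀ R T = {z | p₀ ≤ outCoord z ∧ outCoord z ≤ 2 * T ∧
      c₀ ≤ inCoord z - δ⁻¹ * (max (outCoord z) p₀) ^ (-δ) ∧ inCoord z ≤ R} := by
    ext z
    simp only [cutoffSupport, Set.mem_ofPred_eq, weight]
    refine and_congr_right fun h => ?_
    rw [max_eq_left h]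
  have hcont : Continuous fun z => inCoord z - δ⁻¹ * (max (outCoord z) p₀) ^ (-δ) :=
    continuous_inCoord.sub (continuous_const.mul
      ((continuous_outCoord.max continuous_const).rpow_const fun z =>
        Or.inl (lt_of_lt_of_le hp₀ (le_max_right _ _)).ne'))
  have hclosed : IsClosed (cutoffSupport δ p₀ c₀ R T) := by
    rw [hset]
    exact (isClosed_le continuous_const continuous_outCoord).inter
      ((isClosed_le continuous_outCoord continuous_const).inter
        ((isClosed_le continuous_const hcont).inter
          (isClosed_le continuous_inCoord continuous_const)))
  refine Metric.isCompact_of_isClosed_isBounded hclosed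
    ((Metric.isBounded_closedBall (x := 0) (r := |T| + |R| + |c₀|)).subset ?_)
  rintro z ⟨h1, h2, h3, h4⟩
  have hpos : 0 ≤ δ⁻¹ * outCoord z ^ (-δ) :=
    mul_nonneg (inv_pos.mpr hδ).le (Real.rpow_nonneg (by linarith) _)
  have h5 : c₀ ≤ inCoord z := by
    unfold weight at h3
    linarith
  unfold outCoord at h1 h2
  unfold inCoord at h4 h5
  have a1 := le_abs_self T
  have a2 := le_abs_self R
  have a3 := neg_abs_le c₀
  have a4 := abs_nonneg T
  have a5 := abs_nonneg R
  have a6 := abs_nonneg c₀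
  rw [mem_closedBall_zero_iff, Prod.norm_def, max_le_iff, Real.norm_eq_abs, abs_le]
  refine ⟨⟨by linarith, by linarith⟩, by linarith⟩

/-- The region between two light cones has finite volume for the density `r^{-2} p^{-3/2}`. -/
theorem integrableOn_shell {t₀ Q : ℝ} (ht₀ : 1 ≤ t₀) (hQ : 0 ≤ Q) (htQ : 2 * Q ≤ t₀) :
    IntegrableOn (fun z : Spacetime => (‖z.2‖ ^ 2)⁻¹ * outCoord z ^ (-3 / 2 : ℝ))
      {z | t₀ ≤ z.1 ∧ |inCoord z| ≤ Q} := by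
  set S : Set Spacetime := {z | t₀ ≤ z.1 ∧ |inCoord z| ≤ Q} with hS
  have hSm : MeasurableSet S :=
    ((isClosed_le continuous_const continuous_fst).inter
      (isClosed_le continuous_inCoord.abs continuous_const)).measurableSet
  set ω := (volume : Measure (EuclideanSpace ℝ (Fin 3))).real (Metric.ball 0 1) with hω
  set A : ℝ → Set (EuclideanSpace ℝ (Fin 3)) := fun t => {x | |‖x‖ - t| ≤ Q} with hA
  have hAm : ∀ t, MeasurableSet (A t) := fun t =>
    (isClosed_le (continuous_norm.sub continuous_const).abs continuous_const).measurableSet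
  have hAsub : ∀ t, A t ⊆ Metric.closedBall 0 (t + Q) := fun t x hx => by
    rw [mem_closedBall_zero_iff]
    have := (abs_le.mp (show |‖x‖ - t| ≤ Q from hx)).2
    linarith
  have hAfin : ∀ t, volume (A t) < ⊤ := fun t =>
    (measure_mono (hAsub t)).trans_lt measure_closedBall_lt_top
  have hAvol : ∀ t, t₀ ≤ t → volume.real (A t) ≤ (6 * Q + 2 * Q ^ 3) * ω * t ^ 2 := by
    intro t ht
    have hsub : A t ⊆ Metric.closedBall 0 (t + Q) \ Metric.ball 0 (t - Q) := by
      refine fun x hx => ⟨hAsub t hx, ?_⟩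
      rw [mem_ball_zero_iff, not_lt]
      have := (abs_le.mp (show |‖x‖ - t| ≤ Q from hx)).1
      linarith
    have h1 : volume.real (A t) ≤
        volume.real (Metric.closedBall (0 : EuclideanSpace ℝ (Fin 3)) (t + Q))
          - volume.real (Metric.ball (0 : EuclideanSpace ℝ (Fin 3)) (t - Q)) := by
      rw [← measureReal_sdiff (Metric.ball_subset_closedBall.trans
        (Metric.closedBall_subset_closedBall (by linarith))) Metric.isOpen_ball.measurableSet
        measure_closedBall_lt_top.ne]
      exact measureReal_mono hsub
        (((measure_mono Set.sdiff_subset).trans_lt measure_closedBall_lt_top).ne)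
    have h2 : volume.real (Metric.closedBall (0 : EuclideanSpace ℝ (Fin 3)) (t + Q))
        = (t + Q) ^ 3 * ω := by
      have : 0 ≤ t + Q := by linarith
      rw [measureReal_def, Measure.addHaar_closedBall _ _ (by linarith), ENNReal.toReal_mul,
        ENNReal.toReal_ofReal (by positivity)]
      simp [hω, measureReal_def]
    have h3 : volume.real (Metric.ball (0 : EuclideanSpace ℝ (Fin 3)) (t - Q))
        = (t - Q) ^ 3 * ω := by
      have : 0 ≤ t - Q := by linarith
      rw [measureReal_def, Measure.addHaar_ball _ _ this, ENNReal.toReal_mul,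
        ENNReal.toReal_ofReal (by positivity)]
      simp [hω, measureReal_def]
    have hω0 : 0 ≤ ω := measureReal_nonneg
    have ht1 : 1 ≤ t := ht₀.trans ht
    rw [h2, h3] at h1
    refine h1.trans ?_
    have : 2 * Q ^ 3 * 1 ≤ 2 * Q ^ 3 * t ^ 2 :=
      mul_le_mul_of_nonneg_left (one_le_pow₀ ht1) (by positivity)
    calc _ = (6 * Q * t ^ 2 + 2 * Q ^ 3) * ω := by ring
      _ ≤ (6 * Q * t ^ 2 + 2 * Q ^ 3 * t ^ 2) * ω :=
        mul_le_mul_of_nonneg_right (by linarith) hω0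
      _ = _ := by ring
  -- the integrand is dominated by a function of `t` on the shell
  have hdom : IntegrableOn (fun z : Spacetime => 4 * z.1 ^ (-7 / 2 : ℝ)) S := by
    rw [← integrable_indicator_iff hSm]
    have hmeas : Measurable (S.indicator fun z : Spacetime => 4 * z.1 ^ (-7 / 2 : ℝ)) :=
      ((measurable_fst.pow_const _).const_mul 4).indicator hSm
    have hsec : ∀ t, (fun x => S.indicator (fun z : Spacetime => 4 * z.1 ^ (-7 / 2 : ℝ)) (t, x)) =
        (A t).indicator fun _ => (Set.Ici t₀).indicator (fun t => 4 * t ^ (-7 / 2 : ℝ)) t := by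
      intro t
      ext x
      by_cases h1 : t₀ ≤ t <;> by_cases h2 : |‖x‖ - t| ≤ Q <;>
        simp [hS, hA, inCoord, Set.indicator, h1, h2]
    refine (integrable_prod_iff hmeas.aestronglyMeasurable).mpr ⟨?_, ?_⟩
    · refine Eventually.of_forall fun t => ?_
      rw [hsec]
      exact (integrableOn_const (hAfin t).ne).integrable_indicator (hAm t)
    · have hval : ∀ t, ∫ x, ‖S.indicator (fun z : Spacetime => 4 * z.1 ^ (-7 / 2 : ℝ)) (t, x)‖ =
          volume.real (A t) * ‖(Set.Ici t₀).indicator (fun t => 4 * t ^ (-7 / 2 : ℝ)) t‖ := by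
        intro t
        have := hsec t
        simp only [fun x => congrFun this x, norm_indicator_eq_indicator_norm]
        rw [integral_indicator (hAm t), setIntegral_const, smul_eq_mul]
      have hint : Integrable ((Set.Ici t₀).indicator fun t : ℝ =>
          (6 * Q + 2 * Q ^ 3) * ω * 4 * t ^ (-3 / 2 : ℝ)) := by
        rw [integrable_indicator_iff measurableSet_Ici, integrableOn_Ici_iff_integrableOn_Ioi]
        exact (integrableOn_Ioi_rpow_of_lt (by norm_num) (by linarith)).const_mul _
      refine hint.mono' (hmeas.aestronglyMeasurable.norm.integral_prod_right') ?_
      refine Eventually.of_forall fun t => ?_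
      rw [hval, Real.norm_of_nonneg (by positivity)]
      by_cases ht : t₀ ≤ t
      · have ht0 : 0 < t := by linarith
        simp only [Set.indicator, Set.mem_Ici, ht, if_true]
        rw [Real.norm_of_nonneg (by positivity)]
        have e : t ^ (-3 / 2 : ℝ) = t ^ 2 * t ^ (-7 / 2 : ℝ) := by
          rw [← Real.rpow_natCast, ← Real.rpow_add ht0]
          norm_num
        rw [e]
        have := mul_le_mul_of_nonneg_right (hAvol t ht)
          (show 0 ≤ 4 * t ^ (-7 / 2 : ℝ) by positivity)
        linarith
      · simp [Set.indicator, ht]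
  refine hdom.mono' ?_ ?_
  · exact (((measurable_snd.norm.pow_const 2).inv.mul
      (continuous_outCoord.measurable.pow_const _)).aestronglyMeasurable)
  · rw [ae_restrict_iff' hSm]
    refine Eventually.of_forall fun z hz => ?_
    obtain ⟨h1, h2⟩ := hz
    have h3 := (abs_le.mp h2).1
    unfold inCoord at h3
    have ht : 0 < z.1 := by linarith
    have hr : z.1 / 2 ≤ ‖z.2‖ := by linarith
    have hr0 : 0 < ‖z.2‖ := by linarith
    have hp : z.1 ≤ outCoord z := by
      unfold outCoord
      linarith
    have hp0 : 0 < outCoord z := by linarith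
    rw [Real.norm_of_nonneg (by positivity)]
    have a1 : (‖z.2‖ ^ 2)⁻¹ ≤ 4 * (z.1 ^ 2)⁻¹ := by
      calc (‖z.2‖ ^ 2)⁻¹ ≤ ((z.1 / 2) ^ 2)⁻¹ := by gcongr
        _ = _ := by
          field_simp
          norm_num
    have a2 : outCoord z ^ (-3 / 2 : ℝ) ≤ z.1 ^ (-3 / 2 : ℝ) :=
      Real.rpow_le_rpow_of_nonpos ht hp (by norm_num)
    have e : z.1 ^ (-7 / 2 : ℝ) = (z.1 ^ 2)⁻¹ * z.1 ^ (-3 / 2 : ℝ) := by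
      rw [← Real.rpow_natCast, ← Real.rpow_neg ht.le, ← Real.rpow_add ht]
      norm_num
    rw [e, ← mul_assoc]
    exact mul_le_mul a1 a2 (by positivity) (by positivity)

/-! ### Vanishing above the level sets of the weight -/

theorem along_eventuallyEq {X : Spacetime → Spacetime} {u v : Spacetime → ℝ} {z : Spacetime}
    (h : u =ᶠ[𝓝 z] v) : along X u =ᶠ[𝓝 z] along X v :=
  h.eventuallyEq_nhds.mono fun _ hy => along_congr hy

theorem conjWave_congr {u v : Spacetime → ℝ} {z : Spacetime} (h : u =ᶠ[𝓝 z] v) (δ l : ℝ) :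
    conjWave δ l u z = conjWave δ l v z := by
  have h1 : Dout (Din u) z = Dout (Din v) z := along_congr (along_eventuallyEq h)
  have h2 : ∀ i j, Drot i j (Drot i j u) z = Drot i j (Drot i j v) z := fun i j =>
    along_congr (along_eventuallyEq h)
  have h3 : Din u z = Din v z := along_congr h
  have h4 : Dout u z = Dout v z := along_congr h
  simp only [conjWave, nullWave, weightDeriv, h1, h2, h3, h4, h.self_of_nhds]

theorem carlemanDensity_congr {u v : Spacetime → ℝ} {z : Spacetime} (h : u =ᶠ[𝓝 z] v) (δ l : ℝ) :
    carlemanDensity δ l u z = carlemanDensity δ l v z := by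
  have h2 : ∀ i j, Drot i j u z = Drot i j v z := fun i j => along_congr h
  have h3 : Din u z = Din v z := along_congr h
  have h4 : Dout u z = Dout v z := along_congr h
  simp only [carlemanDensity, weightDeriv, h2, h3, h4, h.self_of_nhds]

/-- The conjugated and cut-off unknown `e^{l f} χ r u`, extended by zero outside `U`. -/
noncomputable def conjUnknown (U : Set Spacetime) (δ c₀ c₁ T l : ℝ) (u : Spacetime → ℝ)
    (z : Spacetime) : ℝ :=
  Real.exp (l * weight δ z) * U.indicator (fun y => cutoff δ c₀ c₁ T y * (‖y.2‖ * u y)) z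

/-- The geometry of the region `{f ≥ c₀, q ≤ R}` on which the argument takes place: where
`p ≥ p₀` it lies in `U`, at times `t ≥ t₀` and between the light cones `q = ± Q`, while no point
of `U` with `p < p₀` and `q ≤ R` has `f > c₀`. -/
structure AdmissibleRegion (U : Set Spacetime) (δ c₀ R p₀ t₀ Q : ℝ) : Prop where
  isOpen : IsOpen U
  one_le : 1 ≤ p₀
  one_le_time : 1 ≤ t₀
  nonneg : 0 ≤ Q
  width_le : 8 * Q ≤ t₀
  mem : ∀ z, p₀ ≤ outCoord z → c₀ ≤ weight δ z → inCoord z ≤ R →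
    z ∈ U ∧ t₀ ≤ z.1 ∧ |inCoord z| ≤ Q
  weight_le : ∀ z ∈ U, outCoord z < p₀ → inCoord z ≤ R → weight δ z ≤ c₀

section

variable {N : ℕ} {U : Set Spacetime} {M γ C : ℝ}
  {V : Fin N → Fin N → Fin 4 → Spacetime → ℝ} {W : Fin N → Fin N → Spacetime → ℝ}
  {u : Fin N → Spacetime → ℝ} {δ c₀ c₁ R p₀ t₀ Q T l : ℝ} {z : Spacetime}

theorem AdmissibleRegion.of_mem (hG : AdmissibleRegion U δ c₀ R p₀ t₀ Q)
    (hz : z ∈ cutoffSupport δ p₀ c₀ R T) :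
    z ∈ U ∧ z.2 ≠ 0 ∧ 1 ≤ outCoord z ∧ outCoord z ≤ 4 * ‖z.2‖ ∧ ‖z.2‖ ≤ outCoord z ∧
      4 * inCoord z ≤ ‖z.2‖ := by
  obtain ⟨h1, h2, h3, h4⟩ := hz
  obtain ⟨hU, ht, hQ⟩ := hG.mem z h1 h3 h4
  have a1 := hG.one_le
  have a2 := hG.one_le_time
  have a3 := hG.nonneg
  have a4 := hG.width_le
  obtain ⟨b1, b2⟩ := abs_le.mp hQ
  refine ⟨hU, ?_, a1.trans h1, ?_, ?_, ?_⟩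
  · unfold inCoord at b1
    exact norm_pos_iff.mp (by linarith)
  all_goals
    unfold inCoord outCoord at *
    linarith

theorem smoothOnSupport_conjUnknown (hu : WaveSystem U M γ C V W u)
    (hG : AdmissibleRegion U δ c₀ R p₀ t₀ Q) (hδ : 0 < δ) (hc : c₀ < c₁) (hT : 1 ≤ T)
    (hvan : ∀ z ∈ U, R < inCoord z → ∀ I, u I z = 0) (I : Fin N) :
    SmoothOnSupport 2 (cutoffSupport δ p₀ c₀ R T) (conjUnknown U δ c₀ c₁ T l (u I)) := by
  obtain ⟨B, hB, hcut⟩ := exists_cutoff_bound hδ hc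
  refine ⟨fun z hz => ?_, fun z hz => ?_⟩
  · obtain ⟨hU, hr, hp, -⟩ := hG.of_mem hz
    have h1 := contDiffAt_weight (n := 2) (δ := δ) hr (by linarith)
    have h2 := (hcut T hT z hr hp hz.2.1).1
    have h3 : U.indicator (fun y => cutoff δ c₀ c₁ T y * (‖y.2‖ * u I y)) =ᶠ[𝓝 z]
        fun y => cutoff δ c₀ c₁ T y * (‖y.2‖ * u I y) := by
      filter_upwards [hG.isOpen.mem_nhds hU] with y hy using Set.indicator_of_mem hy _
    exact (contDiffAt_const.mul h1).exp.mul
      ((h2.mul ((contDiffAt_radius hr).mul (hu.contDiffAt z hU I))).congr_of_eventuallyEq h3)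
  · unfold conjUnknown
    by_cases hU : z ∈ U
    · rw [Set.indicator_of_mem hU]
      by_cases h4 : inCoord z ≤ R
      swap
      · rw [hvan z hU (not_le.mp h4) I]
        simp
      have hcz : cutoff δ c₀ c₁ T z = 0 := by
        by_cases h1 : p₀ ≤ outCoord z
        swap
        · exact cutoff_eq_zero_of_weight_le hc (hG.weight_le z hU (not_le.mp h1) h4)
        by_cases h2 : outCoord z ≤ 2 * T
        swap
        · exact cutoff_eq_zero_of_le_outCoord (by linarith) (not_le.mp h2).le
        by_cases h3 : c₀ ≤ weight δ z
        · exact absurd ⟨h1, h2, h3, h4⟩ hz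
        · exact cutoff_eq_zero_of_weight_le hc (not_le.mp h3).le
      rw [hcz]
      simp
    · rw [Set.indicator_of_notMem hU, mul_zero]

theorem weight_le_inCoord (hδ : 0 < δ) (hp : 0 ≤ outCoord z) : weight δ z ≤ inCoord z :=
  sub_le_self _ (mul_nonneg (inv_pos.mpr hδ).le (Real.rpow_nonneg hp _))

/-- Where the cutoff is locally constant the lower-order terms are absorbed; elsewhere the
exponential weight is small, or `p` is large. -/
theorem WaveSystem.sum_conjWave_sq_le (hu : WaveSystem U M γ C V W u) (hM : 0 ≤ M) (hC : 0 ≤ C)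
    (hγ : 0 ≤ γ) (hG : AdmissibleRegion U δ c₀ R p₀ t₀ Q) (hδ : 0 < δ) (hδ2 : δ < 1 / 2)
    (hδγ : δ ≤ 2 * γ) (hc : c₀ < c₁) :
    ∃ A : ℝ, 0 ≤ A ∧ ∀ T l : ℝ, 1 ≤ T → 1 ≤ l →
      N * (N * (16 * M) ^ 2 * (192 / (1 - 2 * δ))) ≤ 2 * l →
      ∀ z ∈ cutoffSupport δ p₀ c₀ R T,
        ∑ I, (4 * l)⁻¹ * outCoord z ^ (3 / 2 : ℝ) *
            (conjWave δ l (conjUnknown U δ c₀ c₁ T l (u I)) z) ^ 2 ≤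
          1 / 2 * ∑ J, carlemanDensity δ l (conjUnknown U δ c₀ c₁ T l (u J)) z
            + A * (Real.exp (2 * l * c₁)
              + {y | T ≤ outCoord y}.indicator (fun _ => Real.exp (2 * l * R)) z)
              * outCoord z ^ (-3 / 2 : ℝ) := by
  obtain ⟨B, hB, hcut⟩ := exists_cutoff_bound hδ hc
  set D := 5 * N * M * C + 24 * B * C with hD
  have hD0 : 0 ≤ D := by positivity
  refine ⟨N * D ^ 2, by positivity, fun T l hT hl hl' z hz => ?_⟩
  obtain ⟨hU, hr, hp, hpr, hrp, -⟩ := hG.of_mem hz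
  have hp0 : 0 < outCoord z := by linarith
  have hl0 : 0 < l := by linarith
  have hind : 0 ≤ {y | T ≤ outCoord y}.indicator (fun _ => Real.exp (2 * l * R)) z :=
    Set.indicator_nonneg (fun _ _ => (Real.exp_pos _).le) _
  have hP : 0 ≤ outCoord z ^ (-3 / 2 : ℝ) := Real.rpow_nonneg hp0.le _
  have hloc : ∀ I, conjUnknown U δ c₀ c₁ T l (u I) =ᶠ[𝓝 z]
      fun y => Real.exp (l * weight δ y) * (cutoff δ c₀ c₁ T y * (‖y.2‖ * u I y)) := fun I => by
    filter_upwards [hG.isOpen.mem_nhds hU] with y hy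
    rw [conjUnknown, Set.indicator_of_mem hy]
  by_cases hcase : c₁ < weight δ z ∧ outCoord z < T
  · have hloc' : ∀ I, conjUnknown U δ c₀ c₁ T l (u I) =ᶠ[𝓝 z]
        fun y => Real.exp (l * weight δ y) * (‖y.2‖ * u I y) := fun I => by
      filter_upwards [hloc I,
        (contDiffAt_weight (n := 0) hr hp0).continuousAt.eventually (lt_mem_nhds hcase.1),
        continuous_outCoord.continuousAt.eventually (gt_mem_nhds hcase.2)] with y h1 h2 h3
      rw [h1, cutoff_eq_one hc (by linarith) h2.le h3.le, one_mul]
    have hru : ∀ I, ContDiffAt ℝ 2 (fun y : Spacetime => ‖y.2‖ * u I y) z := fun I =>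
      (contDiffAt_radius hr).mul (hu.contDiffAt z hU I)
    simp only [conjWave_congr (hloc' _), carlemanDensity_congr (hloc' _),
      conjWave_exp_weight_mul hδ.ne' hr hp0 l (hru _)]
    refine (hu.absorption hM hδ hδ2 hδγ hl hl' hU hr hp hpr).trans ?_
    exact le_add_of_nonneg_right (by positivity)
  · have hdens : 0 ≤ 1 / 2 * ∑ J, carlemanDensity δ l (conjUnknown U δ c₀ c₁ T l (u J)) z :=
      mul_nonneg (by norm_num)
        (Finset.sum_nonneg fun J _ => carlemanDensity_nonneg hδ2 hl0.le hp0 _)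
    have hexp : Real.exp (l * weight δ z) ^ 2 ≤ Real.exp (2 * l * c₁)
        + {y | T ≤ outCoord y}.indicator (fun _ => Real.exp (2 * l * R)) z := by
      rw [← Real.exp_nat_mul]
      by_cases h : weight δ z ≤ c₁
      · refine le_add_of_le_of_nonneg (Real.exp_le_exp.mpr ?_) hind
        push_cast
        nlinarith
      · have hT' : T ≤ outCoord z := by
          by_contra hlt
          exact hcase ⟨not_le.mp h, not_le.mp hlt⟩
        rw [Set.indicator_of_mem (show z ∈ {y | T ≤ outCoord y} from hT')]
        refine le_add_of_nonneg_of_le (Real.exp_pos _).le (Real.exp_le_exp.mpr ?_)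
        have := (weight_le_inCoord hδ hp0.le).trans hz.2.2.2
        push_cast
        nlinarith
    obtain ⟨k0, k1, k2, k3, k4, k5⟩ := hcut T hT z hr hp hz.2.1
    refine le_add_of_nonneg_of_le hdens ?_
    have hterm : ∀ I, (4 * l)⁻¹ * outCoord z ^ (3 / 2 : ℝ) *
        (conjWave δ l (conjUnknown U δ c₀ c₁ T l (u I)) z) ^ 2 ≤
        D ^ 2 * (Real.exp (2 * l * c₁)
          + {y | T ≤ outCoord y}.indicator (fun _ => Real.exp (2 * l * R)) z)
          * outCoord z ^ (-3 / 2 : ℝ) := by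
      intro I
      have hru : ContDiffAt ℝ 2 (fun y => cutoff δ c₀ c₁ T y * (‖y.2‖ * u I y)) z :=
        k0.mul ((contDiffAt_radius hr).mul (hu.contDiffAt z hU I))
      rw [conjWave_congr (hloc I), conjWave_exp_weight_mul hδ.ne' hr hp0 l hru, mul_pow]
      have hn := hu.abs_nullWave_cutoff_le hM hC hγ hU hr hp hrp k0 k1 k2 k3 k4 k5 I
      have hn2 : nullWave (fun y => cutoff δ c₀ c₁ T y * (‖y.2‖ * u I y)) z ^ 2 ≤
          (D * outCoord z ^ (-3 / 2 : ℝ)) ^ 2 := by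
        rw [← sq_abs]
        exact pow_le_pow_left₀ (abs_nonneg _) hn 2
      have hl4 : (4 * l)⁻¹ ≤ 1 := inv_le_one_of_one_le₀ (by linarith)
      have hPP : outCoord z ^ (3 / 2 : ℝ) * outCoord z ^ (-3 / 2 : ℝ) = 1 := by
        rw [← Real.rpow_add hp0]
        norm_num
      calc _ ≤ 1 * outCoord z ^ (3 / 2 : ℝ) * ((Real.exp (2 * l * c₁)
            + {y | T ≤ outCoord y}.indicator (fun _ => Real.exp (2 * l * R)) z)
            * (D * outCoord z ^ (-3 / 2 : ℝ)) ^ 2) := by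
            refine mul_le_mul (mul_le_mul_of_nonneg_right hl4 (by positivity))
              (mul_le_mul hexp hn2 (sq_nonneg _) (by positivity)) (by positivity) (by positivity)
        _ = D ^ 2 * (Real.exp (2 * l * c₁)
            + {y | T ≤ outCoord y}.indicator (fun _ => Real.exp (2 * l * R)) z)
            * outCoord z ^ (-3 / 2 : ℝ)
            * (outCoord z ^ (3 / 2 : ℝ) * outCoord z ^ (-3 / 2 : ℝ)) := by ring
        _ = _ := by rw [hPP, mul_one]
    refine (Finset.sum_le_sum fun I _ => hterm I).trans (le_of_eq ?_)
    rw [Finset.sum_const, Finset.card_univ, Fintype.card_fin, nsmul_eq_mul]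
    ring

end

section

variable {N : ℕ} {U : Set Spacetime} {M γ C : ℝ}
  {V : Fin N → Fin N → Fin 4 → Spacetime → ℝ} {W : Fin N → Fin N → Spacetime → ℝ}
  {u : Fin N → Spacetime → ℝ} {δ c₀ c₁ R p₀ t₀ Q : ℝ} {z : Spacetime}

/-- The Carleman inequality applied to the cut-off solution: the energy is controlled by
contributions of the set `f ≤ c₁` and of the set `p ≥ T`. -/
theorem WaveSystem.integral_sum_carlemanDensity_le (hu : WaveSystem U M γ C V W u) (hM : 0 ≤ M)
    (hC : 0 ≤ C) (hγ : 0 ≤ γ) (hG : AdmissibleRegion U δ c₀ R p₀ t₀ Q) (hδ : 0 < δ)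
    (hδ2 : δ < 1 / 2) (hδγ : δ ≤ 2 * γ) (hc : c₀ < c₁)
    (hvan : ∀ z ∈ U, R < inCoord z → ∀ I, u I z = 0) :
    ∃ A : ℝ, 0 ≤ A ∧ ∀ T l : ℝ, 1 ≤ T → 1 ≤ l →
      N * (N * (16 * M) ^ 2 * (192 / (1 - 2 * δ))) ≤ 2 * l →
      ∫ z, (‖z.2‖ ^ 2)⁻¹ * ∑ J, carlemanDensity δ l (conjUnknown U δ c₀ c₁ T l (u J)) z ≤
        A * (Real.exp (2 * l * c₁)
            * (∫ z in {z : Spacetime | t₀ ≤ z.1 ∧ |inCoord z| ≤ Q},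
                (‖z.2‖ ^ 2)⁻¹ * outCoord z ^ (-3 / 2 : ℝ))
          + Real.exp (2 * l * R)
            * ∫ z in {z : Spacetime | t₀ ≤ z.1 ∧ |inCoord z| ≤ Q} ∩ {z | T ≤ outCoord z},
                (‖z.2‖ ^ 2)⁻¹ * outCoord z ^ (-3 / 2 : ℝ)) := by
  obtain ⟨A, hA, hle⟩ := hu.sum_conjWave_sq_le hM hC hγ hG hδ hδ2 hδγ hc
  refine ⟨2 * A, by positivity, fun T l hT hl hl' => ?_⟩
  have hl0 : 0 < l := by linarith
  set S : Set Spacetime := {z : Spacetime | t₀ ≤ z.1 ∧ |inCoord z| ≤ Q} with hS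
  set S' : Set Spacetime := {z | T ≤ outCoord z} with hS'
  set h : Spacetime → ℝ := fun z => (‖z.2‖ ^ 2)⁻¹ * outCoord z ^ (-3 / 2 : ℝ) with hh
  set K := cutoffSupport δ p₀ c₀ R T with hKdef
  have hSm : MeasurableSet S :=
    ((isClosed_le continuous_const continuous_fst).inter
      (isClosed_le continuous_inCoord.abs continuous_const)).measurableSet
  have hSm' : MeasurableSet S' := (isClosed_le continuous_const continuous_outCoord).measurableSet
  have hint : IntegrableOn h S := integrableOn_shell hG.one_le_time hG.nonneg
    (by linarith [hG.width_le, hG.nonneg])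
  have hint' : IntegrableOn h (S ∩ S') := hint.mono_set Set.inter_subset_left
  have hK : IsCompact K := isCompact_cutoffSupport hδ (by linarith [hG.one_le])
  have hr : ∀ z ∈ K, z.2 ≠ 0 := fun z hz => (hG.of_mem hz).2.1
  have hp : ∀ z ∈ K, 0 < outCoord z := fun z hz => zero_lt_one.trans_le (hG.of_mem hz).2.2.1
  have hq : ∀ z ∈ K, 4 * inCoord z ≤ ‖z.2‖ := fun z hz => (hG.of_mem hz).2.2.2.2.2
  have hv := fun I => smoothOnSupport_conjUnknown (l := l) hu hG hδ hc hT hvan I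
  set v := fun I => conjUnknown U δ c₀ c₁ T l (u I) with hvdef
  have hinv : ∀ z ∈ K, ContDiffAt ℝ 0 (fun y : Spacetime => (‖y.2‖ ^ 2)⁻¹) z := fun z hz =>
    contDiffAt_inv_radius_sq (hr z hz)
  have sDens : ∀ I, SmoothOnSupport 0 K
      (fun z => (‖z.2‖ ^ 2)⁻¹ * carlemanDensity δ l (v I) z) := fun I =>
    ((hv I).carlemanDensity hK hr hp δ l).mul_left hinv
  have sConj : ∀ I, SmoothOnSupport 0 K (fun z => (‖z.2‖ ^ 2)⁻¹ *
      ((4 * l)⁻¹ * outCoord z ^ (3 / 2 : ℝ) * (conjWave δ l (v I) z) ^ 2)) := fun I =>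
    ((((hv I).conjWave hK hr hp δ l).sq.mul_left fun z hz =>
      contDiffAt_const.mul (contDiffAt_outCoord_rpow (hr z hz) (hp z hz) _))).mul_left hinv
  have hcar : ∑ I, ∫ z, (‖z.2‖ ^ 2)⁻¹ * carlemanDensity δ l (v I) z ≤
      ∑ I, ∫ z, (‖z.2‖ ^ 2)⁻¹ *
        ((4 * l)⁻¹ * outCoord z ^ (3 / 2 : ℝ) * (conjWave δ l (v I) z) ^ 2) :=
    Finset.sum_le_sum fun I _ => carleman_inequality hK hr hp hq hl0 (hv I)
  rw [← integral_finsetSum _ fun I _ => (sDens I).integrable hK,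
    ← integral_finsetSum _ fun I _ => (sConj I).integrable hK] at hcar
  have eConj : ∀ z : Spacetime, ∑ I, (‖z.2‖ ^ 2)⁻¹ *
      ((4 * l)⁻¹ * outCoord z ^ (3 / 2 : ℝ) * (conjWave δ l (v I) z) ^ 2) =
      (‖z.2‖ ^ 2)⁻¹ * ∑ I, (4 * l)⁻¹ * outCoord z ^ (3 / 2 : ℝ) * (conjWave δ l (v I) z) ^ 2 :=
    fun z => (Finset.mul_sum _ _ _).symm
  have eDens : ∀ z : Spacetime, ∑ I, (‖z.2‖ ^ 2)⁻¹ * carlemanDensity δ l (v I) z =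
      (‖z.2‖ ^ 2)⁻¹ * ∑ I, carlemanDensity δ l (v I) z := fun z => (Finset.mul_sum _ _ _).symm
  simp only [eDens, eConj] at hcar
  have iDens : Integrable fun z => (‖z.2‖ ^ 2)⁻¹ * ∑ I, carlemanDensity δ l (v I) z := by
    simp only [Finset.mul_sum]
    exact integrable_finsetSum _ fun I _ => (sDens I).integrable hK
  have iConj : Integrable fun z => (‖z.2‖ ^ 2)⁻¹ *
      ∑ I, (4 * l)⁻¹ * outCoord z ^ (3 / 2 : ℝ) * (conjWave δ l (v I) z) ^ 2 := by
    simp only [← eConj]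
    exact integrable_finsetSum _ fun I _ => (sConj I).integrable hK
  have iE1 : Integrable fun z => A * Real.exp (2 * l * c₁) * S.indicator h z :=
    (hint.integrable_indicator hSm).const_mul _
  have iE2 : Integrable fun z => A * Real.exp (2 * l * R) * (S ∩ S').indicator h z :=
    (hint'.integrable_indicator (hSm.inter hSm')).const_mul _
  have hpt : ∀ z, (‖z.2‖ ^ 2)⁻¹ *
      ∑ I, (4 * l)⁻¹ * outCoord z ^ (3 / 2 : ℝ) * (conjWave δ l (v I) z) ^ 2 ≤
      1 / 2 * ((‖z.2‖ ^ 2)⁻¹ * ∑ I, carlemanDensity δ l (v I) z)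
        + (A * Real.exp (2 * l * c₁) * S.indicator h z
          + A * Real.exp (2 * l * R) * (S ∩ S').indicator h z) := by
    intro z
    by_cases hz : z ∈ K
    · have hzS : z ∈ S := (hG.mem z hz.1 hz.2.2.1 hz.2.2.2).2
      refine (mul_le_mul_of_nonneg_left (hle T l hT hl hl' z hz) (by positivity)).trans ?_
      refine le_of_eq ?_
      by_cases hz' : z ∈ S'
      · rw [Set.indicator_of_mem hz', Set.indicator_of_mem hzS,
          Set.indicator_of_mem (show z ∈ S ∩ S' from ⟨hzS, hz'⟩)]
        simp only [hh]
        ring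
      · rw [Set.indicator_of_notMem hz', Set.indicator_of_mem hzS,
          Set.indicator_of_notMem fun hm => hz' hm.2]
        simp only [hh]
        ring
    · have e1 : ∀ I, conjWave δ l (v I) z = 0 := fun I =>
        ((hv I).conjWave hK hr hp δ l).2 z hz
      have e2 : ∀ I, carlemanDensity δ l (v I) z = 0 := fun I =>
        ((hv I).carlemanDensity hK hr hp δ l).2 z hz
      simp only [e1, e2]
      have hnn : ∀ y ∈ S, 0 ≤ h y := fun y hy => by
        have h1 : 0 ≤ outCoord y :=
          add_nonneg (zero_le_one.trans (hG.one_le_time.trans hy.1)) (norm_nonneg _)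
        exact mul_nonneg (by positivity) (Real.rpow_nonneg h1 _)
      have n1 : 0 ≤ S.indicator h z := Set.indicator_nonneg hnn z
      have n2 : 0 ≤ (S ∩ S').indicator h z := Set.indicator_nonneg (fun y hy => hnn y hy.1) z
      have : 0 ≤ A * Real.exp (2 * l * c₁) * S.indicator h z
          + A * Real.exp (2 * l * R) * (S ∩ S').indicator h z := by positivity
      simpa using this
  have hmono := integral_mono iConj ((iDens.const_mul (1 / 2)).add (iE1.add iE2)) hpt
  have hsplit := integral_add (iDens.const_mul (1 / 2)) (iE1.add iE2)
  have hsplit' := integral_add iE1 iE2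
  simp only [Pi.add_apply] at hmono hsplit hsplit'
  rw [hsplit, hsplit', integral_const_mul, integral_const_mul, integral_const_mul,
    integral_indicator hSm, integral_indicator (hSm.inter hSm')] at hmono
  have := hcar.trans hmono
  change ∫ z, (‖z.2‖ ^ 2)⁻¹ * ∑ J, carlemanDensity δ l (v J) z ≤ _
  linarith

/-- A solution is nonzero at no point above a level set of the weight: otherwise the Carleman
energy would grow at least like `e^{2 l c₂}`, and at most like `e^{2 l c₁}` with `c₁ < c₂`. -/
theorem WaveSystem.eq_zero_of_lt_weight (hu : WaveSystem U M γ C V W u) (hM : 0 ≤ M)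
    (hC : 0 ≤ C) (hγ : 0 ≤ γ) (hG : AdmissibleRegion U δ c₀ R p₀ t₀ Q) (hδ : 0 < δ)
    (hδ2 : δ < 1 / 2) (hδγ : δ ≤ 2 * γ)
    (hvan : ∀ z ∈ U, R < inCoord z → ∀ I, u I z = 0) (hzU : z ∈ U) (hz : z.2 ≠ 0)
    (hzp : 0 < outCoord z) (hzw : c₀ < weight δ z) (I : Fin N) : u I z = 0 := by
  by_contra hne
  obtain ⟨c₁, hc₁, hc₁z⟩ := exists_between hzw
  obtain ⟨c₂, hc₂, hc₂z⟩ := exists_between hc₁z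
  obtain ⟨A, hA, hle⟩ := hu.integral_sum_carlemanDensity_le hM hC hγ hG hδ hδ2 hδγ hc₁ hvan
  set S : Set Spacetime := {z : Spacetime | t₀ ≤ z.1 ∧ |inCoord z| ≤ Q} with hS
  set h : Spacetime → ℝ := fun z => (‖z.2‖ ^ 2)⁻¹ * outCoord z ^ (-3 / 2 : ℝ) with hh
  have hSm : MeasurableSet S :=
    ((isClosed_le continuous_const continuous_fst).inter
      (isClosed_le continuous_inCoord.abs continuous_const)).measurableSet
  have hint : IntegrableOn h S := integrableOn_shell hG.one_le_time hG.nonneg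
    (by linarith [hG.width_le, hG.nonneg])
  -- the tail of the integral over `p ≥ T` tends to zero
  have htail : Tendsto (fun T : ℝ => ∫ y in S ∩ {y | T ≤ outCoord y}, h y) atTop (𝓝 0) := by
    have hlim := tendsto_setIntegral_of_antitone (μ := volume) (f := h)
      (s := fun T : ℝ => S ∩ {y | T ≤ outCoord y})
      (fun T => hSm.inter (isClosed_le continuous_const continuous_outCoord).measurableSet)
      (fun T T' hTT y hy => ⟨hy.1, le_trans hTT hy.2⟩)
      ⟨0, hint.mono_set Set.inter_subset_left⟩
    have hempty : ⋂ T : ℝ, S ∩ {y | T ≤ outCoord y} = ∅ := by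
      rw [Set.eq_empty_iff_forall_notMem]
      intro y hy
      have : outCoord y + 1 ≤ outCoord y := (Set.mem_iInter.mp hy (outCoord y + 1)).2
      linarith
    rwa [hempty, setIntegral_empty] at hlim
  -- a lower bound for the energy near `z`
  set F : Spacetime → ℝ := fun y => (‖y.2‖ ^ 2)⁻¹ *
    ((1 - 2 * δ) * outCoord y ^ (-1 / 2 - δ) * (‖y.2‖ * u I y) ^ 2) with hF
  have hFc : ContinuousAt F z :=
    (contDiffAt_inv_radius_sq (n := 0) hz).continuousAt.mul
      ((continuousAt_const.mul (contDiffAt_outCoord_rpow (n := 0) hz hzp _).continuousAt).mul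
        ((continuous_snd.norm.continuousAt.mul (hu.contDiffAt z hzU I).continuousAt).pow 2))
  have hd : 0 < 1 - 2 * δ := by linarith
  have hFz : 0 < F z := by
    have hr : 0 < ‖z.2‖ := norm_pos_iff.mpr hz
    have : 0 < (‖z.2‖ * u I z) ^ 2 := by positivity
    have := Real.rpow_pos_of_pos hzp (-1 / 2 - δ)
    positivity
  have hev : ∀ᶠ y in 𝓝 z, y ∈ U ∧ F z / 2 < F y ∧ c₂ < weight δ y ∧
      outCoord y < outCoord z + 1 ∧ 0 < outCoord y := by
    filter_upwards [hG.isOpen.mem_nhds hzU, hFc.eventually (lt_mem_nhds (half_lt_self hFz)),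
      (contDiffAt_weight (n := 0) hz hzp).continuousAt.eventually (lt_mem_nhds hc₂z),
      continuous_outCoord.continuousAt.eventually (gt_mem_nhds (lt_add_one (outCoord z))),
      continuous_outCoord.continuousAt.eventually (lt_mem_nhds hzp)] with y h1 h2 h3 h4 h5
      using ⟨h1, h2, h3, h4, h5⟩
  obtain ⟨ε, hε, hball⟩ := Metric.eventually_nhds_iff_ball.mp hev
  set B : Set Spacetime := Metric.ball z ε with hB
  set κ := volume.real B * (F z / 2) with hκ
  have hBfin : volume B ≠ ⊤ := measure_ball_lt_top.ne
  have hκ0 : 0 < κ :=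
    mul_pos (ENNReal.toReal_pos (Metric.measure_ball_pos _ _ hε).ne' hBfin) (by linarith)
  have hlower : ∀ T l : ℝ, outCoord z + 1 ≤ T → 1 ≤ T → 1 ≤ l →
      κ * Real.exp (2 * l * c₂) ≤
        ∫ z, (‖z.2‖ ^ 2)⁻¹ * ∑ J, carlemanDensity δ l (conjUnknown U δ c₀ c₁ T l (u J)) z := by
    intro T l hT hT1 hl
    have hl0 : 0 < l := by linarith
    set K := cutoffSupport δ p₀ c₀ R T with hKdef
    have hK : IsCompact K := isCompact_cutoffSupport hδ (by linarith [hG.one_le])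
    have hr : ∀ z ∈ K, z.2 ≠ 0 := fun z hz => (hG.of_mem hz).2.1
    have hp : ∀ z ∈ K, 0 < outCoord z := fun z hz => zero_lt_one.trans_le (hG.of_mem hz).2.2.1
    have hv := fun I => smoothOnSupport_conjUnknown (l := l) hu hG hδ hc₁ hT1 hvan I
    set v := fun I => conjUnknown U δ c₀ c₁ T l (u I) with hvdef
    have sDens : ∀ I, SmoothOnSupport 0 K
        (fun z => (‖z.2‖ ^ 2)⁻¹ * carlemanDensity δ l (v I) z) := fun I =>
      ((hv I).carlemanDensity hK hr hp δ l).mul_left fun z hz =>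
        contDiffAt_inv_radius_sq (hr z hz)
    have iDens : Integrable fun z => (‖z.2‖ ^ 2)⁻¹ * ∑ I, carlemanDensity δ l (v I) z := by
      simp only [Finset.mul_sum]
      exact integrable_finsetSum _ fun I _ => (sDens I).integrable hK
    have hnn : ∀ y J, 0 ≤ carlemanDensity δ l (v J) y := fun y J => by
      by_cases hy : y ∈ K
      · exact carlemanDensity_nonneg hδ2 hl0.le (hp y hy) _
      · exact (((hv J).carlemanDensity hK hr hp δ l).2 y hy).ge
    have hpt : ∀ y ∈ B, F z / 2 * Real.exp (2 * l * c₂) ≤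
        (‖y.2‖ ^ 2)⁻¹ * ∑ J, carlemanDensity δ l (v J) y := by
      intro y hy
      obtain ⟨h1, h2, h3, h4, h5⟩ := hball y hy
      have hv1 : v I y = Real.exp (l * weight δ y) * (‖y.2‖ * u I y) := by
        simp only [hvdef, conjUnknown]
        rw [Set.indicator_of_mem h1, cutoff_eq_one hc₁ (by linarith) (by linarith) (by linarith),
          one_mul]
      have hexp : Real.exp (2 * l * c₂) ≤ Real.exp (l * weight δ y) ^ 2 := by
        rw [← Real.exp_nat_mul]
        refine Real.exp_le_exp.mpr ?_
        push_cast
        nlinarith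
      have hsingle : carlemanDensity δ l (v I) y ≤ ∑ J, carlemanDensity δ l (v J) y :=
        Finset.single_le_sum (f := fun J => carlemanDensity δ l (v J) y) (fun J _ => hnn y J)
          (Finset.mem_univ I)
      have hdens : (1 - 2 * δ) * outCoord y ^ (-1 / 2 - δ) * (v I y) ^ 2 ≤
          carlemanDensity δ l (v I) y := by
        have hP := Real.rpow_nonneg h5.le (-1 / 2 - δ)
        have a1 : (v I y) ^ 2 ≤ (Din (v I) y) ^ 2 + l ^ 2 * (v I y) ^ 2 := by
          have := mul_le_mul_of_nonneg_right (one_le_pow₀ (n := 2) hl) (sq_nonneg (v I y))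
          linarith [sq_nonneg (Din (v I) y)]
        have a2 := mul_le_mul_of_nonneg_left a1 (mul_nonneg hd.le hP)
        have a3 : 0 ≤ 3 * l * outCoord y ^ (3 / 2 : ℝ) * (weightDeriv δ (v I) y) ^ 2 := by
          positivity
        have a4 : 0 ≤ ∑ i, ∑ j, 1 / 16 * outCoord y ^ (1 / 2 : ℝ) * (‖y.2‖ ^ 2)⁻¹
            * (Drot i j (v I) y) ^ 2 := by positivity
        unfold carlemanDensity
        linarith
      calc F z / 2 * Real.exp (2 * l * c₂) ≤ F y * Real.exp (l * weight δ y) ^ 2 :=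
            mul_le_mul h2.le hexp (Real.exp_pos _).le (by linarith)
        _ = (‖y.2‖ ^ 2)⁻¹ * ((1 - 2 * δ) * outCoord y ^ (-1 / 2 - δ) * (v I y) ^ 2) := by
            rw [hv1]
            simp only [hF]
            ring
        _ ≤ _ := mul_le_mul_of_nonneg_left (hdens.trans hsingle) (by positivity)
    calc κ * Real.exp (2 * l * c₂) = ∫ _ in B, F z / 2 * Real.exp (2 * l * c₂) := by
          rw [setIntegral_const, smul_eq_mul, hκ]
          ring
      _ ≤ ∫ y in B, (‖y.2‖ ^ 2)⁻¹ * ∑ J, carlemanDensity δ l (v J) y :=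
          setIntegral_mono_on (integrableOn_const hBfin) iDens.integrableOn
            Metric.isOpen_ball.measurableSet hpt
      _ ≤ _ := setIntegral_le_integral iDens (Eventually.of_forall fun y =>
          mul_nonneg (by positivity) (Finset.sum_nonneg fun J _ => hnn y J))
  -- let `T → ∞`, then `l → ∞`
  set H := ∫ y in S, h y with hH
  set l₀ := max 1 (N * (N * (16 * M) ^ 2 * (192 / (1 - 2 * δ)))) with hl₀
  have hbound : ∀ l, l₀ ≤ l → κ * Real.exp (2 * l * (c₂ - c₁)) ≤ A * H := by
    intro l hl
    have hl1 : 1 ≤ l := (le_max_left _ _).trans hl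
    have hl2 := (le_max_right _ _).trans hl
    have hlim : κ * Real.exp (2 * l * c₂) ≤
        A * (Real.exp (2 * l * c₁) * H + Real.exp (2 * l * R) * 0) := by
      refine ge_of_tendsto (((htail.const_mul _).const_add _).const_mul _) ?_
      filter_upwards [eventually_ge_atTop (max 1 (outCoord z + 1))] with T hT
      have hT1 := (le_max_left _ _).trans hT
      exact (hlower T l ((le_max_right _ _).trans hT) hT1 hl1).trans
        (hle T l hT1 hl1 (by linarith))
    have he : Real.exp (2 * l * c₂) = Real.exp (2 * l * (c₂ - c₁)) * Real.exp (2 * l * c₁) := by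
      rw [← Real.exp_add]
      ring_nf
    rw [he, mul_zero, add_zero, ← mul_assoc, mul_comm (Real.exp _) H, ← mul_assoc] at hlim
    exact le_of_mul_le_mul_right hlim (Real.exp_pos _)
  have hgrow : Tendsto (fun l : ℝ => κ * Real.exp (2 * l * (c₂ - c₁))) atTop atTop := by
    refine (Real.tendsto_exp_atTop.comp ?_).const_mul_atTop hκ0
    exact (tendsto_id.const_mul_atTop two_pos).atTop_mul_const (sub_pos.mpr hc₂)
  obtain ⟨l, hl, hl'⟩ := ((eventually_ge_atTop l₀).and
    (hgrow.eventually (eventually_gt_atTop (A * H)))).exists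
  exact absurd (hbound l hl) (not_le.mpr hl')

end

/-! ### From derivatives on the closed region to the wave system -/

theorem partialOn_eq_fderiv {F : Type*} [NormedAddCommGroup F] [NormedSpace ℝ F]
    {S : Set Spacetime} {z : Spacetime} (hz : S ∈ 𝓝 z) (α : Fin 4) (u : Spacetime → F) :
    partialOn S α u z = fderiv ℝ u z (coordDir α) := by
  rw [partialOn, fderivWithin_of_mem_nhds hz]

theorem partialOn_partialOn_eq {S : Set Spacetime} {z : Spacetime} (hz : S ∈ 𝓝 z) (α : Fin 4)
    {u : Spacetime → ℝ} (hu : ContDiffAt ℝ 2 u z) :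
    partialOn S α (partialOn S α u) z = fderiv ℝ (fderiv ℝ u) z (coordDir α) (coordDir α) := by
  have h : partialOn S α u =ᶠ[𝓝 z] fun y => fderiv ℝ u y (coordDir α) := by
    filter_upwards [eventually_mem_nhds_iff.mpr hz] with y hy using partialOn_eq_fderiv hy α u
  have h1 : DifferentiableAt ℝ (fderiv ℝ u) z :=
    (hu.fderiv_right (m := 1) (by norm_num)).differentiableAt (by norm_num)
  rw [partialOn_eq_fderiv hz, h.fderiv_eq, fderiv_clm_apply h1 (differentiableAt_const _)]
  simp

theorem waveOp_eq {S : Set Spacetime} {z : Spacetime} (hz : S ∈ 𝓝 z) {u : Spacetime → ℝ}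
    (hu : ContDiffAt ℝ 2 u z) :
    waveOp S u z = -fderiv ℝ (fderiv ℝ u) z (coordDir 0) (coordDir 0)
      + ∑ i : Fin 3, fderiv ℝ (fderiv ℝ u) z (coordDir i.succ) (coordDir i.succ) := by
  simp only [waveOp, partialOn_partialOn_eq hz _ hu]

section

variable {N : ℕ} {φ : Spacetime → EuclideanSpace ℝ (Fin N)} {z : Spacetime}

theorem ContDiffAt.coord {n : WithTop ℕ∞} (hφ : ContDiffAt ℝ n φ z) (I : Fin N) :
    ContDiffAt ℝ n (fun y => φ y I) z :=
  (EuclideanSpace.proj (𝕜 := ℝ) I).contDiff.contDiffAt.comp z hφ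

theorem fderiv_coord_apply (hφ : DifferentiableAt ℝ φ z) (I : Fin N) (e : Spacetime) :
    fderiv ℝ (fun y => φ y I) z e = (fderiv ℝ φ z e) I := by
  have h := (EuclideanSpace.proj (𝕜 := ℝ) I).hasFDerivAt.comp z hφ.hasFDerivAt
  have h' : HasFDerivAt (fun y => φ y I) _ z := h
  rw [h'.fderiv]
  simp

theorem norm_partialOn_le_gradNormOn {F : Type*} [NormedAddCommGroup F] [NormedSpace ℝ F]
    (S : Set Spacetime) (u : Spacetime → F) (z : Spacetime) (α : Fin 4) :
    ‖partialOn S α u z‖ ≤ gradNormOn S u z := by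
  refine Real.le_sqrt_of_sq_le ?_
  exact Finset.single_le_sum (f := fun α => ‖partialOn S α u z‖ ^ 2)
    (fun _ _ => sq_nonneg _) (Finset.mem_univ α)

theorem dout_eq_half_sum (u : Spacetime → ℝ) (z : Spacetime) :
    Dout u z = 1 / 2 * (fderiv ℝ u z (coordDir 0)
      + ∑ i : Fin 3, z.2 i / ‖z.2‖ * fderiv ℝ u z (coordDir i.succ)) := by
  unfold Dout along
  rw [nullField_eq_sum, map_add, map_sum, map_smul, smul_eq_mul, mul_add, Finset.mul_sum]
  congr 1
  refine Finset.sum_congr rfl fun i _ => ?_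
  rw [map_smul, smul_eq_mul]
  ring

/-- The decay in powers of `1 + t + r` implies decay in powers of `p = t + r ≥ 1`, with a
non-negative constant and a weaker exponent. -/
theorem mul_rpow_le_abs_mul_outCoord_rpow (hp : 1 ≤ outCoord z) (c : ℝ) {s s' : ℝ} (hs : s ≤ s')
    (hs' : s' ≤ 0) : c * (1 + z.1 + ‖z.2‖) ^ s ≤ |c| * outCoord z ^ s' := by
  have e : 1 + z.1 + ‖z.2‖ = 1 + outCoord z := by
    unfold outCoord
    ring
  rw [e]
  have h1 : (1 + outCoord z) ^ s ≤ (1 + outCoord z) ^ s' :=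
    Real.rpow_le_rpow_of_exponent_le (by linarith) hs
  have h2 : (1 + outCoord z) ^ s' ≤ outCoord z ^ s' :=
    Real.rpow_le_rpow_of_nonpos (by linarith) (by linarith) hs'
  exact mul_le_mul (le_abs_self c) (h1.trans h2) (Real.rpow_nonneg (by linarith) _) (abs_nonneg _)

/-- The open set excludes the boundary part `t = Ts`, so that the one-sided derivatives become
ordinary ones. -/
theorem waveSystem_of_region {R'' γ γ' Ts C₁ C₂ : ℝ} (hγ : 0 < γ) (hγ' : 0 < γ')
    (hTs : |R''| + 1 < Ts) {V : Fin N → Fin N → Fin 4 → Spacetime → ℝ}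
    {W : Fin N → Fin N → Spacetime → ℝ}
    (hV : ∀ z ∈ region Ts R'', ∑ I, ∑ J, ∑ α, |V I J α z| ≤ C₁ * (1 + z.1 + ‖z.2‖) ^ (-1 : ℝ))
    (hVW : ∀ z ∈ region Ts R'',
      (∑ I, ∑ J, |∑ α, V I J α z * omegaHat z α|) + (∑ I, ∑ J, |W I J z|)
        ≤ C₁ * (1 + z.1 + ‖z.2‖) ^ (-1 - γ))
    (hφ : ContDiffOn ℝ 2 φ (region Ts R''))
    (heq : ∀ z ∈ region Ts R'', ∀ I, perturbedWaveOp (region Ts R'') V W φ I z = 0)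
    (hbound : ∀ z ∈ region Ts R'', ‖φ z‖ + gradNormOn (region Ts R'') φ z
      ≤ C₂ * (1 + z.1 + ‖z.2‖) ^ (-3 / 2 - γ'))
    (hgood : ∀ z ∈ region Ts R'',
      ‖partialOn (region Ts R'') 0 φ z + radialOn (region Ts R'') φ z‖
        ≤ C₂ * (1 + z.1 + ‖z.2‖) ^ (-5 / 2 - γ')) :
    WaveSystem {z | Ts < z.1 ∧ R'' < inCoord z} |C₁| γ |C₂| V W (fun I y => φ y I) := by
  set U : Set Spacetime := {z | Ts < z.1 ∧ R'' < inCoord z} with hU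
  have hUo : IsOpen U := (isOpen_lt continuous_const continuous_fst).inter
    (isOpen_lt continuous_const continuous_inCoord)
  have hUS : U ⊆ region Ts R'' := fun z hz => ⟨hz.1.le, hz.2⟩
  have hnhds : ∀ z ∈ U, region Ts R'' ∈ 𝓝 z := fun z hz =>
    mem_of_superset (hUo.mem_nhds hz) hUS
  have hpos : ∀ z ∈ U, 1 ≤ outCoord z ∧ z.2 ≠ 0 := fun z hz => by
    have h1 : Ts < z.1 := hz.1
    have h2 : R'' < ‖z.2‖ - z.1 := hz.2
    have h3 := neg_abs_le R''
    have h4 := abs_nonneg R''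
    refine ⟨?_, norm_pos_iff.mp (by linarith)⟩
    unfold outCoord
    linarith [norm_nonneg z.2]
  have hcd : ∀ z ∈ U, ContDiffAt ℝ 2 φ z := fun z hz => hφ.contDiffAt (hnhds z hz)
  have hd : ∀ z ∈ U, DifferentiableAt ℝ φ z := fun z hz =>
    (hcd z hz).differentiableAt (by norm_num)
  have hgrad : ∀ z ∈ U, ‖φ z‖ + gradNormOn (region Ts R'') φ z ≤
      |C₂| * outCoord z ^ (-3 / 2 : ℝ) := fun z hz => (hbound z (hUS hz)).trans
    (mul_rpow_le_abs_mul_outCoord_rpow (hpos z hz).1 _ (by linarith) (by norm_num))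
  have hVW' : ∀ z ∈ U, (∑ I, ∑ J, |∑ α, V I J α z * omegaHat z α|) + (∑ I, ∑ J, |W I J z|) ≤
      |C₁| * outCoord z ^ (-1 - γ) := fun z hz => (hVW z (hUS hz)).trans
    (mul_rpow_le_abs_mul_outCoord_rpow (hpos z hz).1 _ le_rfl (by linarith))
  have hsingle : ∀ (f : Fin N → Fin N → ℝ), (∀ I J, 0 ≤ f I J) → ∀ I J,
      f I J ≤ ∑ I, ∑ J, f I J := fun f hf I J =>
    (Finset.single_le_sum (f := fun J => f I J) (fun J _ => hf I J) (Finset.mem_univ J)).trans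
      (Finset.single_le_sum (f := fun I => ∑ J, f I J)
        (fun I _ => Finset.sum_nonneg fun J _ => hf I J) (Finset.mem_univ I))
  refine ⟨fun z hz I => (hcd z hz).coord I, fun z hz I => ?_, fun z hz I => ?_,
    fun z hz I α => ?_, fun z hz I => ?_, fun z hz I J α => ?_, fun z hz I J => ?_,
    fun z hz I J => ?_⟩
  · have h := heq z (hUS hz) I
    rw [perturbedWaveOp, waveOp_eq (hnhds z hz) ((hcd z hz).coord I)] at h
    simp only [partialOn_eq_fderiv (hnhds z hz)] at h
    rw [nullWave_radius_mul (hpos z hz).2 ((hcd z hz).coord I), Finset.sum_add_distrib]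
    linear_combination ‖z.2‖ * h
  · have h1 : |φ z I| ≤ ‖φ z‖ := PiLp.norm_apply_le (φ z) I
    have h2 : 0 ≤ gradNormOn (region Ts R'') φ z := Real.sqrt_nonneg _
    linarith [hgrad z hz]
  · have h1 : |(fderiv ℝ φ z (coordDir α)) I| ≤ ‖fderiv ℝ φ z (coordDir α)‖ :=
      PiLp.norm_apply_le (fderiv ℝ φ z (coordDir α)) I
    have h2 := norm_partialOn_le_gradNormOn (region Ts R'') φ z α
    rw [partialOn_eq_fderiv (hnhds z hz)] at h2
    rw [fderiv_coord_apply (hd z hz)]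
    linarith [hgrad z hz, norm_nonneg (φ z)]
  · have h1 : (partialOn (region Ts R'') 0 φ z + radialOn (region Ts R'') φ z) I =
        2 * Dout (fun y => φ y I) z := by
      rw [dout_eq_half_sum]
      simp only [radialOn, partialOn_eq_fderiv (hnhds z hz), fderiv_coord_apply (hd z hz)]
      simp
    have h2 : |(partialOn (region Ts R'') 0 φ z + radialOn (region Ts R'') φ z) I| ≤
        ‖partialOn (region Ts R'') 0 φ z + radialOn (region Ts R'') φ z‖ :=
      PiLp.norm_apply_le (partialOn (region Ts R'') 0 φ z + radialOn (region Ts R'') φ z) I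
    rw [h1, abs_mul, abs_two] at h2
    have h3 := (hgood z (hUS hz)).trans (mul_rpow_le_abs_mul_outCoord_rpow (hpos z hz).1 C₂
      (s' := -5 / 2) (by linarith) (by norm_num))
    linarith [abs_nonneg (Dout (fun y => φ y I) z)]
  · have h := (hV z (hUS hz)).trans (mul_rpow_le_abs_mul_outCoord_rpow (hpos z hz).1 C₁ le_rfl
      (by norm_num))
    exact (Finset.single_le_sum (f := fun α => |V I J α z|) (fun _ _ => abs_nonneg _)
      (Finset.mem_univ α)).trans ((hsingle (fun I J => ∑ α, |V I J α z|)
        (fun I J => Finset.sum_nonneg fun _ _ => abs_nonneg _) I J).trans h)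
  · have h1 := hsingle (fun I J => |∑ α, V I J α z * omegaHat z α|) (fun _ _ => abs_nonneg _) I J
    have h2 : 0 ≤ ∑ I, ∑ J, |W I J z| := by positivity
    linarith [hVW' z hz]
  · have h1 := hsingle (fun I J => |W I J z|) (fun _ _ => abs_nonneg _) I J
    have h2 : 0 ≤ ∑ I, ∑ J, |∑ α, V I J α z * omegaHat z α| := by positivity
    linarith [hVW' z hz]

end

/-! ### Choice of the constants -/

/-- A value of `p = t + |x|` beyond which `q ≤ R` forces `t > T₀`. -/
noncomputable def outThreshold (T₀ R : ℝ) : ℝ := 2 * |T₀| + |R| + 1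

/-- The smallness threshold for `δ`. For smaller `δ` the set `f > R''`, `q ≤ R` lies in
`p ≥ outThreshold T₀ R`. -/
noncomputable def deltaThreshold (T₀ R R'' : ℝ) : ℝ :=
  min (1 / 2) (min (1 / (1 + |T₀|)) (1 / (outThreshold T₀ R * (1 + |R - R''|))))

theorem one_le_outThreshold (T₀ R : ℝ) : 1 ≤ outThreshold T₀ R := by
  unfold outThreshold
  linarith [abs_nonneg T₀, abs_nonneg R]

theorem deltaThreshold_pos (T₀ R R'' : ℝ) : 0 < deltaThreshold T₀ R R'' := by
  have h1 := one_le_outThreshold T₀ R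
  have h2 := abs_nonneg T₀
  have h3 := abs_nonneg (R - R'')
  unfold deltaThreshold
  positivity

/-- If `p < P` with `P ≥ 1`, then `δ⁻¹ p^{-δ} ≥ δ⁻¹ / P`, which is large for small `δ`. -/
theorem weight_le_of_outCoord_lt {T₀ R R'' δ : ℝ} (hδ : 0 < δ) (hδ' : δ < deltaThreshold T₀ R R'')
    {z : Spacetime} (hp : 0 < outCoord z) (hz : outCoord z < outThreshold T₀ R)
    (hq : inCoord z ≤ R) : weight δ z ≤ R'' := by
  have h1 := one_le_outThreshold T₀ R
  have h3 := abs_nonneg (R - R'')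
  have hpos : 0 < outThreshold T₀ R * (1 + |R - R''|) := by positivity
  have hδ1 : δ ≤ 1 / 2 := hδ'.le.trans (min_le_left _ _)
  have hδ2 : δ < 1 / (outThreshold T₀ R * (1 + |R - R''|)) :=
    hδ'.trans_le ((min_le_right _ _).trans (min_le_right _ _))
  have h4 : (outThreshold T₀ R)⁻¹ ≤ outCoord z ^ (-δ) := by
    rw [← Real.rpow_neg_one]
    exact (Real.rpow_le_rpow_of_exponent_le h1 (by linarith)).trans
      (Real.rpow_le_rpow_of_nonpos hp hz.le (by linarith))
  have h5 : outThreshold T₀ R * (1 + |R - R''|) ≤ δ⁻¹ := by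
    rw [lt_div_iff₀ hpos] at hδ2
    rw [le_inv_comm₀ hpos hδ, ← one_div, le_div_iff₀ hpos]
    exact hδ2.le
  have h6 : 1 + |R - R''| ≤ δ⁻¹ * outCoord z ^ (-δ) := by
    calc 1 + |R - R''| = outThreshold T₀ R * (1 + |R - R''|) * (outThreshold T₀ R)⁻¹ := by
          field_simp
      _ ≤ _ := mul_le_mul h5 h4 (by positivity) (by positivity)
  unfold weight
  linarith [le_abs_self (R - R'')]

theorem fDelta_lt_weight {δ : ℝ} (hδ : 0 < δ) {z : Spacetime} (ht : 0 < z.1) (hz : z.2 ≠ 0) :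
    fDelta δ z < weight δ z := by
  have h : outCoord z ^ (-δ) < z.1 ^ (-δ) :=
    Real.rpow_lt_rpow_of_neg ht (lt_add_of_pos_right _ (norm_pos_iff.mpr hz)) (by linarith)
  exact sub_lt_sub_left (mul_lt_mul_of_pos_left h (inv_pos.mpr hδ)) _

theorem mainTheorem4 (N : ℕ) :
    ∃ δ₀ : ℝ → ℝ → ℝ → ℝ,
      (∀ T₀ R R'' : ℝ, 0 < δ₀ T₀ R R'' ∧ δ₀ T₀ R R'' ≤ 1 / 2) ∧
      ∀ R R'' γ γ' Ts C₁ C₂ : ℝ,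
        R'' < R → 0 < γ → γ ≤ 1 → 0 < γ' → γ' ≤ 1 → |R''| + 1 < Ts →
        ∃ Tmin : ℝ, Ts ≤ Tmin ∧
          ∀ T₀ : ℝ, Tmin ≤ T₀ → ∀ δ : ℝ, 0 < δ → δ < δ₀ T₀ R R'' →
          ∀ (V : Fin N → Fin N → Fin 4 → Spacetime → ℝ)
            (W : Fin N → Fin N → Spacetime → ℝ)
            (φ : Spacetime → EuclideanSpace ℝ (Fin N)),
            (∀ I J α, ContinuousOn (V I J α) (region Ts R'')) →
            (∀ I J, ContinuousOn (W I J) (region Ts R'')) →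
            (∀ z ∈ region Ts R'',
              ∑ I, ∑ J, ∑ α, |V I J α z| ≤ C₁ * (1 + z.1 + ‖z.2‖) ^ (-1 : ℝ)) →
            (∀ z ∈ region Ts R'',
              (∑ I, ∑ J, |∑ α, V I J α z * omegaHat z α|) + (∑ I, ∑ J, |W I J z|)
                ≤ C₁ * (1 + z.1 + ‖z.2‖) ^ (-1 - γ)) →
            ContDiffOn ℝ 2 φ (region Ts R'') →
            (∀ z ∈ region Ts R'', ∀ I, perturbedWaveOp (region Ts R'') V W φ I z = 0) →
            (∀ z ∈ region Ts R'', R ≤ ‖z.2‖ - z.1 → φ z = 0) →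
            (∀ z ∈ region Ts R'',
              ‖φ z‖ + gradNormOn (region Ts R'') φ z
                ≤ C₂ * (1 + z.1 + ‖z.2‖) ^ (-3 / 2 - γ')) →
            (∀ z ∈ region Ts R'',
              ‖partialOn (region Ts R'') 0 φ z + radialOn (region Ts R'') φ z‖
                ≤ C₂ * (1 + z.1 + ‖z.2‖) ^ (-5 / 2 - γ')) →
            ∀ z ∈ region T₀ R'' ∩ {z | R'' ≤ fDelta δ z}, φ z = 0 := by
  refine ⟨deltaThreshold, fun T₀ R R'' => ⟨deltaThreshold_pos _ _ _, min_le_left _ _⟩, ?_⟩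
  intro R R'' γ γ' Ts C₁ C₂ hRR hγ _ hγ' _ hTs
  -- `T₀ ≥ 1 / γ` makes `δ ≤ γ`, and the other terms make the region thin in comparison with `T₀`
  refine ⟨Ts + 1 / γ + 8 * (|R| + |R''|), ?_, ?_⟩
  · have : 0 ≤ 1 / γ := by positivity
    linarith [abs_nonneg R, abs_nonneg R'']
  intro T₀ hT₀ δ hδ hδ' V W φ _ _ hV hVW hφ heq hvan hbound hgood
  have hinv : 0 < 1 / γ := by positivity
  have a1 := abs_nonneg R
  have a2 := abs_nonneg R''
  have hT₀1 : 1 ≤ T₀ := by linarith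
  have hTsT₀ : Ts ≤ T₀ := by linarith
  have habs : |T₀| = T₀ := abs_of_pos (by linarith)
  have hδ2 : δ < 1 / 2 := hδ'.trans_le (min_le_left _ _)
  have hδγ : δ ≤ 2 * γ := by
    have h1 : δ < 1 / (1 + |T₀|) := hδ'.trans_le ((min_le_right _ _).trans (min_le_left _ _))
    have h2 : 1 / (1 + |T₀|) ≤ 1 / (1 / γ) :=
      one_div_le_one_div_of_le hinv (by rw [habs]; linarith)
    rw [one_div_one_div] at h2
    linarith
  have hu := waveSystem_of_region hγ hγ' hTs hV hVW hφ heq hbound hgood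
  set U : Set Spacetime := {z | Ts < z.1 ∧ R'' < inCoord z} with hU
  have hP := one_le_outThreshold T₀ R
  have hUp : ∀ z ∈ U, 0 < outCoord z := fun z hz => by
    have : Ts < z.1 := hz.1
    unfold outCoord
    linarith [norm_nonneg z.2]
  have hvan' : ∀ z ∈ U, R < inCoord z → ∀ I, φ z I = 0 := fun z hz hR I => by
    rw [hvan z ⟨hz.1.le, hz.2⟩ hR.le]
    rfl
  rintro z ⟨⟨hzT, hzR⟩, hzf⟩
  have hzf' : R'' ≤ fDelta δ z := hzf
  have hz0 : z.2 ≠ 0 := norm_pos_iff.mp (by linarith [neg_abs_le R''])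
  have hzp : 0 < outCoord z := by
    unfold outCoord
    linarith [norm_nonneg z.2]
  have hzw : R'' < weight δ z := hzf'.trans_lt (fDelta_lt_weight hδ (by linarith) hz0)
  by_cases hzq : R ≤ inCoord z
  · exact hvan z ⟨hTsT₀.trans hzT, hzR⟩ hzq
  have hzq' : inCoord z ≤ R := (not_le.mp hzq).le
  obtain ⟨c₀, hc₀, hc₀z⟩ := exists_between hzw
  have hG : AdmissibleRegion U δ c₀ R (outThreshold T₀ R) T₀ (|R| + |R''|) := by
    refine ⟨(isOpen_lt continuous_const continuous_fst).inter
      (isOpen_lt continuous_const continuous_inCoord), hP, hT₀1, by positivity, by linarith,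
      fun y h1 h2 h3 => ?_, fun y hy h1 h2 => ?_⟩
    · have h4 : R'' < inCoord y :=
        hc₀.trans_le (h2.trans (weight_le_inCoord hδ (by linarith)))
      have h5 : T₀ < y.1 := by
        have b1 := le_abs_self R
        unfold outThreshold outCoord at h1
        unfold inCoord at h3
        rw [habs] at h1
        linarith
      refine ⟨⟨hTsT₀.trans_lt h5, h4⟩, h5.le, abs_le.mpr ⟨?_, ?_⟩⟩
      · linarith [neg_abs_le R'']
      · linarith [le_abs_self R]
    · exact (weight_le_of_outCoord_lt hδ hδ' (hUp y hy) h1 h2).trans hc₀.le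
  have hTsz : Ts < z.1 := by
    have : 0 < 1 / γ := hinv
    linarith
  ext I
  exact hu.eq_zero_of_lt_weight (abs_nonneg _) (abs_nonneg _) hγ.le hG hδ hδ2 hδγ hvan'
    ⟨hTsz, hzR⟩ hz0 hzp hc₀z I
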